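/- Let $(M^n,g)$ be a compact Riemannian manifold without boundary, $n\ge 1$, which is a gradient shrinking Ricci soliton with potential $f\in C^\infty(M)$ and scale $\tau>0$: $$Rc+\nabla^2 f=\frac{1}{2\tau}\,g .$$ For a Riemannian metric $\tilde g$ on $M$, $\tilde f\in C^\infty(M)$ and $\tilde\tau>0$ let $$\mathcal W(\tilde g,\tilde f,\tilde\tau)=\int_M\big[\tilde\tau(R_{\tilde g}+|\nabla \tilde f|_{\tilde g}^2)+\tilde f-n\big](4\pi\tilde\tau)^{-n/2}e^{-\tilde f}\,dV_{\tilde g},$$ $$\nu(\tilde g)=\inf\Big\{\mathcal W(\tilde g,\tilde f,\tilde\tau)\;:\;\tilde f\in C^\infty(M),\ \tilde\tau>0,\ (4\pi\tilde\tau)^{-n/2}\int_M e^{-\tilde f}\,dV_{\tilde g}=1\Big\},$$ and say that an admissible pair $(\tilde f,\tilde\tau)$ realizes $\nu(\tilde g)$ if the infimum is attained at it. Let $h$ be a smooth symmetric 2-tensor and $g(s)=g+sh$. Suppose that for some $\varepsilon>0$ there are pairs $(f_s,\tau_s)$, $|s|<\varepsilon$, such that $(f_s,\tau_s)$ realizes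 $\nu(g(s))$ for every such $s$, $(f_0,\tau_0)=(f,\tau)$, and $(s,x)\mapsto f_s(x)$ is smooth on $(-\varepsilon,\varepsilon)\times M$. Then $\int_M R\,e^{-f}\,dV\neq 0$, the function $s\mapsto\tau_s$ is differentiable at $s=0$, and its derivative $\delta\tau=\frac{d}{ds}\big|_{s=0}\tau_s$ is $$\delta\tau=\tau\,\frac{\int_M\langle Rc,h\rangle e^{-f}\,dV}{\int_M R\,e^{-f}\,dV},$$ where $Rc$, $R$, $\langle\cdot,\cdot\rangle$ and $dV$ are those of $g$. -/

import Mathlib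

open scoped Manifold ContDiff
open MeasureTheory

namespace ShrinkerEntropy

noncomputable section

/-! ### Riemannian geometry of a matrix-valued function on an open subset of `ℝⁿ`

Throughout, `G u i j` are the components `g_ij(u)` of a metric in local coordinates. -/

/-- The partial derivative `∂_i F` at `u`. -/
def pd {n : ℕ} (i : Fin n) (F : EuclideanSpace ℝ (Fin n) → ℝ) (u : EuclideanSpace ℝ (Fin n)) : ℝ :=
  fderiv ℝ F u (EuclideanSpace.single i (1 : ℝ))

/-- Christoffel symbols
`Γ^k_ij = ½ ∑_l g^{kl} (∂_i g_jl + ∂_j g_il - ∂_l g_ij)` of the Levi-Civita connection. -/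
def christoffel {n : ℕ} (G : EuclideanSpace ℝ (Fin n) → Matrix (Fin n) (Fin n) ℝ)
    (k i j : Fin n) (u : EuclideanSpace ℝ (Fin n)) : ℝ :=
  (1 / 2 : ℝ) * ∑ l, (G u)⁻¹ k l *
    (pd i (fun v => G v j l) u + pd j (fun v => G v i l) u - pd l (fun v => G v i j) u)

/-- Ricci tensor
`R_ij = ∑_k (∂_k Γ^k_ij - ∂_j Γ^k_ik) + ∑_{k,l} (Γ^k_kl Γ^l_ij - Γ^k_jl Γ^l_ik)`
(positive on round spheres). -/
def ricciLocal {n : ℕ} (G : EuclideanSpace ℝ (Fin n) → Matrix (Fin n) (Fin n) ℝ)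
    (u : EuclideanSpace ℝ (Fin n)) : Matrix (Fin n) (Fin n) ℝ :=
  Matrix.of fun i j =>
    ∑ k, (pd k (christoffel G k i j) u - pd j (christoffel G k i k) u) +
    ∑ k, ∑ l, (christoffel G k k l u * christoffel G l i j u -
      christoffel G k j l u * christoffel G l i k u)

/-- Hessian `∇_i ∇_j F = ∂_i ∂_j F - ∑_k Γ^k_ij ∂_k F`. -/
def hessLocal {n : ℕ} (G : EuclideanSpace ℝ (Fin n) → Matrix (Fin n) (Fin n) ℝ)
    (F : EuclideanSpace ℝ (Fin n) → ℝ) (u : EuclideanSpace ℝ (Fin n)) :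
    Matrix (Fin n) (Fin n) ℝ :=
  Matrix.of fun i j => pd i (pd j F) u - ∑ k, christoffel G k i j u * pd k F u

/-! ### Tensors on a manifold -/

/-- A field of bilinear forms on the tangent spaces of the `n`-manifold `M` (a covariant 2-tensor
field, with no regularity or symmetry built in). -/
abbrev Tensor2 (n : ℕ) (M : Type*) [TopologicalSpace M] [ChartedSpace (EuclideanSpace ℝ (Fin n)) M] :
    Type _ :=
  ∀ x : M, TangentSpace (𝓡 n) x →L[ℝ] TangentSpace (𝓡 n) x →L[ℝ] ℝ

/-- Smoothness (`C^∞`) of a 2-tensor field, as a section of the bundle of bilinear forms on `TM`. -/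
def Tensor2.Smooth {n : ℕ} {M : Type*} [TopologicalSpace M]
    [ChartedSpace (EuclideanSpace ℝ (Fin n)) M] [IsManifold (𝓡 n) ∞ M] (h : Tensor2 n M) : Prop :=
  ContMDiff (𝓡 n)
    ((𝓡 n).prod 𝓘(ℝ, EuclideanSpace ℝ (Fin n) →L[ℝ] EuclideanSpace ℝ (Fin n) →L[ℝ] ℝ)) ∞
    (fun x : M => Bundle.TotalSpace.mk'
      (EuclideanSpace ℝ (Fin n) →L[ℝ] EuclideanSpace ℝ (Fin n) →L[ℝ] ℝ) x (h x))

section Geometry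

variable {n : ℕ} {M : Type*} [TopologicalSpace M] [ChartedSpace (EuclideanSpace ℝ (Fin n)) M]

/-- The coordinate vector field `∂_i` of the chart around `c`, at the point with coordinates `u`. -/
def coordVec (c : M) (u : EuclideanSpace ℝ (Fin n)) (i : Fin n) :
    TangentSpace (𝓡 n) ((chartAt (EuclideanSpace ℝ (Fin n)) c).symm u) :=
  mfderiv (𝓡 n) (𝓡 n) (chartAt (EuclideanSpace ℝ (Fin n)) c).symm u
    (EuclideanSpace.single i (1 : ℝ))

/-- The components `h_ij = h(∂_i, ∂_j)` of a 2-tensor in the chart around `c`, as functions of the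
coordinates. -/
def comps (h : Tensor2 n M) (c : M) (u : EuclideanSpace ℝ (Fin n)) : Matrix (Fin n) (Fin n) ℝ :=
  Matrix.of fun i j =>
    h ((chartAt (EuclideanSpace ℝ (Fin n)) c).symm u) (coordVec c u i) (coordVec c u j)

/-- A function in the coordinates of the chart around `c`. -/
def funComp (f : M → ℝ) (c : M) (u : EuclideanSpace ℝ (Fin n)) : ℝ :=
  f ((chartAt (EuclideanSpace ℝ (Fin n)) c).symm u)

/-- The coordinates of `p` in the chart around `p`. -/
def coord (p : M) : EuclideanSpace ℝ (Fin n) := chartAt (EuclideanSpace ℝ (Fin n)) p p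

/-! The following tensors at `p` are given by their components in the chart around `p`; being
tensorial, they can be computed in any chart. -/

/-- The components of the 2-tensor `h` at `p`. -/
def compsAt (h : Tensor2 n M) (p : M) : Matrix (Fin n) (Fin n) ℝ := comps h p (coord p)

/-- The Ricci tensor `R_ij` of the metric `g` at `p`. -/
def ricci (g : Tensor2 n M) (p : M) : Matrix (Fin n) (Fin n) ℝ := ricciLocal (comps g p) (coord p)

/-- The Hessian `∇_i ∇_j f` at `p`, for the metric `g`. -/
def hess (g : Tensor2 n M) (f : M → ℝ) (p : M) : Matrix (Fin n) (Fin n) ℝ :=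
  hessLocal (comps g p) (funComp f p) (coord p)

/-- The scalar curvature `R = g^{ij} R_ij`. -/
def scal (g : Tensor2 n M) (p : M) : ℝ :=
  ∑ i, ∑ j, (compsAt g p)⁻¹ i j * ricci g p i j

/-- `|∇f|² = g^{ij} ∂_i f ∂_j f`. -/
def gradSq (g : Tensor2 n M) (f : M → ℝ) (p : M) : ℝ :=
  ∑ i, ∑ j, (compsAt g p)⁻¹ i j *
    (pd i (funComp f p) (coord p) * pd j (funComp f p) (coord p))

/-- The inner product `⟨Rc, h⟩ = g^{ik} g^{jl} R_ij h_kl`. -/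
def ricciInner (g h : Tensor2 n M) (p : M) : ℝ :=
  ∑ i, ∑ j, ∑ k, ∑ l,
    (compsAt g p)⁻¹ i k * (compsAt g p)⁻¹ j l * ricci g p i j * compsAt h p k l

variable [MeasurableSpace M]

/-- The Riemannian volume measure on the domain of the chart around `c`: the image under the inverse
chart of `√(det g_ij) du`. -/
def chartVol (g : Tensor2 n M) (c : M) : Measure M :=
  ((volume.restrict (chartAt (EuclideanSpace ℝ (Fin n)) c).target).withDensity
    (fun u => ENNReal.ofReal (Real.sqrt (comps g c u).det))).map
      (chartAt (EuclideanSpace ℝ (Fin n)) c).symm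

/-- The Riemannian volume measure `dV`. By the change of variables formula the measures on the chart
domains agree on overlaps, so their supremum is the measure that restricts to each of them. -/
def vol (g : Tensor2 n M) : Measure M := ⨆ c : M, chartVol g c

/-! ### Perelman's `𝒲`-functional and the `ν`-entropy -/

/-- `𝒲(g,f,τ) = ∫_M [τ(R + |∇f|²) + f - n] (4πτ)^{-n/2} e^{-f} dV`. -/
def W (g : Tensor2 n M) (f : M → ℝ) (τ : ℝ) : ℝ :=
  ∫ x, (τ * (scal g x + gradSq g f x) + f x - n) *
    (4 * Real.pi * τ) ^ (-(n : ℝ) / 2) * Real.exp (-f x) ∂(vol g)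

/-- The pairs `(f, τ)` admitted in the definition of `ν(g)`: `f ∈ C^∞(M)`, `τ > 0` and
`(4πτ)^{-n/2} ∫_M e^{-f} dV = 1`. -/
def Admissible (g : Tensor2 n M) (f : M → ℝ) (τ : ℝ) : Prop :=
  ContMDiff (𝓡 n) 𝓘(ℝ, ℝ) ∞ f ∧ 0 < τ ∧
    (4 * Real.pi * τ) ^ (-(n : ℝ) / 2) * ∫ x, Real.exp (-f x) ∂(vol g) = 1

/-- The `ν`-entropy, the infimum of `𝒲(g,f,τ)` over all admissible pairs, as an extended real. -/
def nu (g : Tensor2 n M) : EReal :=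
  sInf {w : EReal | ∃ f : M → ℝ, ∃ τ : ℝ, Admissible g f τ ∧ w = ((W g f τ : ℝ) : EReal)}

/-- The pair `(f, τ)` realizes `ν(g)`. -/
def Realizes (g : Tensor2 n M) (f : M → ℝ) (τ : ℝ) : Prop :=
  Admissible g f τ ∧ ((W g f τ : ℝ) : EReal) = nu g

/-- `g` is a gradient shrinking Ricci soliton with potential function `f` and scale `τ > 0`:
`R_ij + ∇_i ∇_j f = g_ij / (2τ)`. -/
def IsGradientShrinker (g : Tensor2 n M) (f : M → ℝ) (τ : ℝ) : Prop :=
  ContMDiff (𝓡 n) 𝓘(ℝ, ℝ) ∞ f ∧ 0 < τ ∧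
    ∀ p : M, ricci g p + hess g f p = (1 / (2 * τ)) • compsAt g p

end Geometry

end

end ShrinkerEntropy

open scoped Manifold ContDiff
open MeasureTheory

namespace ShrinkerEntropy

noncomputable section

open Filter Topology

/-! ### Calculus of partial derivatives -/

section Calculus

variable {n : ℕ}

/-! Each pair `(F s, T s)` minimizes `𝒲` for the metric `g + s h`, so it is stationary in two
directions. Changing the scale while the density `(4πτ)^{-n/2} e^{-f}` is kept fixed gives `τ ∫ (R +
|∇f|²) e^{-f} = (n/2) ∫ e^{-f}` (`Realizes.scale_equation`). Changing the potential at fixed scale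
gives the weak Euler-Lagrange equation (`Realizes.potential_equation`); tested with `f` itself it
becomes a second scalar identity (`Realizes.potential_equation_self`). Both scalar identities hold
for all small `s`, so they can be differentiated at `s = 0`. The scale is differentiable because the
normalization expresses it as a power of `∫ e^{-F s} dV` (`Admissible.mass_eq`).

The differentiated identities contain the unknown derivatives `T'` of the scale, `v` of the
potential and `R'` of the scalar curvature. The last occurs only integrated against `e^{-f}` and `f
e^{-f}`, where the integrated Palatini formula `∫ χ R' = ∫ (-χ⟨Rc,h⟩ + ⟨h,∇²χ⟩ - tr h Δχ)`
(`integral_variation_scal`) removes it. No equation for `v` has to be solved: its contributions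
cancel by Green's identity for `e^{-f} dV` and by the potential equation at `s = 0`, tested with
functions built from `v`, `tr h` and `f`. The soliton equation and its trace eliminate `R` and
`⟨Rc,h⟩` in favour of `Δf` and `⟨h,∇²f⟩`, and what survives is `T' ∫ R e^{-f} = τ ∫ ⟨Rc,h⟩ e^{-f}`
(`mul_apply_scal_eq`).

It remains to divide. Bochner's formula for `f`, integrated on the shrinker and combined with the
potential equation, gives `∫ R e^{-f} = 2τ ∫ |Rc|² e^{-f}` (`integral_scal_eq_ricSq`). If this
vanished, `R² ≤ n|Rc|²` would force `R = 0` almost everywhere; but integrating `R + Δf = n/(2τ)`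
over `M` then gives zero volume (`integral_scal_ne_zero`).

All tensors are given by components in charts, so the integrations by parts are done in charts and
glued by a partition of unity, which requires every integrand to be independent of the chart.
Invariance is obtained without transformation laws for Christoffel symbols or curvature: inner
products of gradients are invariant, the Hessian is a combination of such products
(`IsLocalMetric.hess_gr_gr`), and Bochner's formula (`IsLocalMetric.bochner`) expresses `Rc(∇a,∇a)`
through invariant quantities. This reaches the symmetric part of the Ricci tensor, which is all that
the contractions see. -/

lemma two_le_infty : (2 : WithTop ℕ∞) ≤ ∞ :=
  WithTop.coe_le_coe.2 (le_top : (2 : ℕ∞) ≤ ⊤)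

lemma pd_congr {i : Fin n} {a b : EuclideanSpace ℝ (Fin n) → ℝ} {u : EuclideanSpace ℝ (Fin n)}
    (h : a =ᶠ[𝓝 u] b) : pd i a u = pd i b u := by
  unfold pd; rw [h.fderiv_eq]

lemma pd_const (i : Fin n) (r : ℝ) (u : EuclideanSpace ℝ (Fin n)) :
    pd i (fun _ => r) u = 0 := by
  simp [pd]

lemma pd_add {i : Fin n} {a b : EuclideanSpace ℝ (Fin n) → ℝ} {u : EuclideanSpace ℝ (Fin n)}
    (ha : DifferentiableAt ℝ a u) (hb : DifferentiableAt ℝ b u) :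
    pd i (fun v => a v + b v) u = pd i a u + pd i b u := by
  unfold pd; rw [fderiv_fun_add ha hb]; rfl

lemma pd_sub {i : Fin n} {a b : EuclideanSpace ℝ (Fin n) → ℝ} {u : EuclideanSpace ℝ (Fin n)}
    (ha : DifferentiableAt ℝ a u) (hb : DifferentiableAt ℝ b u) :
    pd i (fun v => a v - b v) u = pd i a u - pd i b u := by
  unfold pd; rw [fderiv_fun_sub ha hb]; rfl

lemma pd_mul {i : Fin n} {a b : EuclideanSpace ℝ (Fin n) → ℝ} {u : EuclideanSpace ℝ (Fin n)}
    (ha : DifferentiableAt ℝ a u) (hb : DifferentiableAt ℝ b u) :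
    pd i (fun v => a v * b v) u = pd i a u * b u + a u * pd i b u := by
  unfold pd; rw [fderiv_fun_mul ha hb]; simp; ring

lemma pd_const_mul {i : Fin n} {a : EuclideanSpace ℝ (Fin n) → ℝ} {u : EuclideanSpace ℝ (Fin n)}
    (r : ℝ) (ha : DifferentiableAt ℝ a u) :
    pd i (fun v => r * a v) u = r * pd i a u := by
  unfold pd; rw [fderiv_const_mul ha]; simp

lemma pd_sum {κ : Type*} {i : Fin n} {t : Finset κ} {a : κ → EuclideanSpace ℝ (Fin n) → ℝ}
    {u : EuclideanSpace ℝ (Fin n)} (ha : ∀ k ∈ t, DifferentiableAt ℝ (a k) u) :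
    pd i (fun v => ∑ k ∈ t, a k v) u = ∑ k ∈ t, pd i (a k) u := by
  unfold pd; rw [fderiv_fun_sum ha]; simp

lemma pd_comp {i : Fin n} {η : ℝ → ℝ} {η' : ℝ} {a : EuclideanSpace ℝ (Fin n) → ℝ}
    {u : EuclideanSpace ℝ (Fin n)} (hη : HasDerivAt η η' (a u)) (ha : DifferentiableAt ℝ a u) :
    pd i (fun v => η (a v)) u = η' * pd i a u := by
  unfold pd
  have : HasFDerivAt (fun v => η (a v)) (η' • fderiv ℝ a u) u :=
    hη.comp_hasFDerivAt u ha.hasFDerivAt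
  rw [this.fderiv]; simp

/-- Joint smoothness of a one-parameter family of functions at a parameter and a point. -/
def SmAt (Φ : ℝ → EuclideanSpace ℝ (Fin n) → ℝ) (s : ℝ) (u : EuclideanSpace ℝ (Fin n)) : Prop :=
  ContDiffAt ℝ ∞ (fun q : ℝ × EuclideanSpace ℝ (Fin n) => Φ q.1 q.2) (s, u)

namespace SmAt

variable {Φ Ψ : ℝ → EuclideanSpace ℝ (Fin n) → ℝ} {s : ℝ} {u : EuclideanSpace ℝ (Fin n)}

lemma add (hΦ : SmAt Φ s u) (hΨ : SmAt Ψ s u) : SmAt (fun s v => Φ s v + Ψ s v) s u :=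
  ContDiffAt.add hΦ hΨ

lemma sub (hΦ : SmAt Φ s u) (hΨ : SmAt Ψ s u) : SmAt (fun s v => Φ s v - Ψ s v) s u :=
  ContDiffAt.sub hΦ hΨ

lemma mul (hΦ : SmAt Φ s u) (hΨ : SmAt Ψ s u) : SmAt (fun s v => Φ s v * Ψ s v) s u :=
  ContDiffAt.mul hΦ hΨ

lemma const (r : ℝ) : SmAt (fun _ _ => r) s u := contDiffAt_const

lemma const_mul (r : ℝ) (hΦ : SmAt Φ s u) : SmAt (fun s v => r * Φ s v) s u :=
  (const r).mul hΦ

lemma sum {κ : Type*} {t : Finset κ} {Φ : κ → ℝ → EuclideanSpace ℝ (Fin n) → ℝ}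
    (h : ∀ k ∈ t, SmAt (Φ k) s u) : SmAt (fun s v => ∑ k ∈ t, Φ k s v) s u :=
  ContDiffAt.sum h

lemma prod {κ : Type*} {t : Finset κ} {Φ : κ → ℝ → EuclideanSpace ℝ (Fin n) → ℝ}
    (h : ∀ k ∈ t, SmAt (Φ k) s u) : SmAt (fun s v => ∏ k ∈ t, Φ k s v) s u :=
  contDiffAt_prod h

lemma inv (hΦ : SmAt Φ s u) (h0 : Φ s u ≠ 0) : SmAt (fun s v => (Φ s v)⁻¹) s u :=
  ContDiffAt.inv hΦ h0

lemma sqrt (hΦ : SmAt Φ s u) (h0 : Φ s u ≠ 0) : SmAt (fun s v => Real.sqrt (Φ s v)) s u :=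
  ContDiffAt.sqrt hΦ h0

lemma static {a : EuclideanSpace ℝ (Fin n) → ℝ} (ha : ContDiffAt ℝ ∞ a u) :
    SmAt (fun _ => a) s u :=
  ContDiffAt.comp (s, u) (g := a) ha contDiffAt_snd

lemma slice (hΦ : SmAt Φ s u) : ContDiffAt ℝ ∞ (Φ s) u :=
  ContDiffAt.comp (f := fun v => (s, v)) u hΦ (contDiffAt_const.prodMk contDiffAt_id)

lemma param (hΦ : SmAt Φ s u) : ContDiffAt ℝ ∞ (fun s => Φ s u) s :=
  ContDiffAt.comp (f := fun s => (s, u)) s hΦ (contDiffAt_id.prodMk contDiffAt_const)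

lemma eventually_differentiableAt (hΦ : SmAt Φ s u) : ∀ᶠ q in 𝓝 (s, u),
    DifferentiableAt ℝ (fun q : ℝ × EuclideanSpace ℝ (Fin n) => Φ q.1 q.2) q := by
  -- Order `∞` at a point need not persist on one neighbourhood; finite order does, and order one is
  -- enough.
  have h1 : ContDiffAt ℝ 1 (fun q : ℝ × EuclideanSpace ℝ (Fin n) => Φ q.1 q.2) (s, u) :=
    hΦ.of_le (by simp)
  filter_upwards [h1.eventually (by simp)] with q hq using hq.differentiableAt one_ne_zero

/-- Writing slice derivatives as the joint derivative in a fixed direction is what makes `SmAt`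
stable under `pd` and, with `deriv_eq`, under the parameter derivative. -/
lemma pd_eq {Φ : ℝ → EuclideanSpace ℝ (Fin n) → ℝ} {q : ℝ × EuclideanSpace ℝ (Fin n)} (i : Fin n)
    (h : DifferentiableAt ℝ (fun q : ℝ × EuclideanSpace ℝ (Fin n) => Φ q.1 q.2) q) :
    pd i (Φ q.1) q.2 = fderiv ℝ (fun q : ℝ × EuclideanSpace ℝ (Fin n) => Φ q.1 q.2) q
      (0, EuclideanSpace.single i 1) := by
  have h1 : HasFDerivAt (fun v : EuclideanSpace ℝ (Fin n) => (q.1, v))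
      (ContinuousLinearMap.inr ℝ ℝ (EuclideanSpace ℝ (Fin n))) q.2 := hasFDerivAt_prodMk_right _ _
  have h2 := HasFDerivAt.comp (g := fun q : ℝ × EuclideanSpace ℝ (Fin n) => Φ q.1 q.2) q.2
    (f := fun v => (q.1, v)) h.hasFDerivAt h1
  have h3 : fderiv ℝ (Φ q.1) q.2 = _ := h2.fderiv
  unfold ShrinkerEntropy.pd
  rw [h3]; simp

lemma deriv_eq {Φ : ℝ → EuclideanSpace ℝ (Fin n) → ℝ} {q : ℝ × EuclideanSpace ℝ (Fin n)}
    (h : DifferentiableAt ℝ (fun q : ℝ × EuclideanSpace ℝ (Fin n) => Φ q.1 q.2) q) :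
    deriv (fun s => Φ s q.2) q.1 =
      fderiv ℝ (fun q : ℝ × EuclideanSpace ℝ (Fin n) => Φ q.1 q.2) q (1, 0) := by
  have h1 : HasFDerivAt (fun s : ℝ => (s, q.2))
      (ContinuousLinearMap.inl ℝ ℝ (EuclideanSpace ℝ (Fin n))) q.1 := hasFDerivAt_prodMk_left _ _
  have h2 := HasFDerivAt.comp (g := fun q : ℝ × EuclideanSpace ℝ (Fin n) => Φ q.1 q.2) q.1
    (f := fun s => (s, q.2)) h.hasFDerivAt h1
  have h3 : fderiv ℝ (fun s => Φ s q.2) q.1 = _ := h2.fderiv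
  rw [← fderiv_apply_one_eq_deriv, h3]; simp

lemma fderiv_apply (hΦ : SmAt Φ s u) (w : ℝ × EuclideanSpace ℝ (Fin n)) :
    ContDiffAt ℝ ∞ (fun q => fderiv ℝ
      (fun q : ℝ × EuclideanSpace ℝ (Fin n) => Φ q.1 q.2) q w) (s, u) :=
  (ContDiffAt.fderiv_right (m := ∞) hΦ (by simp)).clm_apply contDiffAt_const

lemma pd (i : Fin n) (hΦ : SmAt Φ s u) : SmAt (fun s v => pd i (Φ s) v) s u := by
  refine ContDiffAt.congr_of_eventuallyEq (hΦ.fderiv_apply (0, EuclideanSpace.single i 1)) ?_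
  filter_upwards [hΦ.eventually_differentiableAt] with q hq using pd_eq i hq

lemma deriv (hΦ : SmAt Φ s u) : SmAt (fun s v => deriv (fun s => Φ s v) s) s u := by
  refine ContDiffAt.congr_of_eventuallyEq (hΦ.fderiv_apply (1, 0)) ?_
  filter_upwards [hΦ.eventually_differentiableAt] with q hq using deriv_eq hq

/-- Both sides are second derivatives of one joint function in the directions `(1, 0)` and `(0,
eᵢ)`, so symmetry of the second derivative applies. -/
lemma pd_deriv_comm (i : Fin n) (hΦ : SmAt Φ s u) :
    ShrinkerEntropy.pd i (fun v => _root_.deriv (fun s => Φ s v) s) u =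
      _root_.deriv (fun s => ShrinkerEntropy.pd i (Φ s) u) s := by
  have hd := hΦ.deriv
  have hp := hΦ.pd i
  have hdd : DifferentiableAt ℝ (fun q : ℝ × EuclideanSpace ℝ (Fin n) =>
      _root_.deriv (fun s => Φ s q.2) q.1) (s, u) := ContDiffAt.differentiableAt hd (by simp)
  have hpd : DifferentiableAt ℝ (fun q : ℝ × EuclideanSpace ℝ (Fin n) =>
      ShrinkerEntropy.pd i (Φ q.1) q.2) (s, u) := ContDiffAt.differentiableAt hp (by simp)
  have e1 := pd_eq (Φ := fun s v => _root_.deriv (fun s => Φ s v) s) (q := (s, u)) i hdd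
  have e2 := deriv_eq (Φ := fun s v => ShrinkerEntropy.pd i (Φ s) v) (q := (s, u)) hpd
  simp only at e1 e2
  rw [e1, e2]
  have c1 : (fun q : ℝ × EuclideanSpace ℝ (Fin n) => _root_.deriv (fun s => Φ s q.2) q.1) =ᶠ[𝓝 (s, u)]
      fun q => fderiv ℝ (fun q : ℝ × EuclideanSpace ℝ (Fin n) => Φ q.1 q.2) q (1, 0) := by
    filter_upwards [hΦ.eventually_differentiableAt] with q hq using deriv_eq hq
  have c2 : (fun q : ℝ × EuclideanSpace ℝ (Fin n) => ShrinkerEntropy.pd i (Φ q.1) q.2) =ᶠ[𝓝 (s, u)]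
      fun q => fderiv ℝ (fun q : ℝ × EuclideanSpace ℝ (Fin n) => Φ q.1 q.2) q
        (0, EuclideanSpace.single i 1) := by
    filter_upwards [hΦ.eventually_differentiableAt] with q hq using pd_eq i hq
  rw [c1.fderiv_eq, c2.fderiv_eq]
  have hF : DifferentiableAt ℝ (fderiv ℝ
      (fun q : ℝ × EuclideanSpace ℝ (Fin n) => Φ q.1 q.2)) (s, u) :=
    (ContDiffAt.fderiv_right (m := ∞) hΦ (by simp)).differentiableAt (by simp)
  have hs : IsSymmSndFDerivAt ℝ (fun q : ℝ × EuclideanSpace ℝ (Fin n) => Φ q.1 q.2) (s, u) :=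
    ContDiffAt.isSymmSndFDerivAt hΦ (by simpa using two_le_infty)
  rw [fderiv_clm_apply hF (differentiableAt_const _), fderiv_clm_apply hF (differentiableAt_const _)]
  simp [hs.eq (1, 0) (0, EuclideanSpace.single i 1)]

lemma differentiableAt (hΦ : SmAt Φ s u) : DifferentiableAt ℝ (Φ s) u :=
  hΦ.slice.differentiableAt (by simp)

lemma hasDerivAt (hΦ : SmAt Φ s u) :
    HasDerivAt (fun s => Φ s u) (_root_.deriv (fun s => Φ s u) s) s :=
  (hΦ.param.differentiableAt (by simp)).hasDerivAt

end SmAt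

lemma contDiffAt_pd {a : EuclideanSpace ℝ (Fin n) → ℝ} {u : EuclideanSpace ℝ (Fin n)} (i : Fin n)
    (ha : ContDiffAt ℝ ∞ a u) : ContDiffAt ℝ ∞ (pd i a) u :=
  ((SmAt.static (s := 0) ha).pd i).slice

lemma pd_pd_comm {a : EuclideanSpace ℝ (Fin n) → ℝ} {u : EuclideanSpace ℝ (Fin n)} (i j : Fin n)
    (ha : ContDiffAt ℝ ∞ a u) : pd i (pd j a) u = pd j (pd i a) u := by
  have hs : IsSymmSndFDerivAt ℝ a u := ha.isSymmSndFDerivAt (by simpa using two_le_infty)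
  have hF : DifferentiableAt ℝ (fderiv ℝ a) u :=
    (ContDiffAt.fderiv_right (m := ∞) ha (by simp)).differentiableAt (by simp)
  unfold pd
  rw [fderiv_clm_apply hF (differentiableAt_const _), fderiv_clm_apply hF (differentiableAt_const _)]
  simp [hs.eq (EuclideanSpace.single i 1) (EuclideanSpace.single j 1)]

end Calculus

/-! ### Smooth families of metrics -/

section MetricFamilies

variable {n : ℕ} {G : ℝ → EuclideanSpace ℝ (Fin n) → Matrix (Fin n) (Fin n) ℝ}
  {s : ℝ} {u : EuclideanSpace ℝ (Fin n)}

lemma SmAt.det {m : ℕ} {G : ℝ → EuclideanSpace ℝ (Fin n) → Matrix (Fin m) (Fin m) ℝ}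
    (hG : ∀ i j, SmAt (fun s v => G s v i j) s u) :
    SmAt (fun s v => (G s v).det) s u := by
  simp only [Matrix.det_apply']
  exact SmAt.sum fun σ _ => SmAt.const_mul _ (SmAt.prod fun i _ => hG _ _)

/-- Cramer's rule: up to the factor `det⁻¹`, every entry of the inverse is the determinant of a
matrix with one row replaced by a constant. -/
lemma SmAt.matrix_inv (hG : ∀ i j, SmAt (fun s v => G s v i j) s u) (h0 : (G s u).det ≠ 0)
    (i j : Fin n) : SmAt (fun s v => (G s v)⁻¹ i j) s u := by
  simp only [Matrix.inv_def, Ring.inverse_eq_inv', Matrix.smul_apply, smul_eq_mul,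
    Matrix.adjugate_apply]
  refine ((SmAt.det hG).inv h0).mul (SmAt.det fun k l => ?_)
  by_cases hk : k = j
  · subst hk; simp only [Matrix.updateRow_self]; exact SmAt.const _
  · simp only [Matrix.updateRow_ne hk]; exact hG _ _

lemma SmAt.christoffel (hG : ∀ i j, SmAt (fun s v => G s v i j) s u) (h0 : (G s u).det ≠ 0)
    (k i j : Fin n) : SmAt (fun s v => christoffel (G s) k i j v) s u := by
  unfold ShrinkerEntropy.christoffel
  exact SmAt.const_mul _ (SmAt.sum fun l _ => (SmAt.matrix_inv hG h0 k l).mul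
    ((((hG j l).pd i).add ((hG i l).pd j)).sub ((hG i j).pd l)))

lemma SmAt.ricciLocal (hG : ∀ i j, SmAt (fun s v => G s v i j) s u) (h0 : (G s u).det ≠ 0)
    (i j : Fin n) : SmAt (fun s v => ricciLocal (G s) v i j) s u := by
  have hΓ := SmAt.christoffel hG h0
  unfold ShrinkerEntropy.ricciLocal
  simp only [Matrix.of_apply]
  exact (SmAt.sum fun k _ => ((hΓ k i j).pd k).sub ((hΓ k i k).pd j)).add
    (SmAt.sum fun k _ => SmAt.sum fun l _ => ((hΓ _ _ _).mul (hΓ _ _ _)).sub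
      ((hΓ _ _ _).mul (hΓ _ _ _)))

lemma SmAt.hessLocal {Φ : ℝ → EuclideanSpace ℝ (Fin n) → ℝ}
    (hG : ∀ i j, SmAt (fun s v => G s v i j) s u) (h0 : (G s u).det ≠ 0) (hΦ : SmAt Φ s u)
    (i j : Fin n) : SmAt (fun s v => hessLocal (G s) (Φ s) v i j) s u := by
  have hΓ := SmAt.christoffel hG h0
  unfold ShrinkerEntropy.hessLocal
  simp only [Matrix.of_apply]
  exact ((hΦ.pd j).pd i).sub (SmAt.sum fun k _ => (hΓ _ _ _).mul (hΦ.pd k))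

end MetricFamilies

/-! ### Derivatives of matrix-valued functions -/

section MatrixCalculus

variable {n : ℕ}

/-- Jacobi's formula. The Leibniz expansion gives differentiability, so the derivative in direction
`B` may be computed on the line `A + rB = A(1 + r A⁻¹B)`; there the determinant is a polynomial in
`r` with linear coefficient `det A · tr(A⁻¹B)`. -/
lemma hasDerivAt_det {A : ℝ → Matrix (Fin n) (Fin n) ℝ} {B : Matrix (Fin n) (Fin n) ℝ} {t : ℝ}
    (hA : ∀ i j, HasDerivAt (fun t => A t i j) (B i j) t) (h0 : (A t).det ≠ 0) :
    HasDerivAt (fun t => (A t).det) ((A t).det * ((A t)⁻¹ * B).trace) t := by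
  let d : (Fin n → Fin n → ℝ) → ℝ := fun X => (Matrix.of X).det
  let A' : ℝ → Fin n → Fin n → ℝ := fun t i j => A t i j
  let B' : Fin n → Fin n → ℝ := fun i j => B i j
  have hd : Differentiable ℝ d := by
    have : d = fun X => ∑ σ : Equiv.Perm (Fin n), ((Equiv.Perm.sign σ : ℤ) : ℝ) * ∏ i, X (σ i) i := by
      funext X; simp [d, Matrix.det_apply']
    rw [this]; fun_prop
  have hA' : HasDerivAt A' B' t := hasDerivAt_pi.2 fun i => hasDerivAt_pi.2 fun j => hA i j
  have h1 := (hd (A' t)).hasFDerivAt.comp_hasDerivAt t hA'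
  have hL : HasDerivAt (fun r : ℝ => A' t + r • B') B' 0 := by
    simpa using ((hasDerivAt_id (0 : ℝ)).smul_const B').const_add (A' t)
  have h2 : HasDerivAt (fun r : ℝ => d (A' t + r • B')) (fderiv ℝ d (A' t) B') 0 := by
    have h3 : HasFDerivAt d (fderiv ℝ d (A' t)) (A' t + (0 : ℝ) • B') := by
      simpa using (hd (A' t)).hasFDerivAt
    exact h3.comp_hasDerivAt (0 : ℝ) hL
  have hu : IsUnit (A t).det := isUnit_iff_ne_zero.2 h0
  have h4 : (fun r : ℝ => d (A' t + r • B')) =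
      fun r => (A t).det * (Polynomial.eval r
        (1 + (Polynomial.X : Polynomial ℝ) • ((A t)⁻¹ * B).map Polynomial.C).det) := by
    funext r
    have e1 : A t + r • B = A t * (1 + r • ((A t)⁻¹ * B)) := by
      rw [mul_add, mul_one, Matrix.mul_smul, Matrix.mul_nonsing_inv_cancel_left _ _ hu]
    have e2 : d (A' t + r • B') = (A t + r • B).det := rfl
    rw [e2, e1, Matrix.det_mul, ← Polynomial.coe_evalRingHom, RingHom.map_det]
    generalize (A t)⁻¹ * B = N
    congr 2
    ext i j
    by_cases hij : i = j <;> simp [hij] <;> ring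
  rw [h4] at h2
  have h5 : HasDerivAt (fun r => (A t).det * (Polynomial.eval r
        (1 + (Polynomial.X : Polynomial ℝ) • ((A t)⁻¹ * B).map Polynomial.C).det))
      ((A t).det * ((A t)⁻¹ * B).trace) 0 := by
    rw [← Matrix.derivative_det_one_add_X_smul]
    exact (Polynomial.hasDerivAt _ 0).const_mul _
  rw [← h2.unique h5]
  exact h1

/-- The entrywise partial derivative of a matrix-valued function. -/
def pdM (k : Fin n) (X : EuclideanSpace ℝ (Fin n) → Matrix (Fin n) (Fin n) ℝ)
    (u : EuclideanSpace ℝ (Fin n)) : Matrix (Fin n) (Fin n) ℝ :=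
  Matrix.of fun i j => pd k (fun v => X v i j) u

/-- The entrywise partial derivative of a vector-valued function. -/
def pdV (k : Fin n) (x : EuclideanSpace ℝ (Fin n) → Fin n → ℝ)
    (u : EuclideanSpace ℝ (Fin n)) : Fin n → ℝ :=
  fun i => pd k (fun v => x v i) u

variable {u : EuclideanSpace ℝ (Fin n)} {k : Fin n}
  {X Y : EuclideanSpace ℝ (Fin n) → Matrix (Fin n) (Fin n) ℝ}
  {x y : EuclideanSpace ℝ (Fin n) → Fin n → ℝ}

lemma pdM_congr (h : X =ᶠ[𝓝 u] Y) : pdM k X u = pdM k Y u := by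
  ext i j
  exact pd_congr (h.mono fun v hv => by simp only [hv])

lemma pdM_mul (hX : ∀ i j, DifferentiableAt ℝ (fun v => X v i j) u)
    (hY : ∀ i j, DifferentiableAt ℝ (fun v => Y v i j) u) :
    pdM k (fun v => X v * Y v) u = pdM k X u * Y u + X u * pdM k Y u := by
  ext i j
  simp only [pdM, Matrix.of_apply, Matrix.mul_apply, Matrix.add_apply]
  rw [pd_sum fun l _ => (hX i l).fun_mul (hY l j), ← Finset.sum_add_distrib]
  exact Finset.sum_congr rfl fun l _ => pd_mul (hX i l) (hY l j)

lemma pdM_add (hX : ∀ i j, DifferentiableAt ℝ (fun v => X v i j) u)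
    (hY : ∀ i j, DifferentiableAt ℝ (fun v => Y v i j) u) :
    pdM k (fun v => X v + Y v) u = pdM k X u + pdM k Y u := by
  ext i j
  exact pd_add (hX i j) (hY i j)

lemma pdM_neg : pdM k (fun v => -X v) u = -pdM k X u := by
  ext i j
  simp [pdM, pd]

lemma pdM_transpose : pdM k (fun v => (X v).transpose) u = (pdM k X u).transpose := rfl

lemma pdV_mulVec (hX : ∀ i j, DifferentiableAt ℝ (fun v => X v i j) u)
    (hx : ∀ i, DifferentiableAt ℝ (fun v => x v i) u) :
    pdV k (fun v => (X v).mulVec (x v)) u = (pdM k X u).mulVec (x u) + (X u).mulVec (pdV k x u) := by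
  ext i
  simp only [pdV, pdM, Matrix.of_apply, Matrix.mulVec, dotProduct, Pi.add_apply]
  rw [pd_sum fun l _ => (hX i l).fun_mul (hx l), ← Finset.sum_add_distrib]
  exact Finset.sum_congr rfl fun l _ => pd_mul (hX i l) (hx l)

lemma pdV_sub (hx : ∀ i, DifferentiableAt ℝ (fun v => x v i) u)
    (hy : ∀ i, DifferentiableAt ℝ (fun v => y v i) u) :
    pdV k (fun v => x v - y v) u = pdV k x u - pdV k y u := by
  ext i
  exact pd_sub (hx i) (hy i)

lemma pd_dotProduct (hx : ∀ i, DifferentiableAt ℝ (fun v => x v i) u)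
    (hy : ∀ i, DifferentiableAt ℝ (fun v => y v i) u) :
    pd k (fun v => x v ⬝ᵥ y v) u = pdV k x u ⬝ᵥ y u + x u ⬝ᵥ pdV k y u := by
  simp only [pdV, dotProduct]
  rw [pd_sum fun l _ => (hx l).fun_mul (hy l), ← Finset.sum_add_distrib]
  exact Finset.sum_congr rfl fun l _ => pd_mul (hx l) (hy l)

lemma differentiableAt_mulVec (hX : ∀ i j, DifferentiableAt ℝ (fun v => X v i j) u)
    (hx : ∀ i, DifferentiableAt ℝ (fun v => x v i) u) (i : Fin n) :
    DifferentiableAt ℝ (fun v => (X v).mulVec (x v) i) u := by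
  simp only [Matrix.mulVec, dotProduct]
  exact DifferentiableAt.fun_sum fun l _ => (hX i l).mul (hx l)

lemma differentiableAt_matrix_mul (hX : ∀ i j, DifferentiableAt ℝ (fun v => X v i j) u)
    (hY : ∀ i j, DifferentiableAt ℝ (fun v => Y v i j) u) (i j : Fin n) :
    DifferentiableAt ℝ (fun v => (X v * Y v) i j) u := by
  simp only [Matrix.mul_apply]
  exact DifferentiableAt.fun_sum fun l _ => (hX i l).mul (hY l j)

end MatrixCalculus

/-! ### The Levi-Civita connection in coordinates -/

section Connection

variable {n : ℕ}

/-- The components of a metric, smooth on an open set of coordinates. -/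
structure IsLocalMetric (G : EuclideanSpace ℝ (Fin n) → Matrix (Fin n) (Fin n) ℝ)
    (Ω : Set (EuclideanSpace ℝ (Fin n))) : Prop where
  isOpen : IsOpen Ω
  smooth : ∀ u ∈ Ω, ∀ i j, ContDiffAt ℝ ∞ (fun v => G v i j) u
  symm : ∀ u ∈ Ω, (G u).transpose = G u
  det_pos : ∀ u ∈ Ω, 0 < (G u).det

/-- The connection matrices `(A_k)^l_j = Γ^l_kj`. -/
def conn (G : EuclideanSpace ℝ (Fin n) → Matrix (Fin n) (Fin n) ℝ) (k : Fin n)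
    (u : EuclideanSpace ℝ (Fin n)) : Matrix (Fin n) (Fin n) ℝ :=
  Matrix.of fun l j => christoffel G l k j u

/-- The differential of a function. -/
def dv (a : EuclideanSpace ℝ (Fin n) → ℝ) (u : EuclideanSpace ℝ (Fin n)) : Fin n → ℝ :=
  fun i => pd i a u

/-- The gradient of a function. -/
def gr (G : EuclideanSpace ℝ (Fin n) → Matrix (Fin n) (Fin n) ℝ)
    (a : EuclideanSpace ℝ (Fin n) → ℝ) (u : EuclideanSpace ℝ (Fin n)) : Fin n → ℝ :=
  (G u)⁻¹.mulVec (dv a u)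

/-- The inner product `⟨∇a, ∇b⟩`. -/
def dot (G : EuclideanSpace ℝ (Fin n) → Matrix (Fin n) (Fin n) ℝ)
    (a b : EuclideanSpace ℝ (Fin n) → ℝ) (u : EuclideanSpace ℝ (Fin n)) : ℝ :=
  dv a u ⬝ᵥ gr G b u

variable {G : EuclideanSpace ℝ (Fin n) → Matrix (Fin n) (Fin n) ℝ}
  {Ω : Set (EuclideanSpace ℝ (Fin n))} {u : EuclideanSpace ℝ (Fin n)}
  {a b : EuclideanSpace ℝ (Fin n) → ℝ}

namespace IsLocalMetric

lemma mem_nhds (hG : IsLocalMetric G Ω) (hu : u ∈ Ω) : Ω ∈ 𝓝 u := hG.isOpen.mem_nhds hu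

lemma isUnit_det (hG : IsLocalMetric G Ω) (hu : u ∈ Ω) : IsUnit (G u).det :=
  isUnit_iff_ne_zero.2 (hG.det_pos u hu).ne'

lemma apply_comm (hG : IsLocalMetric G Ω) (hu : u ∈ Ω) (i j : Fin n) : G u i j = G u j i :=
  congrFun (congrFun (hG.symm u hu) j) i

lemma inv_transpose (hG : IsLocalMetric G Ω) (hu : u ∈ Ω) : (G u)⁻¹.transpose = (G u)⁻¹ := by
  rw [Matrix.transpose_nonsing_inv, hG.symm u hu]

lemma inv_comm (hG : IsLocalMetric G Ω) (hu : u ∈ Ω) (i j : Fin n) :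
    (G u)⁻¹ i j = (G u)⁻¹ j i := congrFun (congrFun (hG.inv_transpose hu) j) i

lemma smooth_inv (hG : IsLocalMetric G Ω) (hu : u ∈ Ω) (i j : Fin n) :
    ContDiffAt ℝ ∞ (fun v => (G v)⁻¹ i j) u :=
  (SmAt.matrix_inv (s := 0) (fun i j => SmAt.static (hG.smooth u hu i j))
    (hG.det_pos u hu).ne' i j).slice

lemma smooth_christoffel (hG : IsLocalMetric G Ω) (hu : u ∈ Ω) (k i j : Fin n) :
    ContDiffAt ℝ ∞ (christoffel G k i j) u :=
  (SmAt.christoffel (s := 0) (fun i j => SmAt.static (hG.smooth u hu i j))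
    (hG.det_pos u hu).ne' k i j).slice

lemma smooth_ricci (hG : IsLocalMetric G Ω) (hu : u ∈ Ω) (i j : Fin n) :
    ContDiffAt ℝ ∞ (fun v => ricciLocal G v i j) u :=
  (SmAt.ricciLocal (s := 0) (fun i j => SmAt.static (hG.smooth u hu i j))
    (hG.det_pos u hu).ne' i j).slice

lemma smooth_hess (hG : IsLocalMetric G Ω) (hu : u ∈ Ω) (ha : ContDiffAt ℝ ∞ a u) (i j : Fin n) :
    ContDiffAt ℝ ∞ (fun v => hessLocal G a v i j) u :=
  (SmAt.hessLocal (s := 0) (fun i j => SmAt.static (hG.smooth u hu i j))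
    (hG.det_pos u hu).ne' (SmAt.static ha) i j).slice

lemma smooth_conn (hG : IsLocalMetric G Ω) (hu : u ∈ Ω) (k i j : Fin n) :
    ContDiffAt ℝ ∞ (fun v => conn G k v i j) u :=
  hG.smooth_christoffel hu i k j

lemma smooth_gr (hG : IsLocalMetric G Ω) (hu : u ∈ Ω) (ha : ContDiffAt ℝ ∞ a u) (i : Fin n) :
    ContDiffAt ℝ ∞ (fun v => gr G a v i) u := by
  simp only [gr, Matrix.mulVec, dotProduct]
  exact ContDiffAt.sum fun j _ => (hG.smooth_inv hu i j).mul (contDiffAt_pd j ha)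

lemma smooth_dot (hG : IsLocalMetric G Ω) (hu : u ∈ Ω) (ha : ContDiffAt ℝ ∞ a u)
    (hb : ContDiffAt ℝ ∞ b u) : ContDiffAt ℝ ∞ (dot G a b) u := by
  unfold dot dotProduct
  exact ContDiffAt.sum fun j _ => (contDiffAt_pd j ha).mul (hG.smooth_gr hu hb j)

lemma christoffel_comm (hG : IsLocalMetric G Ω) (hu : u ∈ Ω) (k i j : Fin n) :
    christoffel G k i j u = christoffel G k j i u := by
  unfold christoffel
  congr 1
  refine Finset.sum_congr rfl fun l _ => ?_
  have : pd l (fun v => G v i j) u = pd l (fun v => G v j i) u :=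
    pd_congr (by filter_upwards [hG.mem_nhds hu] with v hv using hG.apply_comm hv i j)
  rw [this]; ring

lemma lower_christoffel (hG : IsLocalMetric G Ω) (hu : u ∈ Ω) (k i j : Fin n) :
    ∑ l, G u k l * christoffel G l i j u = (1 / 2 : ℝ) *
      (pd i (fun v => G v j k) u + pd j (fun v => G v i k) u - pd k (fun v => G v i j) u) := by
  let w : Fin n → ℝ := fun l =>
    pd i (fun v => G v j l) u + pd j (fun v => G v i l) u - pd l (fun v => G v i j) u
  have h1 : (fun l => christoffel G l i j u) = (1 / 2 : ℝ) • (G u)⁻¹.mulVec w := by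
    funext l; simp [christoffel, Matrix.mulVec, dotProduct, w]
  have h2 : ∑ l, G u k l * christoffel G l i j u =
      (G u).mulVec (fun l => christoffel G l i j u) k := rfl
  rw [h2, h1, Matrix.mulVec_smul, Matrix.mulVec_mulVec, Matrix.mul_nonsing_inv _ (hG.isUnit_det hu)]
  simp [w]

/-- Metric compatibility `∇g = 0` in matrix form: in the sum of two lowered Christoffel symbols all
but one derivative of the metric cancel. -/
lemma pdM_metric (hG : IsLocalMetric G Ω) (hu : u ∈ Ω) (k : Fin n) :
    pdM k G u = G u * conn G k u + (conn G k u).transpose * G u := by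
  ext i j
  have hs : ∀ k i j, pd k (fun v => G v i j) u = pd k (fun v => G v j i) u := fun k i j =>
    pd_congr (by filter_upwards [hG.mem_nhds hu] with v hv using hG.apply_comm hv i j)
  have e2 : ((conn G k u).transpose * G u) i j = ∑ l, G u j l * christoffel G l k i u := by
    simp only [Matrix.mul_apply, Matrix.transpose_apply, conn, Matrix.of_apply]
    exact Finset.sum_congr rfl fun l _ => by rw [hG.apply_comm hu l j, mul_comm]
  rw [Matrix.add_apply, e2, hG.lower_christoffel hu]
  have e1 : (G u * conn G k u) i j = ∑ l, G u i l * christoffel G l k j u := rfl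
  rw [e1, hG.lower_christoffel hu, hs k j i, hs j k i, hs i k j]
  simp only [pdM, Matrix.of_apply]; ring

lemma differentiableAt_inv (hG : IsLocalMetric G Ω) (hu : u ∈ Ω) (i j : Fin n) :
    DifferentiableAt ℝ (fun v => (G v)⁻¹ i j) u := (hG.smooth_inv hu i j).differentiableAt (by simp)

lemma differentiableAt_conn (hG : IsLocalMetric G Ω) (hu : u ∈ Ω) (k i j : Fin n) :
    DifferentiableAt ℝ (fun v => conn G k v i j) u :=
  (hG.smooth_conn hu k i j).differentiableAt (by simp)

/-- Differentiate `G⁻¹G = 1`, insert `pdM_metric` and multiply by `G⁻¹` from the right. -/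
lemma pdM_inv (hG : IsLocalMetric G Ω) (hu : u ∈ Ω) (k : Fin n) :
    pdM k (fun v => (G v)⁻¹) u =
      -(conn G k u * (G u)⁻¹ + (G u)⁻¹ * (conn G k u).transpose) := by
  have h1 : pdM k (fun v => (G v)⁻¹ * G v) u = 0 := by
    have : (fun v => (G v)⁻¹ * G v) =ᶠ[𝓝 u] fun _ => 1 := by
      filter_upwards [hG.mem_nhds hu] with v hv using Matrix.nonsing_inv_mul _ (hG.isUnit_det hv)
    rw [pdM_congr this]; ext i j; simp [pdM, pd_const]
  rw [pdM_mul (hG.differentiableAt_inv hu)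
    (fun i j => (hG.smooth u hu i j).differentiableAt (by simp)), hG.pdM_metric hu] at h1
  have h2 := congrArg (· * (G u)⁻¹) h1
  simp only [add_mul, mul_add, zero_mul] at h2
  rw [Matrix.mul_nonsing_inv_cancel_right _ _ (hG.isUnit_det hu),
    Matrix.nonsing_inv_mul_cancel_left _ _ (hG.isUnit_det hu), ← mul_assoc,
    Matrix.mul_nonsing_inv_cancel_right _ _ (hG.isUnit_det hu)] at h2
  exact eq_neg_of_add_eq_zero_left h2

/-- Jacobi's formula along a coordinate line; by compatibility `tr(G⁻¹ ∂ₖG) = 2 tr Aₖ`, and the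
square root absorbs the factor two. -/
lemma pd_sqrt_det (hG : IsLocalMetric G Ω) (hu : u ∈ Ω) (k : Fin n) :
    pd k (fun v => Real.sqrt (G v).det) u = Real.sqrt (G u).det * (conn G k u).trace := by
  have hsm : ContDiffAt ℝ ∞ (fun v => (G v).det) u :=
    (SmAt.det (s := 0) fun i j => SmAt.static (hG.smooth u hu i j)).slice
  have hd : DifferentiableAt ℝ (fun v => (G v).det) u := hsm.differentiableAt (by simp)
  have h1 : pd k (fun v => (G v).det) u = (G u).det * ((G u)⁻¹ * pdM k G u).trace := by
    have hline := hd.hasFDerivAt.hasLineDerivAt (EuclideanSpace.single k 1)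
    have hdet := hasDerivAt_det (A := fun t : ℝ => G (u + t • EuclideanSpace.single k 1))
      (B := pdM k G u) (t := 0)
      (fun i j => ((hG.smooth u hu i j).differentiableAt (by simp)).hasFDerivAt.hasLineDerivAt
        (EuclideanSpace.single k 1)) (by simpa using (hG.det_pos u hu).ne')
    have := HasDerivAt.unique hline hdet
    simp only [zero_smul, add_zero] at this
    exact this
  rw [hG.pdM_metric hu, mul_add, Matrix.nonsing_inv_mul_cancel_left _ _ (hG.isUnit_det hu),
    Matrix.trace_add, ← mul_assoc, Matrix.trace_mul_comm, ← mul_assoc,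
    Matrix.mul_nonsing_inv _ (hG.isUnit_det hu), one_mul, Matrix.trace_transpose] at h1
  rw [pd_comp (Real.hasDerivAt_sqrt (hG.det_pos u hu).ne') hd, h1]
  have hpos := hG.det_pos u hu
  have hsq : Real.sqrt (G u).det * Real.sqrt (G u).det = (G u).det := Real.mul_self_sqrt hpos.le
  have hne : Real.sqrt (G u).det ≠ 0 := (Real.sqrt_pos.2 hpos).ne'
  field_simp
  rw [pow_two, hsq]; ring

lemma pdV_dv (a : EuclideanSpace ℝ (Fin n) → ℝ) (k : Fin n) :
    pdV k (dv a) u = hessLocal G a u k + (conn G k u).transpose.mulVec (dv a u) := by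
  ext j
  simp [pdV, dv, hessLocal, conn, Matrix.mulVec, dotProduct]

lemma hess_comm (hG : IsLocalMetric G Ω) (hu : u ∈ Ω) (ha : ContDiffAt ℝ ∞ a u) (i j : Fin n) :
    hessLocal G a u i j = hessLocal G a u j i := by
  simp only [hessLocal, Matrix.of_apply]
  rw [pd_pd_comm i j ha]
  congr 1
  exact Finset.sum_congr rfl fun k _ => by rw [hG.christoffel_comm hu]

lemma differentiableAt_dv (ha : ContDiffAt ℝ ∞ a u) (i : Fin n) :
    DifferentiableAt ℝ (fun v => dv a v i) u := (contDiffAt_pd i ha).differentiableAt (by simp)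

lemma differentiableAt_gr (hG : IsLocalMetric G Ω) (hu : u ∈ Ω) (ha : ContDiffAt ℝ ∞ a u)
    (i : Fin n) : DifferentiableAt ℝ (fun v => gr G a v i) u :=
  (hG.smooth_gr hu ha i).differentiableAt (by simp)

lemma pdV_gr (hG : IsLocalMetric G Ω) (hu : u ∈ Ω) (ha : ContDiffAt ℝ ∞ a u) (k : Fin n) :
    pdV k (gr G a) u =
      (G u)⁻¹.mulVec (hessLocal G a u k) - (conn G k u).mulVec (gr G a u) := by
  have h1 : pdV k (gr G a) u = _ :=
    pdV_mulVec (hG.differentiableAt_inv hu) (differentiableAt_dv ha)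
  rw [h1, hG.pdM_inv hu, pdV_dv (G := G)]
  simp only [Matrix.neg_mulVec, Matrix.add_mulVec, Matrix.mulVec_add, gr, Matrix.mulVec_mulVec]
  abel

lemma dotProduct_inv (hG : IsLocalMetric G Ω) (hu : u ∈ Ω) (x y : Fin n → ℝ) :
    x ⬝ᵥ (G u)⁻¹.mulVec y = (G u)⁻¹.mulVec x ⬝ᵥ y := by
  rw [Matrix.dotProduct_mulVec, ← Matrix.mulVec_transpose, hG.inv_transpose hu]

lemma dot_comm (hG : IsLocalMetric G Ω) (hu : u ∈ Ω) (a b : EuclideanSpace ℝ (Fin n) → ℝ) :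
    dot G a b u = dot G b a u := by
  unfold dot gr
  rw [hG.dotProduct_inv hu, dotProduct_comm]

/-- The connection term from differentiating `da` cancels the one from differentiating `∇b`, so only
the two Hessians remain. -/
lemma pd_dot (hG : IsLocalMetric G Ω) (hu : u ∈ Ω) (ha : ContDiffAt ℝ ∞ a u)
    (hb : ContDiffAt ℝ ∞ b u) (k : Fin n) :
    pd k (dot G a b) u = hessLocal G a u k ⬝ᵥ gr G b u + hessLocal G b u k ⬝ᵥ gr G a u := by
  have h1 : pd k (dot G a b) u = _ :=
    pd_dotProduct (differentiableAt_dv ha) (hG.differentiableAt_gr hu hb)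
  rw [h1, hG.pdV_gr hu hb, pdV_dv (G := G), add_dotProduct, dotProduct_sub,
    hG.dotProduct_inv hu, Matrix.mulVec_transpose, ← Matrix.dotProduct_mulVec]
  unfold gr
  rw [dotProduct_comm (hessLocal G b u k)]
  ring

/-- The Hessian in terms of inner products of gradients. -/
lemma hess_gr_gr (hG : IsLocalMetric G Ω) (hu : u ∈ Ω) {c : EuclideanSpace ℝ (Fin n) → ℝ}
    (ha : ContDiffAt ℝ ∞ a u) (hb : ContDiffAt ℝ ∞ b u) (hc : ContDiffAt ℝ ∞ c u) :
    2 * (gr G a u ⬝ᵥ (hessLocal G c u).mulVec (gr G b u)) =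
      dot G a (dot G c b) u + dot G b (dot G c a) u - dot G c (dot G a b) u := by
  -- Each of the three iterated products is a sum of two Hessian terms. Symmetry of the Hessians
  -- identifies them in pairs, and the signs leave twice the Hessian of `c`.
  have key : ∀ {a b c : EuclideanSpace ℝ (Fin n) → ℝ}, ContDiffAt ℝ ∞ a u → ContDiffAt ℝ ∞ b u →
      ContDiffAt ℝ ∞ c u → dot G a (dot G c b) u =
        gr G a u ⬝ᵥ (hessLocal G c u).mulVec (gr G b u) +
        gr G a u ⬝ᵥ (hessLocal G b u).mulVec (gr G c u) := by
    intro a b c ha hb hc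
    unfold dot
    conv_lhs => rw [gr, hG.dotProduct_inv hu]
    rw [← dotProduct_add]
    congr 1
    funext k
    exact hG.pd_dot hu hc hb k
  have hsym : ∀ {c : EuclideanSpace ℝ (Fin n) → ℝ}, ContDiffAt ℝ ∞ c u → ∀ x y : Fin n → ℝ,
      x ⬝ᵥ (hessLocal G c u).mulVec y = y ⬝ᵥ (hessLocal G c u).mulVec x := by
    intro c hc x y
    rw [Matrix.dotProduct_mulVec, ← Matrix.mulVec_transpose, dotProduct_comm]
    congr 2
    ext i j; exact hG.hess_comm hu hc j i
  rw [key ha hb hc, key hb ha hc, key hc hb ha]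
  rw [hsym hc (gr G b u), hsym ha (gr G b u), hsym hb (gr G a u)]
  ring

end IsLocalMetric

end Connection

/-! ### The Bochner formula -/

section Bochner

variable {n : ℕ}

/-- The Laplacian in coordinates. -/
def lapLocal (G : EuclideanSpace ℝ (Fin n) → Matrix (Fin n) (Fin n) ℝ)
    (a : EuclideanSpace ℝ (Fin n) → ℝ) (u : EuclideanSpace ℝ (Fin n)) : ℝ :=
  ((G u)⁻¹ * hessLocal G a u).trace

/-- The curvature matrices `F_im = ∂_i A_m - ∂_m A_i + [A_i, A_m]`. -/
def curv (G : EuclideanSpace ℝ (Fin n) → Matrix (Fin n) (Fin n) ℝ) (i m : Fin n)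
    (u : EuclideanSpace ℝ (Fin n)) : Matrix (Fin n) (Fin n) ℝ :=
  pdM i (conn G m) u - pdM m (conn G i) u +
    (conn G i u * conn G m u - conn G m u * conn G i u)

/-- Ricci is the contraction of the curvature of the connection. The symmetry of the symbols is
assumed near `u`, not just at `u`, because their derivatives are exchanged too. -/
lemma ricciLocal_eq_sum_curv (G : EuclideanSpace ℝ (Fin n) → Matrix (Fin n) (Fin n) ℝ)
    (u : EuclideanSpace ℝ (Fin n))
    (hsym : ∀ k i j, christoffel G k i j =ᶠ[𝓝 u] christoffel G k j i) (i j : Fin n) :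
    ricciLocal G u i j = ∑ k, curv G k j u k i := by
  have hs : ∀ k i j, christoffel G k i j u = christoffel G k j i u := fun k i j =>
    (hsym k i j).eq_of_nhds
  simp only [ricciLocal, Matrix.of_apply, curv, Matrix.add_apply, Matrix.sub_apply,
    Matrix.mul_apply, conn, pdM, ← Finset.sum_add_distrib, ← Finset.sum_sub_distrib]
  refine Finset.sum_congr rfl fun k _ => ?_
  rw [pd_congr (hsym k i j), pd_congr (hsym k i k)]
  congr 1
  refine Finset.sum_congr rfl fun l _ => ?_
  rw [hs l i j, hs l i k]

namespace IsLocalMetric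

variable {G : EuclideanSpace ℝ (Fin n) → Matrix (Fin n) (Fin n) ℝ}
  {Ω : Set (EuclideanSpace ℝ (Fin n))} {u : EuclideanSpace ℝ (Fin n)}
  {a b : EuclideanSpace ℝ (Fin n) → ℝ}

lemma eventually_christoffel_comm (hG : IsLocalMetric G Ω) (hu : u ∈ Ω) (k i j : Fin n) :
    christoffel G k i j =ᶠ[𝓝 u] christoffel G k j i := by
  filter_upwards [hG.mem_nhds hu] with v hv using hG.christoffel_comm hv k i j

/-- Skewness of the curvature with respect to the metric: expand `∂ᵢ∂ₘ G⁻¹ = ∂ₘ∂ᵢ G⁻¹` with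
`pdM_inv`; everything but the curvature cancels. -/
lemma curv_inv (hG : IsLocalMetric G Ω) (hu : u ∈ Ω) (i m : Fin n) :
    curv G i m u * (G u)⁻¹ + (G u)⁻¹ * (curv G i m u).transpose = 0 := by
  have hI := hG.differentiableAt_inv hu
  have hM := fun k => hG.differentiableAt_conn hu k
  have second : ∀ k l, pdM k (fun v => pdM l (fun v => (G v)⁻¹) v) u =
      -(pdM k (conn G l) u * (G u)⁻¹ + conn G l u * pdM k (fun v => (G v)⁻¹) u +
        (pdM k (fun v => (G v)⁻¹) u * (conn G l u).transpose +
          (G u)⁻¹ * (pdM k (conn G l) u).transpose)) := by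
    intro k l
    have h1 : (fun v => pdM l (fun v => (G v)⁻¹) v) =ᶠ[𝓝 u] fun v =>
        -(conn G l v * (G v)⁻¹ + (G v)⁻¹ * (conn G l v).transpose) := by
      filter_upwards [hG.mem_nhds hu] with v hv using hG.pdM_inv hv l
    rw [pdM_congr h1, pdM_neg, pdM_add (X := fun v => conn G l v * (G v)⁻¹)
      (Y := fun v => (G v)⁻¹ * (conn G l v).transpose)
      (differentiableAt_matrix_mul (hM l) hI)
      (differentiableAt_matrix_mul hI fun i j => hM l j i),
      pdM_mul (hM l) hI,
      pdM_mul (Y := fun v => (conn G l v).transpose) hI fun i j => hM l j i, pdM_transpose]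
  have hcomm : pdM i (fun v => pdM m (fun v => (G v)⁻¹) v) u =
      pdM m (fun v => pdM i (fun v => (G v)⁻¹) v) u := by
    ext k l
    exact pd_pd_comm i m (hG.smooth_inv hu k l)
  rw [second i m, second m i, hG.pdM_inv hu, hG.pdM_inv hu] at hcomm
  have h0 := sub_eq_zero.2 hcomm
  rw [← neg_eq_zero, ← h0]
  simp only [curv, Matrix.transpose_add, Matrix.transpose_sub, Matrix.transpose_mul]
  noncomm_ring

/-- The covariant derivative `∇_i ∇_m ∇_j a` as a covector in `j`. -/
def thirdDeriv (G : EuclideanSpace ℝ (Fin n) → Matrix (Fin n) (Fin n) ℝ)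
    (a : EuclideanSpace ℝ (Fin n) → ℝ) (i : Fin n) (u : EuclideanSpace ℝ (Fin n)) :
    Matrix (Fin n) (Fin n) ℝ :=
  pdM i (hessLocal G a) u - hessLocal G a u * conn G i u -
    (conn G i u).transpose * hessLocal G a u

/-- The Ricci identity for the covector `da`: commuting covariant derivatives costs the curvature,
since the ordinary second derivatives of `da` commute. -/
lemma thirdDeriv_sub (hG : IsLocalMetric G Ω) (hu : u ∈ Ω) (ha : ContDiffAt ℝ ∞ a u)
    (i m : Fin n) :
    thirdDeriv G a i u m - thirdDeriv G a m u i =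
      -((curv G i m u).transpose.mulVec (dv a u)) := by
  have hM := fun k => hG.differentiableAt_conn hu k
  have hrow : ∀ i m, pdM i (hessLocal G a) u m =
      pdV i (fun v => pdV m (dv a) v) u -
      ((pdM i (conn G m) u).transpose.mulVec (dv a u) +
        (conn G m u).transpose.mulVec
          (hessLocal G a u i + (conn G i u).transpose.mulVec (dv a u))) := by
    intro i m
    have h1 : (fun v => hessLocal G a v m) = fun v =>
        pdV m (dv a) v - (conn G m v).transpose.mulVec (dv a v) := by
      funext v; rw [pdV_dv (G := G)]; abel
    have h2 : pdM i (hessLocal G a) u m = pdV i (fun v => hessLocal G a v m) u := rfl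
    rw [h2, h1, pdV_sub (x := fun v => pdV m (dv a) v)
      (y := fun v => (conn G m v).transpose.mulVec (dv a v))
      (fun j => (contDiffAt_pd m (contDiffAt_pd j ha)).differentiableAt (by simp))
      (differentiableAt_mulVec (fun i j => hM m j i) (differentiableAt_dv ha)),
      pdV_mulVec (X := fun v => (conn G m v).transpose) (fun i j => hM m j i)
        (differentiableAt_dv ha), ← pdV_dv, pdM_transpose]
  have hcomm : pdV i (fun v => pdV m (dv a) v) u = pdV m (fun v => pdV i (dv a) v) u := by
    ext j
    exact pd_pd_comm i m (contDiffAt_pd j ha)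
  have hΓ : ∀ i m, (hessLocal G a u * conn G i u) m = (conn G i u).transpose.mulVec
      (hessLocal G a u m) := by
    intro i m
    rw [Matrix.mulVec_transpose]; rfl
  -- The correction in the first Hessian slot is symmetric in `i, m` because the connection is
  -- torsion-free, so it drops out of the commutator.
  have hΓ2 : ((conn G i u).transpose * hessLocal G a u) m =
      ((conn G m u).transpose * hessLocal G a u) i := by
    ext j
    simp only [Matrix.mul_apply, Matrix.transpose_apply, conn, Matrix.of_apply]
    exact Finset.sum_congr rfl fun l _ => by rw [hG.christoffel_comm hu]
  have e : ∀ i m, thirdDeriv G a i u m = pdM i (hessLocal G a) u m -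
      (hessLocal G a u * conn G i u) m - ((conn G i u).transpose * hessLocal G a u) m :=
    fun i m => rfl
  rw [e, e, hrow, hrow, hcomm, hΓ, hΓ, hΓ2]
  simp only [curv, Matrix.transpose_add, Matrix.transpose_sub, Matrix.transpose_mul,
    Matrix.add_mulVec, Matrix.sub_mulVec, Matrix.mulVec_add, Matrix.mulVec_mulVec]
  abel

lemma thirdDeriv_comm (hG : IsLocalMetric G Ω) (hu : u ∈ Ω) (ha : ContDiffAt ℝ ∞ a u)
    (i m j : Fin n) : thirdDeriv G a i u m j = thirdDeriv G a i u j m := by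
  have hA : (hessLocal G a u).transpose = hessLocal G a u := by
    ext i j; exact hG.hess_comm hu ha j i
  have hd : (pdM i (hessLocal G a) u).transpose = pdM i (hessLocal G a) u := by
    ext k l
    exact pd_congr (by
      -- Symmetry of the Hessian is needed on a neighbourhood, since it is about to be
      -- differentiated; order three at `u` persists nearby and suffices.
      have h1 : ContDiffAt ℝ 3 a u := ha.of_le (WithTop.coe_le_coe.2 (le_top : (3 : ℕ∞) ≤ ⊤))
      filter_upwards [hG.mem_nhds hu, h1.eventually (by decide)] with v hv hav
      simp only [hessLocal, Matrix.of_apply]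
      have hs : IsSymmSndFDerivAt ℝ a v := hav.isSymmSndFDerivAt (by simp; norm_cast)
      have hF : DifferentiableAt ℝ (fderiv ℝ a) v :=
        (ContDiffAt.fderiv_right (m := 1) hav (by norm_cast)).differentiableAt one_ne_zero
      congr 1
      · unfold pd
        rw [fderiv_clm_apply hF (differentiableAt_const _),
          fderiv_clm_apply hF (differentiableAt_const _)]
        simp [hs.eq (EuclideanSpace.single k 1) (EuclideanSpace.single l 1)]
      · exact Finset.sum_congr rfl fun p _ => by rw [hG.christoffel_comm hv])
  have ht : (thirdDeriv G a i u).transpose = thirdDeriv G a i u := by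
    unfold thirdDeriv
    simp only [Matrix.transpose_sub, Matrix.transpose_mul, Matrix.transpose_transpose, hA, hd]
    abel
  conv_lhs => rw [← ht]
  rfl

/-- Contraction with `g⁻¹` commutes with covariant differentiation; the connection terms of `∂ₖ G⁻¹`
become those of `∇ₖX` by cyclicity of the trace. -/
lemma pd_trace_inv_mul (hG : IsLocalMetric G Ω) (hu : u ∈ Ω)
    {X : EuclideanSpace ℝ (Fin n) → Matrix (Fin n) (Fin n) ℝ}
    (hX : ∀ i j, DifferentiableAt ℝ (fun v => X v i j) u) (k : Fin n) :
    pd k (fun v => ((G v)⁻¹ * X v).trace) u =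
      ((G u)⁻¹ * (pdM k X u - X u * conn G k u - (conn G k u).transpose * X u)).trace := by
  have h1 : pd k (fun v => ((G v)⁻¹ * X v).trace) u =
      (pdM k (fun v => (G v)⁻¹ * X v) u).trace := by
    simp only [Matrix.trace, Matrix.diag, pdM, Matrix.of_apply]
    exact pd_sum fun i _ => differentiableAt_matrix_mul (hG.differentiableAt_inv hu) hX i i
  rw [h1, pdM_mul (hG.differentiableAt_inv hu) hX, hG.pdM_inv hu]
  have h2 : (conn G k u * (G u)⁻¹ * X u).trace = ((G u)⁻¹ * (X u * conn G k u)).trace := by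
    rw [mul_assoc, Matrix.trace_mul_comm, mul_assoc]
  simp only [mul_sub, Matrix.trace_sub, neg_mul, add_mul, Matrix.trace_add, Matrix.trace_neg, h2]
  simp only [mul_assoc]
  ring

/-- Bochner's formula. -/
lemma bochner (hG : IsLocalMetric G Ω) (hu : u ∈ Ω) (ha : ∀ v ∈ Ω, ContDiffAt ℝ ∞ a v) :
    (1 / 2 : ℝ) * lapLocal G (dot G a a) u -
      ((G u)⁻¹ * hessLocal G a u * (G u)⁻¹ * hessLocal G a u).trace - dot G a (lapLocal G a) u =
    gr G a u ⬝ᵥ (ricciLocal G u).mulVec (gr G a u) := by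
  set I := (G u)⁻¹ with hI
  set A := hessLocal G a u with hAdef
  set ξ := gr G a u with hξ
  have hau := ha u hu
  have hIsym : ∀ i j, I i j = I j i := hG.inv_comm hu
  have hA : ∀ i j, DifferentiableAt ℝ (fun v => hessLocal G a v i j) u := fun i j =>
    (hG.smooth_hess hu hau i j).differentiableAt (by simp)
  have hdw : ∀ j, pd j (dot G a a) =ᶠ[𝓝 u] fun v => 2 * (hessLocal G a v j ⬝ᵥ gr G a v) := by
    intro j
    filter_upwards [hG.mem_nhds hu] with v hv
    rw [hG.pd_dot hv (ha v hv) (ha v hv)]; ring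
  -- Since `∂ⱼ|∇a|² = 2∇²a(∂ⱼ,∇a)`, the Hessian of `|∇a|²` splits into a third-derivative term and
  -- the square of `∇²a`.
  have hhess : ∀ i j, hessLocal G (dot G a a) u i j =
      2 * (thirdDeriv G a i u j ⬝ᵥ ξ + A j ⬝ᵥ I.mulVec (A i)) := by
    intro i j
    have h1 : pd i (pd j (dot G a a)) u =
        2 * (pdM i (hessLocal G a) u j ⬝ᵥ ξ + A j ⬝ᵥ (I.mulVec (A i) - (conn G i u).mulVec ξ)) := by
      rw [pd_congr (hdw j), pd_const_mul, pd_dotProduct (x := fun v => hessLocal G a v j)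
        (fun k => hA j k) (hG.differentiableAt_gr hu hau), hG.pdV_gr hu hau]
      · rfl
      · simp only [dotProduct]
        exact DifferentiableAt.fun_sum fun l _ =>
          (hA j l).fun_mul (hG.differentiableAt_gr hu hau l)
    have h2 : ∑ k, christoffel G k i j u * pd k (dot G a a) u =
        2 * (((conn G i u).transpose * A) j ⬝ᵥ ξ) := by
      have e : ((conn G i u).transpose * A) j ⬝ᵥ ξ = (conn G i u).transpose j ⬝ᵥ A.mulVec ξ := by
        rw [Matrix.dotProduct_mulVec]; rfl
      rw [e, dotProduct, Finset.mul_sum]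
      refine Finset.sum_congr rfl fun k _ => ?_
      rw [(hdw k).eq_of_nhds]
      simp only [Matrix.transpose_apply, conn, Matrix.of_apply, Matrix.mulVec]
      ring
    have h3 : (A * conn G i u) j ⬝ᵥ ξ = A j ⬝ᵥ (conn G i u).mulVec ξ := by
      rw [Matrix.dotProduct_mulVec]; rfl
    have e : thirdDeriv G a i u j = pdM i (hessLocal G a) u j -
      (A * conn G i u) j - ((conn G i u).transpose * A) j := rfl
    have e0 : hessLocal G (dot G a a) u i j = pd i (pd j (dot G a a)) u -
      ∑ k, christoffel G k i j u * pd k (dot G a a) u := rfl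
    rw [e0, h1, h2, e, sub_dotProduct, sub_dotProduct, h3, dotProduct_sub]
    ring
  have hlap : dot G a (lapLocal G a) u = ∑ m, ξ m * (I * thirdDeriv G a m u).trace := by
    unfold dot
    rw [gr, hG.dotProduct_inv hu, dotProduct]
    refine Finset.sum_congr rfl fun m _ => ?_
    congr 1
    exact hG.pd_trace_inv_mul hu hA m
  have hnorm : (I * A * I * A).trace = ∑ i, ∑ j, I i j * (A j ⬝ᵥ I.mulVec (A i)) := by
    have e : ∀ j i, A j ⬝ᵥ I.mulVec (A i) = (A * I * A) j i := by
      intro j i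
      have : A i = fun k => A k i := by funext k; exact hG.hess_comm hu hau i k
      rw [this, Matrix.dotProduct_mulVec]; rfl
    simp only [e]
    rw [show I * A * I * A = I * (A * I * A) by simp only [mul_assoc]]
    exact Finset.sum_congr rfl fun i _ => Matrix.mul_apply
  have hL : (1 / 2 : ℝ) * lapLocal G (dot G a a) u =
      ∑ i, ∑ j, I i j * (thirdDeriv G a i u j ⬝ᵥ ξ) + ∑ i, ∑ j, I i j * (A j ⬝ᵥ I.mulVec (A i)) := by
    simp only [lapLocal, Matrix.trace, Matrix.diag, Matrix.mul_apply, Finset.mul_sum,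
      ← Finset.sum_add_distrib]
    rw [Finset.sum_comm]
    refine Finset.sum_congr rfl fun j _ => Finset.sum_congr rfl fun i _ => ?_
    rw [hhess, ← hI, hIsym i j]; ring
  rw [hL, hnorm, hlap]
  -- With `|∇²a|²` gone, what is left is the trace of a commutator of third derivatives; the
  -- symmetry in the last two indices lines up the two traces.
  have hD : ∑ i, ∑ j, I i j * (thirdDeriv G a i u j ⬝ᵥ ξ) -
      ∑ m, ξ m * (I * thirdDeriv G a m u).trace =
      ∑ i, ∑ m, ξ m * I.mulVec (thirdDeriv G a i u m - thirdDeriv G a m u i) i := by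
    have e1 : ∑ i, ∑ j, I i j * (thirdDeriv G a i u j ⬝ᵥ ξ) =
        ∑ i, ∑ m, ξ m * I.mulVec (thirdDeriv G a i u m) i := by
      refine Finset.sum_congr rfl fun i _ => ?_
      simp only [dotProduct, Matrix.mulVec, Finset.mul_sum]
      rw [Finset.sum_comm]
      refine Finset.sum_congr rfl fun m _ => Finset.sum_congr rfl fun j _ => ?_
      rw [hG.thirdDeriv_comm hu hau i j m]; ring
    have e2 : ∑ m, ξ m * (I * thirdDeriv G a m u).trace =
        ∑ i, ∑ m, ξ m * I.mulVec (thirdDeriv G a m u i) i := by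
      rw [Finset.sum_comm]
      refine Finset.sum_congr rfl fun m _ => ?_
      rw [← Finset.mul_sum]
      congr 1
      simp only [Matrix.trace, Matrix.diag, Matrix.mul_apply, Matrix.mulVec, dotProduct]
      refine Finset.sum_congr rfl fun i _ => Finset.sum_congr rfl fun j _ => ?_
      rw [hG.thirdDeriv_comm hu hau m j i]
    rw [e1, e2, ← Finset.sum_sub_distrib]
    refine Finset.sum_congr rfl fun i _ => ?_
    rw [← Finset.sum_sub_distrib]
    refine Finset.sum_congr rfl fun m _ => ?_
    rw [Matrix.mulVec_sub, Pi.sub_apply]; ring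
  -- The Ricci identity produces `-Fᵀ da`; skewness `I Fᵀ = -F I` raises the index and turns this
  -- into `F ∇a`.
  have hF : ∀ i m, I.mulVec (thirdDeriv G a i u m - thirdDeriv G a m u i) =
      (curv G i m u).mulVec ξ := by
    intro i m
    have h1 : I * (curv G i m u).transpose = -(curv G i m u * I) :=
      eq_neg_of_add_eq_zero_right (hG.curv_inv hu i m)
    rw [hG.thirdDeriv_sub hu hau, Matrix.mulVec_neg, Matrix.mulVec_mulVec, h1, Matrix.neg_mulVec,
      neg_neg, ← Matrix.mulVec_mulVec]
    rfl
  have hR : ξ ⬝ᵥ (ricciLocal G u).mulVec ξ = ∑ i, ∑ m, ξ m * (curv G i m u).mulVec ξ i := by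
    simp only [dotProduct, Matrix.mulVec, Finset.mul_sum,
      ricciLocal_eq_sum_curv G u (hG.eventually_christoffel_comm hu), Finset.sum_mul]
    rw [Finset.sum_comm]
    rw [Finset.sum_comm (s := Finset.univ (α := Fin n))
      (f := fun i m => ∑ l, ξ m * (curv G i m u i l * ξ l))]
    refine Finset.sum_congr rfl fun m _ => ?_
    rw [Finset.sum_comm]
    refine Finset.sum_congr rfl fun i _ => Finset.sum_congr rfl fun l _ => ?_
    ring
  rw [hR]
  simp only [hF] at hD
  linarith [hD]

end IsLocalMetric

end Bochner

/-! ### Change of coordinates -/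

section CoordChange

variable {n : ℕ}

/-- The Jacobian matrix of a map between coordinate domains. -/
def jac (ψ : EuclideanSpace ℝ (Fin n) → EuclideanSpace ℝ (Fin n))
    (v : EuclideanSpace ℝ (Fin n)) : Matrix (Fin n) (Fin n) ℝ :=
  Matrix.of fun i j => pd j (fun w => ψ w i) v

/-- `ψ` is smooth, and pulls the metric `G` back to `G'`. -/
structure IsCoordChange (ψ : EuclideanSpace ℝ (Fin n) → EuclideanSpace ℝ (Fin n))
    (G' : EuclideanSpace ℝ (Fin n) → Matrix (Fin n) (Fin n) ℝ) (Ω' : Set (EuclideanSpace ℝ (Fin n)))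
    (G : EuclideanSpace ℝ (Fin n) → Matrix (Fin n) (Fin n) ℝ)
    (Ω : Set (EuclideanSpace ℝ (Fin n))) : Prop where
  source : IsLocalMetric G' Ω'
  target : IsLocalMetric G Ω
  mapsTo : Set.MapsTo ψ Ω' Ω
  smooth : ∀ v ∈ Ω', ContDiffAt ℝ ∞ ψ v
  pullback : ∀ v ∈ Ω', G' v = (jac ψ v).transpose * G (ψ v) * jac ψ v

lemma hessLocal_congr {G : EuclideanSpace ℝ (Fin n) → Matrix (Fin n) (Fin n) ℝ}
    {a b : EuclideanSpace ℝ (Fin n) → ℝ} {u : EuclideanSpace ℝ (Fin n)} (h : a =ᶠ[𝓝 u] b) :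
    hessLocal G a u = hessLocal G b u := by
  have h1 : ∀ j, pd j a =ᶠ[𝓝 u] pd j b := fun j => by
    filter_upwards [h.eventuallyEq_nhds] with v hv using pd_congr hv
  ext i j
  simp only [hessLocal, Matrix.of_apply]
  rw [pd_congr (h1 j)]
  congr 1
  exact Finset.sum_congr rfl fun k _ => by rw [(h1 k).eq_of_nhds]

lemma lapLocal_congr {G : EuclideanSpace ℝ (Fin n) → Matrix (Fin n) (Fin n) ℝ}
    {a b : EuclideanSpace ℝ (Fin n) → ℝ} {u : EuclideanSpace ℝ (Fin n)} (h : a =ᶠ[𝓝 u] b) :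
    lapLocal G a u = lapLocal G b u := by
  unfold lapLocal; rw [hessLocal_congr h]

lemma dot_congr_right {G : EuclideanSpace ℝ (Fin n) → Matrix (Fin n) (Fin n) ℝ}
    {a b c : EuclideanSpace ℝ (Fin n) → ℝ} {u : EuclideanSpace ℝ (Fin n)} (h : b =ᶠ[𝓝 u] c) :
    dot G a b u = dot G a c u := by
  have : dv b u = dv c u := by funext i; exact pd_congr h
  unfold dot gr; rw [this]

lemma mulVec_dotProduct_mulVec (J B : Matrix (Fin n) (Fin n) ℝ) (x y : Fin n → ℝ) :
    J.mulVec x ⬝ᵥ B.mulVec (J.mulVec y) = x ⬝ᵥ (J.transpose * B * J).mulVec y := by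
  rw [← Matrix.mulVec_mulVec, ← Matrix.mulVec_mulVec, Matrix.dotProduct_mulVec x,
    Matrix.vecMul_transpose]

/-- The symmetric part of the Ricci tensor. -/
def ricS (G : EuclideanSpace ℝ (Fin n) → Matrix (Fin n) (Fin n) ℝ)
    (u : EuclideanSpace ℝ (Fin n)) : Matrix (Fin n) (Fin n) ℝ :=
  (1 / 2 : ℝ) • (ricciLocal G u + (ricciLocal G u).transpose)

lemma dv_comp {ψ : EuclideanSpace ℝ (Fin n) → EuclideanSpace ℝ (Fin n)}
    {a : EuclideanSpace ℝ (Fin n) → ℝ} {v : EuclideanSpace ℝ (Fin n)}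
    (hψ : DifferentiableAt ℝ ψ v) (ha : DifferentiableAt ℝ a (ψ v)) :
    dv (a ∘ ψ) v = (jac ψ v).transpose.mulVec (dv a (ψ v)) := by
  ext j
  have hc : ∀ i, pd j (fun w => ψ w i) v = fderiv ℝ ψ v (EuclideanSpace.single j 1) i := by
    intro i
    have h1 : HasFDerivAt (fun w => ψ w i)
        ((EuclideanSpace.proj i : EuclideanSpace ℝ (Fin n) →L[ℝ] ℝ).comp (fderiv ℝ ψ v)) v :=
      (EuclideanSpace.proj i : EuclideanSpace ℝ (Fin n) →L[ℝ] ℝ).hasFDerivAt.comp v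
        hψ.hasFDerivAt
    unfold pd; rw [h1.fderiv]; rfl
  have h2 : dv (a ∘ ψ) v j = fderiv ℝ a (ψ v) (fderiv ℝ ψ v (EuclideanSpace.single j 1)) := by
    unfold dv pd
    rw [fderiv_comp v ha hψ]; rfl
  have h3 : ∀ w : EuclideanSpace ℝ (Fin n), fderiv ℝ a (ψ v) w = ∑ i, w i * dv a (ψ v) i := by
    intro w
    have : w = ∑ i, w i • EuclideanSpace.single i (1 : ℝ) := by
      ext k; simp [Pi.single_apply]
    conv_lhs => rw [this]
    simp [dv, pd]
  rw [h2, h3]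
  simp only [Matrix.mulVec, dotProduct, Matrix.transpose_apply, jac, Matrix.of_apply, hc]

namespace IsCoordChange

variable {ψ : EuclideanSpace ℝ (Fin n) → EuclideanSpace ℝ (Fin n)}
  {G' G : EuclideanSpace ℝ (Fin n) → Matrix (Fin n) (Fin n) ℝ}
  {Ω' Ω : Set (EuclideanSpace ℝ (Fin n))} {v : EuclideanSpace ℝ (Fin n)}
  {a b c : EuclideanSpace ℝ (Fin n) → ℝ}

lemma isUnit_jac (h : IsCoordChange ψ G' Ω' G Ω) (hv : v ∈ Ω') : IsUnit (jac ψ v).det := by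
  have h1 := h.source.det_pos v hv
  rw [h.pullback v hv, Matrix.det_mul] at h1
  exact isUnit_iff_ne_zero.2 (right_ne_zero_of_mul h1.ne')

lemma jac_mul_inv (h : IsCoordChange ψ G' Ω' G Ω) (hv : v ∈ Ω') :
    jac ψ v * (G' v)⁻¹ * (jac ψ v).transpose = (G (ψ v))⁻¹ := by
  have hJ := h.isUnit_jac hv
  have hJt : IsUnit (jac ψ v).transpose.det := by rwa [Matrix.det_transpose]
  rw [h.pullback v hv, Matrix.mul_inv_rev, Matrix.mul_inv_rev]
  rw [Matrix.mul_nonsing_inv_cancel_left _ _ hJ, Matrix.nonsing_inv_mul_cancel_right _ _ hJt]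

lemma trace_inv_mul (h : IsCoordChange ψ G' Ω' G Ω) (hv : v ∈ Ω')
    {Q' Q : Matrix (Fin n) (Fin n) ℝ} (hQ : Q' = (jac ψ v).transpose * Q * jac ψ v) :
    ((G' v)⁻¹ * Q').trace = ((G (ψ v))⁻¹ * Q).trace := by
  rw [hQ, ← h.jac_mul_inv hv]
  rw [← mul_assoc, ← mul_assoc, Matrix.trace_mul_comm]
  simp only [mul_assoc]

lemma trace_inv_mul_inv_mul (h : IsCoordChange ψ G' Ω' G Ω) (hv : v ∈ Ω')
    {Q' Q P' P : Matrix (Fin n) (Fin n) ℝ} (hQ : Q' = (jac ψ v).transpose * Q * jac ψ v)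
    (hP : P' = (jac ψ v).transpose * P * jac ψ v) :
    ((G' v)⁻¹ * Q' * (G' v)⁻¹ * P').trace =
      ((G (ψ v))⁻¹ * Q * (G (ψ v))⁻¹ * P).trace := by
  rw [hQ, hP, ← h.jac_mul_inv hv]
  have : (G' v)⁻¹ * ((jac ψ v).transpose * Q * jac ψ v) * (G' v)⁻¹ *
      ((jac ψ v).transpose * P * jac ψ v) = ((G' v)⁻¹ * ((jac ψ v).transpose * Q * jac ψ v) *
        (G' v)⁻¹ * (jac ψ v).transpose * P) * jac ψ v := by
    simp only [mul_assoc]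
  rw [this, Matrix.trace_mul_comm]
  simp only [mul_assoc]

lemma dv_comp (h : IsCoordChange ψ G' Ω' G Ω) (hv : v ∈ Ω') (ha : ContDiffAt ℝ ∞ a (ψ v)) :
    dv (a ∘ ψ) v = (jac ψ v).transpose.mulVec (dv a (ψ v)) :=
  ShrinkerEntropy.dv_comp ((h.smooth v hv).differentiableAt (by simp)) (ha.differentiableAt (by simp))

lemma jac_gr (h : IsCoordChange ψ G' Ω' G Ω) (hv : v ∈ Ω') (ha : ContDiffAt ℝ ∞ a (ψ v)) :
    (jac ψ v).mulVec (gr G' (a ∘ ψ) v) = gr G a (ψ v) := by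
  unfold gr
  rw [h.dv_comp hv ha, Matrix.mulVec_mulVec, Matrix.mulVec_mulVec, h.jac_mul_inv hv]

lemma dot_comp (h : IsCoordChange ψ G' Ω' G Ω) (hv : v ∈ Ω') (ha : ContDiffAt ℝ ∞ a (ψ v))
    (hb : ContDiffAt ℝ ∞ b (ψ v)) : dot G' (a ∘ ψ) (b ∘ ψ) v = dot G a b (ψ v) := by
  unfold dot
  rw [h.dv_comp hv ha, Matrix.mulVec_transpose, ← Matrix.dotProduct_mulVec, h.jac_gr hv hb]

/-- The linear function with differential `α`. -/
def linFun (α : Fin n → ℝ) : EuclideanSpace ℝ (Fin n) → ℝ := fun u => ∑ i, α i * u i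

lemma contDiff_linFun (α : Fin n → ℝ) : ContDiff ℝ ∞ (linFun α) := by
  unfold linFun; fun_prop

lemma dv_linFun (α : Fin n → ℝ) (u : EuclideanSpace ℝ (Fin n)) : dv (linFun α) u = α := by
  ext k
  have hp : ∀ i, DifferentiableAt ℝ (fun v : EuclideanSpace ℝ (Fin n) => v i) u := by
    intro i; fun_prop
  have hpd : ∀ i, pd k (fun v : EuclideanSpace ℝ (Fin n) => v i) u = if i = k then 1 else 0 := by
    intro i
    have : HasFDerivAt (fun v : EuclideanSpace ℝ (Fin n) => v i)
      (EuclideanSpace.proj i : EuclideanSpace ℝ (Fin n) →L[ℝ] ℝ) u :=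
      (EuclideanSpace.proj i : EuclideanSpace ℝ (Fin n) →L[ℝ] ℝ).hasFDerivAt
    unfold pd; rw [this.fderiv]
    simp [eq_comm]
  unfold dv linFun
  rw [pd_sum fun i _ => (hp i).const_mul _]
  simp [pd_const_mul _ (hp _), hpd]

/-- Every tangent vector is the gradient of a linear function pulled back by `ψ`, so a tensor
identity may be tested on gradients alone. -/
lemma exists_gr_eq (h : IsCoordChange ψ G' Ω' G Ω) (hv : v ∈ Ω') (x : Fin n → ℝ) :
    ∃ α, gr G' (linFun α ∘ ψ) v = x := by
  have hJt : IsUnit (jac ψ v).transpose.det := by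
    rw [Matrix.det_transpose]; exact h.isUnit_jac hv
  refine ⟨((jac ψ v).transpose)⁻¹.mulVec ((G' v).mulVec x), ?_⟩
  unfold gr
  rw [h.dv_comp hv (contDiff_linFun _).contDiffAt, dv_linFun,
    Matrix.mulVec_mulVec _ (jac ψ v).transpose, Matrix.mul_nonsing_inv _ hJt, Matrix.one_mulVec, Matrix.mulVec_mulVec,
    Matrix.nonsing_inv_mul _ (h.source.isUnit_det hv), Matrix.one_mulVec]

lemma eventually_comp {p : EuclideanSpace ℝ (Fin n) → Prop} (h : IsCoordChange ψ G' Ω' G Ω)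
    (hv : v ∈ Ω') (hp : ∀ w ∈ Ω', p w) : ∀ᶠ w in 𝓝 v, p w := by
  filter_upwards [h.source.mem_nhds hv] with w hw using hp w hw

lemma comp_smooth (h : IsCoordChange ψ G' Ω' G Ω) (ha : ∀ u ∈ Ω, ContDiffAt ℝ ∞ a u) :
    ∀ v ∈ Ω', ContDiffAt ℝ ∞ (a ∘ ψ) v := fun v hv =>
  (ha _ (h.mapsTo hv)).comp v (h.smooth v hv)

/-- By `hess_gr_gr` the Hessian evaluated on gradients is a combination of iterated inner products
of gradients, each preserved by `dot_comp`. No transformation law for Christoffel symbols is used.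
-/
lemma hess_comp (h : IsCoordChange ψ G' Ω' G Ω) (hv : v ∈ Ω') (hc : ∀ u ∈ Ω, ContDiffAt ℝ ∞ c u) :
    hessLocal G' (c ∘ ψ) v = (jac ψ v).transpose * hessLocal G c (ψ v) * jac ψ v := by
  have hu := h.mapsTo hv
  have key : ∀ x y : Fin n → ℝ, x ⬝ᵥ (hessLocal G' (c ∘ ψ) v).mulVec y =
      (jac ψ v).mulVec x ⬝ᵥ (hessLocal G c (ψ v)).mulVec ((jac ψ v).mulVec y) := by
    intro x y
    obtain ⟨α, rfl⟩ := h.exists_gr_eq hv x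
    obtain ⟨β, rfl⟩ := h.exists_gr_eq hv y
    have hα : ∀ u ∈ Ω, ContDiffAt ℝ ∞ (linFun α) u := fun u _ => (contDiff_linFun α).contDiffAt
    have hβ : ∀ u ∈ Ω, ContDiffAt ℝ ∞ (linFun β) u := fun u _ => (contDiff_linFun β).contDiffAt
    have ev : ∀ {a b : EuclideanSpace ℝ (Fin n) → ℝ}, (∀ u ∈ Ω, ContDiffAt ℝ ∞ a u) →
        (∀ u ∈ Ω, ContDiffAt ℝ ∞ b u) → dot G' (a ∘ ψ) (b ∘ ψ) =ᶠ[𝓝 v] dot G a b ∘ ψ :=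
      fun ha hb => h.eventually_comp hv fun w hw =>
        h.dot_comp hw (ha _ (h.mapsTo hw)) (hb _ (h.mapsTo hw))
    have sm : ∀ {a b : EuclideanSpace ℝ (Fin n) → ℝ}, (∀ u ∈ Ω, ContDiffAt ℝ ∞ a u) →
        (∀ u ∈ Ω, ContDiffAt ℝ ∞ b u) → ContDiffAt ℝ ∞ (dot G a b) (ψ v) :=
      fun ha hb => h.target.smooth_dot hu (ha _ hu) (hb _ hu)
    have h1 := h.source.hess_gr_gr hv (h.comp_smooth hα v hv) (h.comp_smooth hβ v hv)
      (h.comp_smooth hc v hv)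
    have h2 := h.target.hess_gr_gr hu (hα _ hu) (hβ _ hu) (hc _ hu)
    rw [dot_congr_right (ev hc hβ), dot_congr_right (ev hc hα), dot_congr_right (ev hα hβ),
      h.dot_comp hv (hα _ hu) (sm hc hβ), h.dot_comp hv (hβ _ hu) (sm hc hα),
      h.dot_comp hv (hc _ hu) (sm hα hβ), ← h2] at h1
    rw [h.jac_gr hv (hα _ hu), h.jac_gr hv (hβ _ hu)]
    linarith
  ext i j
  have := key (Pi.single i 1) (Pi.single j 1)
  rw [mulVec_dotProduct_mulVec] at this
  simpa using this

lemma lap_comp (h : IsCoordChange ψ G' Ω' G Ω) (hv : v ∈ Ω') (hc : ∀ u ∈ Ω, ContDiffAt ℝ ∞ c u) :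
    lapLocal G' (c ∘ ψ) v = lapLocal G c (ψ v) :=
  h.trace_inv_mul hv (h.hess_comp hv hc)

end IsCoordChange

lemma IsLocalMetric.smooth_lap {G : EuclideanSpace ℝ (Fin n) → Matrix (Fin n) (Fin n) ℝ}
    {Ω : Set (EuclideanSpace ℝ (Fin n))} {u : EuclideanSpace ℝ (Fin n)}
    {a : EuclideanSpace ℝ (Fin n) → ℝ} (hG : IsLocalMetric G Ω) (hu : u ∈ Ω)
    (ha : ContDiffAt ℝ ∞ a u) : ContDiffAt ℝ ∞ (lapLocal G a) u := by
  unfold lapLocal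
  simp only [Matrix.trace, Matrix.diag, Matrix.mul_apply]
  exact ContDiffAt.sum fun i _ => ContDiffAt.sum fun j _ =>
    (hG.smooth_inv hu i j).mul (hG.smooth_hess hu ha j i)

namespace IsCoordChange

variable {ψ : EuclideanSpace ℝ (Fin n) → EuclideanSpace ℝ (Fin n)}
  {G' G : EuclideanSpace ℝ (Fin n) → Matrix (Fin n) (Fin n) ℝ}
  {Ω' Ω : Set (EuclideanSpace ℝ (Fin n))} {v : EuclideanSpace ℝ (Fin n)}

/-- Bochner's formula expresses `Rc(∇a,∇a)` through the Laplacian, inner products of gradients and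
`|∇²a|²`, all already known to be invariant. -/
lemma ric_quadratic (h : IsCoordChange ψ G' Ω' G Ω) (hv : v ∈ Ω') (x : Fin n → ℝ) :
    x ⬝ᵥ (ricciLocal G' v).mulVec x =
      (jac ψ v).mulVec x ⬝ᵥ (ricciLocal G (ψ v)).mulVec ((jac ψ v).mulVec x) := by
  have hu := h.mapsTo hv
  obtain ⟨α, rfl⟩ := h.exists_gr_eq hv x
  have hα : ∀ u ∈ Ω, ContDiffAt ℝ ∞ (linFun α) u := fun u _ => (contDiff_linFun α).contDiffAt
  have hw : ∀ u ∈ Ω, ContDiffAt ℝ ∞ (dot G (linFun α) (linFun α)) u := fun u hu =>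
    h.target.smooth_dot hu (hα u hu) (hα u hu)
  have hl : ∀ u ∈ Ω, ContDiffAt ℝ ∞ (lapLocal G (linFun α)) u := fun u hu =>
    h.target.smooth_lap hu (hα u hu)
  have ev1 : dot G' (linFun α ∘ ψ) (linFun α ∘ ψ) =ᶠ[𝓝 v] dot G (linFun α) (linFun α) ∘ ψ :=
    h.eventually_comp hv fun w hw => h.dot_comp hw (hα _ (h.mapsTo hw)) (hα _ (h.mapsTo hw))
  have ev2 : lapLocal G' (linFun α ∘ ψ) =ᶠ[𝓝 v] lapLocal G (linFun α) ∘ ψ :=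
    h.eventually_comp hv fun w hw => h.lap_comp hw hα
  have hH := h.hess_comp hv hα
  rw [← h.source.bochner hv (h.comp_smooth hα), h.jac_gr hv (hα _ hu), ← h.target.bochner hu hα,
    lapLocal_congr ev1, dot_congr_right ev2, h.lap_comp hv hw,
    h.dot_comp hv (hα _ hu) (hl _ hu), h.trace_inv_mul_inv_mul hv hH hH]

/-- Polarization of `ric_quadratic`. A quadratic form determines only the symmetric part, hence
`ricS` instead of `ricciLocal`. -/
lemma ricS_pullback (h : IsCoordChange ψ G' Ω' G Ω) (hv : v ∈ Ω') :
    ricS G' v = (jac ψ v).transpose * ricS G (ψ v) * jac ψ v := by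
  set B := (jac ψ v).transpose * ricciLocal G (ψ v) * jac ψ v with hB
  have hq : ∀ x : Fin n → ℝ, x ⬝ᵥ (ricciLocal G' v).mulVec x = x ⬝ᵥ B.mulVec x := by
    intro x
    rw [h.ric_quadratic hv, mulVec_dotProduct_mulVec]
  have hs : ∀ i j, ricciLocal G' v i j + ricciLocal G' v j i = B i j + B j i := by
    intro i j
    have h1 := hq (Pi.single i 1 + Pi.single j 1)
    have h2 := hq (Pi.single i 1)
    have h3 := hq (Pi.single j 1)
    simp only [Matrix.mulVec_add, add_dotProduct, dotProduct_add, Matrix.mulVec_single_one,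
      single_dotProduct, one_mul, Matrix.col_apply] at h1 h2 h3
    linarith
  have hB' : ricS G' v = (1 / 2 : ℝ) • (B + B.transpose) := by
    ext i j
    simp only [ricS, Matrix.smul_apply, Matrix.add_apply, Matrix.transpose_apply]
    rw [hs]
  rw [hB', hB]
  simp only [ricS, Matrix.transpose_mul, Matrix.transpose_transpose, Matrix.mul_smul,
    Matrix.smul_mul, mul_add, add_mul, mul_assoc]

end IsCoordChange

end CoordChange

/-! ### Divergences -/

section Divergence

variable {n : ℕ}

/-- `√(det g)` times the divergence of the vector field `x`. -/
def divDens (G : EuclideanSpace ℝ (Fin n) → Matrix (Fin n) (Fin n) ℝ)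
    (x : EuclideanSpace ℝ (Fin n) → Fin n → ℝ) (u : EuclideanSpace ℝ (Fin n)) : ℝ :=
  ∑ i, pd i (fun v => Real.sqrt (G v).det * x v i) u

/-- The covariant derivative `∇_k h`. -/
def covM (G X : EuclideanSpace ℝ (Fin n) → Matrix (Fin n) (Fin n) ℝ) (k : Fin n)
    (u : EuclideanSpace ℝ (Fin n)) : Matrix (Fin n) (Fin n) ℝ :=
  pdM k X u - X u * conn G k u - (conn G k u).transpose * X u

/-- The divergence `g^{ij} ∇_i h_jk`. -/
def divM (G X : EuclideanSpace ℝ (Fin n) → Matrix (Fin n) (Fin n) ℝ)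
    (u : EuclideanSpace ℝ (Fin n)) : Fin n → ℝ :=
  fun a => ∑ i, ((G u)⁻¹ * covM G X i u) i a

namespace IsLocalMetric

variable {G : EuclideanSpace ℝ (Fin n) → Matrix (Fin n) (Fin n) ℝ}
  {Ω : Set (EuclideanSpace ℝ (Fin n))} {u : EuclideanSpace ℝ (Fin n)}
  {a b : EuclideanSpace ℝ (Fin n) → ℝ}

lemma smooth_sqrt_det (hG : IsLocalMetric G Ω) (hu : u ∈ Ω) :
    ContDiffAt ℝ ∞ (fun v => Real.sqrt (G v).det) u :=
  ((SmAt.det (s := 0) fun i j => SmAt.static (hG.smooth u hu i j)).sqrt (hG.det_pos u hu).ne').slice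

/-- The derivative of `√det` contributes the trace of the connection, which by torsion-freeness is
the connection term of the covariant divergence. -/
lemma divDens_eq (hG : IsLocalMetric G Ω) (hu : u ∈ Ω)
    {x : EuclideanSpace ℝ (Fin n) → Fin n → ℝ}
    (hx : ∀ i, DifferentiableAt ℝ (fun v => x v i) u) :
    divDens G x u = Real.sqrt (G u).det * ∑ i, (pdV i x u + (conn G i u).mulVec (x u)) i := by
  have h1 : ∀ i, pd i (fun v => Real.sqrt (G v).det * x v i) u =
      Real.sqrt (G u).det * (pdV i x u i + (conn G i u).trace * x u i) := by
    intro i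
    rw [pd_mul ((hG.smooth_sqrt_det hu).differentiableAt (by simp)) (hx i), hG.pd_sqrt_det hu]
    simp only [pdV]; ring
  unfold divDens
  rw [Finset.sum_congr rfl fun i _ => h1 i, ← Finset.mul_sum]
  congr 1
  simp only [Pi.add_apply, Finset.sum_add_distrib]
  congr 1
  simp only [Matrix.mulVec, dotProduct, Matrix.trace, Matrix.diag, Finset.sum_mul]
  rw [Finset.sum_comm]
  refine Finset.sum_congr rfl fun i _ => Finset.sum_congr rfl fun j _ => ?_
  simp only [conn, Matrix.of_apply]
  rw [hG.christoffel_comm hu]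

lemma divDens_smul (hG : IsLocalMetric G Ω) (hu : u ∈ Ω)
    {x : EuclideanSpace ℝ (Fin n) → Fin n → ℝ} (ha : DifferentiableAt ℝ a u)
    (hx : ∀ i, DifferentiableAt ℝ (fun v => x v i) u) :
    divDens G (fun v => a v • x v) u = a u * divDens G x u +
      Real.sqrt (G u).det * (dv a u ⬝ᵥ x u) := by
  have h1 : ∀ i, pd i (fun v => Real.sqrt (G v).det * (a v • x v) i) u =
      a u * pd i (fun v => Real.sqrt (G v).det * x v i) u +
        Real.sqrt (G u).det * (dv a u i * x u i) := by
    intro i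
    have hs : DifferentiableAt ℝ (fun v => Real.sqrt (G v).det) u :=
      (hG.smooth_sqrt_det hu).differentiableAt (by simp)
    have : (fun v => Real.sqrt (G v).det * (a v • x v) i) =
        fun v => a v * (Real.sqrt (G v).det * x v i) := by
      funext v; simp only [Pi.smul_apply, smul_eq_mul]; ring
    rw [this, pd_mul ha (hs.fun_mul (hx i))]
    simp only [dv]; ring
  unfold divDens
  rw [Finset.sum_congr rfl fun i _ => h1 i, Finset.sum_add_distrib, ← Finset.mul_sum,
    ← Finset.mul_sum]
  rfl

lemma divDens_gr (hG : IsLocalMetric G Ω) (hu : u ∈ Ω) (hb : ContDiffAt ℝ ∞ b u) :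
    divDens G (gr G b) u = Real.sqrt (G u).det * lapLocal G b u := by
  rw [hG.divDens_eq hu (hG.differentiableAt_gr hu hb)]
  congr 1
  unfold lapLocal Matrix.trace
  refine Finset.sum_congr rfl fun i _ => ?_
  rw [hG.pdV_gr hu hb, sub_add_cancel]
  simp only [Matrix.diag, Matrix.mul_apply, Matrix.mulVec, dotProduct]
  exact Finset.sum_congr rfl fun j _ => by rw [hG.hess_comm hu hb i j]

lemma divDens_smul_gr (hG : IsLocalMetric G Ω) (hu : u ∈ Ω) (ha : DifferentiableAt ℝ a u)
    (hb : ContDiffAt ℝ ∞ b u) :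
    divDens G (fun v => a v • gr G b v) u =
      Real.sqrt (G u).det * (a u * lapLocal G b u + dot G a b u) := by
  rw [hG.divDens_smul hu ha (hG.differentiableAt_gr hu hb), hG.divDens_gr hu hb]
  unfold dot; ring

lemma divDens_inv_mul_gr (hG : IsLocalMetric G Ω) (hu : u ∈ Ω)
    {X : EuclideanSpace ℝ (Fin n) → Matrix (Fin n) (Fin n) ℝ}
    (hX : ∀ i j, DifferentiableAt ℝ (fun v => X v i j) u) (hb : ContDiffAt ℝ ∞ b u) :
    divDens G (fun v => ((G v)⁻¹ * X v).mulVec (gr G b v)) u =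
      Real.sqrt (G u).det * (divM G X u ⬝ᵥ gr G b u +
        ((G u)⁻¹ * X u * (G u)⁻¹ * hessLocal G b u).trace) := by
  have hIX := differentiableAt_matrix_mul (hG.differentiableAt_inv hu) hX
  rw [hG.divDens_eq hu (differentiableAt_mulVec hIX (hG.differentiableAt_gr hu hb))]
  congr 1
  have h1 : ∀ i, pdV i (fun v => ((G v)⁻¹ * X v).mulVec (gr G b v)) u +
      (conn G i u).mulVec (((G u)⁻¹ * X u).mulVec (gr G b u)) =
      ((G u)⁻¹ * covM G X i u).mulVec (gr G b u) +
        ((G u)⁻¹ * X u * (G u)⁻¹).mulVec (hessLocal G b u i) := by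
    intro i
    rw [pdV_mulVec hIX (hG.differentiableAt_gr hu hb),
      pdM_mul (hG.differentiableAt_inv hu) hX, hG.pdM_inv hu, hG.pdV_gr hu hb]
    simp only [covM, Matrix.mulVec_sub, Matrix.mulVec_mulVec, mul_sub, Matrix.sub_mulVec,
      Matrix.add_mulVec, neg_mul, add_mul, Matrix.neg_mulVec, mul_assoc]
    abel
  rw [Finset.sum_congr rfl fun i _ => congrFun (h1 i) i]
  simp only [Pi.add_apply, Finset.sum_add_distrib]
  congr 1
  · simp only [Matrix.mulVec, dotProduct, divM, Finset.sum_mul]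
    rw [Finset.sum_comm]
  · unfold Matrix.trace
    refine Finset.sum_congr rfl fun i _ => ?_
    rw [Matrix.diag, Matrix.mul_apply]
    simp only [Matrix.mulVec, dotProduct]
    exact Finset.sum_congr rfl fun j _ => by rw [hG.hess_comm hu hb i j]

end IsLocalMetric

end Divergence

/-! ### The variation of the scalar curvature -/

section Palatini

variable {n : ℕ}

/-- A family of metrics, jointly smooth in the parameter and the coordinates. -/
structure IsMetricFamily (G : ℝ → EuclideanSpace ℝ (Fin n) → Matrix (Fin n) (Fin n) ℝ)
    (S : Set ℝ) (Ω : Set (EuclideanSpace ℝ (Fin n))) : Prop where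
  isOpen_param : IsOpen S
  isOpen : IsOpen Ω
  smooth : ∀ s ∈ S, ∀ u ∈ Ω, ∀ i j, SmAt (fun s v => G s v i j) s u
  symm : ∀ s ∈ S, ∀ u ∈ Ω, (G s u).transpose = G s u
  det_pos : ∀ s ∈ S, ∀ u ∈ Ω, 0 < (G s u).det

/-- The variation of a family of matrices. -/
def dsM (X : ℝ → EuclideanSpace ℝ (Fin n) → Matrix (Fin n) (Fin n) ℝ) (s : ℝ)
    (u : EuclideanSpace ℝ (Fin n)) : Matrix (Fin n) (Fin n) ℝ :=
  Matrix.of fun i j => deriv (fun s => X s u i j) s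

/-- `SmAt` for all the entries of a matrix. -/
def MSmAt (X : ℝ → EuclideanSpace ℝ (Fin n) → Matrix (Fin n) (Fin n) ℝ) (s : ℝ)
    (u : EuclideanSpace ℝ (Fin n)) : Prop :=
  ∀ i j, SmAt (fun s v => X s v i j) s u

section
variable {X Y : ℝ → EuclideanSpace ℝ (Fin n) → Matrix (Fin n) (Fin n) ℝ} {s : ℝ}
  {u : EuclideanSpace ℝ (Fin n)}

lemma dsM_congr (h : ∀ᶠ t in 𝓝 s, X t u = Y t u) : dsM X s u = dsM Y s u := by
  ext i j
  exact EventuallyEq.deriv_eq (h.mono fun t ht => by simp only [ht])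

lemma dsM_add (hX : MSmAt X s u) (hY : MSmAt Y s u) :
    dsM (fun s v => X s v + Y s v) s u = dsM X s u + dsM Y s u := by
  ext i j
  exact ((hX i j).hasDerivAt.add (hY i j).hasDerivAt).deriv

lemma dsM_sub (hX : MSmAt X s u) (hY : MSmAt Y s u) :
    dsM (fun s v => X s v - Y s v) s u = dsM X s u - dsM Y s u := by
  ext i j
  exact ((hX i j).hasDerivAt.sub (hY i j).hasDerivAt).deriv

lemma dsM_mul (hX : MSmAt X s u) (hY : MSmAt Y s u) :
    dsM (fun s v => X s v * Y s v) s u = dsM X s u * Y s u + X s u * dsM Y s u := by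
  ext i j
  simp only [dsM, Matrix.of_apply, Matrix.mul_apply, Matrix.add_apply]
  rw [← Finset.sum_add_distrib]
  exact (HasDerivAt.fun_sum fun l _ => (hX i l).hasDerivAt.fun_mul (hY l j).hasDerivAt).deriv

lemma dsM_transpose : dsM (fun s v => (X s v).transpose) s u = (dsM X s u).transpose := rfl

lemma dsM_pdM (hX : MSmAt X s u) (k : Fin n) :
    dsM (fun s v => pdM k (X s) v) s u = pdM k (dsM X s) u := by
  ext i j
  exact ((hX i j).pd_deriv_comm k).symm

lemma MSmAt.mul (hX : MSmAt X s u) (hY : MSmAt Y s u) : MSmAt (fun s v => X s v * Y s v) s u := by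
  intro i j
  simp only [Matrix.mul_apply]
  exact SmAt.sum fun l _ => (hX i l).mul (hY l j)

lemma MSmAt.add (hX : MSmAt X s u) (hY : MSmAt Y s u) : MSmAt (fun s v => X s v + Y s v) s u :=
  fun i j => (hX i j).add (hY i j)

lemma MSmAt.sub (hX : MSmAt X s u) (hY : MSmAt Y s u) : MSmAt (fun s v => X s v - Y s v) s u :=
  fun i j => (hX i j).sub (hY i j)

lemma MSmAt.transpose (hX : MSmAt X s u) : MSmAt (fun s v => (X s v).transpose) s u :=
  fun i j => hX j i

lemma MSmAt.pdM (hX : MSmAt X s u) (k : Fin n) : MSmAt (fun s v => pdM k (X s) v) s u :=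
  fun i j => (hX i j).pd k

lemma MSmAt.dsM (hX : MSmAt X s u) : MSmAt (dsM X) s u := fun i j => (hX i j).deriv

lemma MSmAt.trace (hX : MSmAt X s u) : SmAt (fun s v => (X s v).trace) s u :=
  SmAt.sum fun i _ => hX i i

lemma deriv_trace (hX : MSmAt X s u) : deriv (fun s => (X s u).trace) s = (dsM X s u).trace :=
  (HasDerivAt.fun_sum fun i _ => (hX i i).hasDerivAt).deriv

end

namespace IsMetricFamily

variable {G : ℝ → EuclideanSpace ℝ (Fin n) → Matrix (Fin n) (Fin n) ℝ} {S : Set ℝ}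
  {Ω : Set (EuclideanSpace ℝ (Fin n))} {s : ℝ} {u : EuclideanSpace ℝ (Fin n)}

lemma isLocalMetric (hG : IsMetricFamily G S Ω) (hs : s ∈ S) : IsLocalMetric (G s) Ω where
  isOpen := hG.isOpen
  smooth := fun u hu i j => (hG.smooth s hs u hu i j).slice
  symm := hG.symm s hs
  det_pos := hG.det_pos s hs

lemma sm_inv (hG : IsMetricFamily G S Ω) (hs : s ∈ S) (hu : u ∈ Ω) :
    MSmAt (fun s v => (G s v)⁻¹) s u :=
  fun i j => SmAt.matrix_inv (hG.smooth s hs u hu) (hG.det_pos s hs u hu).ne' i j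

lemma sm_conn (hG : IsMetricFamily G S Ω) (hs : s ∈ S) (hu : u ∈ Ω) (k : Fin n) :
    MSmAt (fun s v => conn (G s) k v) s u :=
  fun i j => SmAt.christoffel (hG.smooth s hs u hu) (hG.det_pos s hs u hu).ne' i k j

lemma sm_ric (hG : IsMetricFamily G S Ω) (hs : s ∈ S) (hu : u ∈ Ω) :
    MSmAt (fun s v => ricciLocal (G s) v) s u :=
  fun i j => SmAt.ricciLocal (hG.smooth s hs u hu) (hG.det_pos s hs u hu).ne' i j

lemma eventually_mem (hG : IsMetricFamily G S Ω) (hs : s ∈ S) : ∀ᶠ t in 𝓝 s, t ∈ S :=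
  hG.isOpen_param.mem_nhds hs

lemma dsM_inv (hG : IsMetricFamily G S Ω) (hs : s ∈ S) (hu : u ∈ Ω) :
    dsM (fun s v => (G s v)⁻¹) s u = -((G s u)⁻¹ * dsM G s u * (G s u)⁻¹) := by
  have hU := (hG.isLocalMetric hs).isUnit_det hu
  have h1 : dsM (fun s v => (G s v)⁻¹ * G s v) s u = 0 := by
    rw [dsM_congr (Y := fun _ _ => 1)]
    · ext i j; simp [dsM]
    · filter_upwards [hG.eventually_mem hs] with t ht
      exact Matrix.nonsing_inv_mul _ ((hG.isLocalMetric ht).isUnit_det hu)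
  rw [dsM_mul (hG.sm_inv hs hu) (hG.smooth s hs u hu)] at h1
  have h2 := congrArg (· * (G s u)⁻¹) h1
  simp only [add_mul, zero_mul] at h2
  rw [Matrix.mul_nonsing_inv_cancel_right _ _ hU] at h2
  exact eq_neg_of_add_eq_zero_left h2

/-- The variation `C` of the connection. -/
lemma covM_variation (hG : IsMetricFamily G S Ω) (hs : s ∈ S) (hu : u ∈ Ω) (k : Fin n) :
    covM (G s) (dsM G s) k u = G s u * dsM (fun s v => conn (G s) k v) s u +
      (G s u * dsM (fun s v => conn (G s) k v) s u).transpose := by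
  have hsm : MSmAt G s u := hG.smooth s hs u hu
  have hc := hG.sm_conn hs hu k
  have h1 : dsM (fun s v => pdM k (G s) v) s u =
      dsM (fun s v => G s v * conn (G s) k v + (conn (G s) k v).transpose * G s v) s u := by
    refine dsM_congr ?_
    filter_upwards [hG.eventually_mem hs] with t ht using (hG.isLocalMetric ht).pdM_metric hu k
  rw [dsM_pdM hsm, dsM_add (hsm.mul hc) (hc.transpose.mul hsm), dsM_mul hsm hc,
    dsM_mul hc.transpose hsm, dsM_transpose] at h1
  unfold covM
  rw [h1, Matrix.transpose_mul, hG.symm s hs u hu]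
  abel

/-- Torsion-freeness survives differentiation in the parameter: the variation of the connection is a
symmetric tensor in its lower indices. -/
lemma dsM_conn_comm (hG : IsMetricFamily G S Ω) (hs : s ∈ S) (hu : u ∈ Ω) (k l j : Fin n) :
    dsM (fun s v => conn (G s) k v) s u l j = dsM (fun s v => conn (G s) j v) s u l k := by
  refine EventuallyEq.deriv_eq ?_
  filter_upwards [hG.eventually_mem hs] with t ht
  exact (hG.isLocalMetric ht).christoffel_comm hu l k j

lemma dsM_ric (hG : IsMetricFamily G S Ω) (hs : s ∈ S) (hu : u ∈ Ω) (i j : Fin n) :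
    dsM (fun s v => ricciLocal (G s) v) s u i j =
      ∑ k, dsM (fun s v => curv (G s) k j v) s u k i := by
  have hc : ∀ k m, MSmAt (fun s v => curv (G s) k m v) s u := fun k m =>
    (((hG.sm_conn hs hu m).pdM k).sub ((hG.sm_conn hs hu k).pdM m)).add
      (((hG.sm_conn hs hu k).mul (hG.sm_conn hs hu m)).sub
        ((hG.sm_conn hs hu m).mul (hG.sm_conn hs hu k)))
  have h1 : dsM (fun s v => ricciLocal (G s) v) s u i j =
      deriv (fun s => ∑ k, curv (G s) k j u k i) s := by
    refine EventuallyEq.deriv_eq ?_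
    filter_upwards [hG.eventually_mem hs] with t ht
    exact ricciLocal_eq_sum_curv (G t) u
      ((hG.isLocalMetric ht).eventually_christoffel_comm hu) i j
  rw [h1]
  exact (HasDerivAt.fun_sum fun k _ => (hc k j k i).hasDerivAt).deriv

lemma dsM_curv (hG : IsMetricFamily G S Ω) (hs : s ∈ S) (hu : u ∈ Ω) (k m : Fin n) :
    dsM (fun s v => curv (G s) k m v) s u =
      pdM k (dsM (fun s v => conn (G s) m v) s) u - pdM m (dsM (fun s v => conn (G s) k v) s) u +
      ((dsM (fun s v => conn (G s) k v) s u * conn (G s) m u +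
        conn (G s) k u * dsM (fun s v => conn (G s) m v) s u) -
      (dsM (fun s v => conn (G s) m v) s u * conn (G s) k u +
        conn (G s) m u * dsM (fun s v => conn (G s) k v) s u)) := by
  have hc := fun k => hG.sm_conn hs hu k
  unfold curv
  rw [dsM_add (((hc m).pdM k).sub ((hc k).pdM m)) (((hc k).mul (hc m)).sub ((hc m).mul (hc k))),
    dsM_sub ((hc m).pdM k) ((hc k).pdM m), dsM_sub ((hc k).mul (hc m)) ((hc m).mul (hc k)),
    dsM_mul (hc k) (hc m), dsM_mul (hc m) (hc k), dsM_pdM (hc m), dsM_pdM (hc k)]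

/-- The vector field `V^k = g^{ij} C^k_ij - g^{ik} C^j_ij`. -/
def palatiniV (G : ℝ → EuclideanSpace ℝ (Fin n) → Matrix (Fin n) (Fin n) ℝ) (s : ℝ)
    (u : EuclideanSpace ℝ (Fin n)) : Fin n → ℝ := fun k =>
  ∑ m, ((dsM (fun s v => conn (G s) m v) s u * (G s u)⁻¹) k m -
    (dsM (fun s v => conn (G s) m v) s u * (G s u)⁻¹) m k)

lemma smooth_palatiniV (hG : IsMetricFamily G S Ω) (hs : s ∈ S) (hu : u ∈ Ω) (k : Fin n) :
    ContDiffAt ℝ ∞ (fun v => palatiniV G s v k) u := by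
  have h := fun m => (((hG.sm_conn hs hu m).dsM).mul (hG.sm_inv hs hu))
  unfold palatiniV
  exact ContDiffAt.sum fun m _ => ((h m k m).sub (h m m k)).slice

/-- Palatini's identity: `δRc` is an antisymmetrized covariant derivative of the variation `C` of
the connection, so its trace is the divergence of a contraction of `C`. -/
lemma divDens_palatiniV (hG : IsMetricFamily G S Ω) (hs : s ∈ S) (hu : u ∈ Ω) :
    divDens (G s) (palatiniV G s) u = Real.sqrt (G s u).det *
      ((G s u)⁻¹ * dsM (fun s v => ricciLocal (G s) v) s u).trace := by
  have hL := hG.isLocalMetric hs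
  set C : Fin n → EuclideanSpace ℝ (Fin n) → Matrix (Fin n) (Fin n) ℝ :=
    fun m => dsM (fun s v => conn (G s) m v) s with hC
  set I := (G s u)⁻¹ with hI
  set Γ : Fin n → Matrix (Fin n) (Fin n) ℝ := fun k => conn (G s) k u with hΓ
  set X : Fin n → Matrix (Fin n) (Fin n) ℝ := fun m => C m u * I with hX
  have hCd : ∀ m i j, DifferentiableAt ℝ (fun v => C m v i j) u := fun m i j =>
    ((hG.sm_conn hs hu m).dsM i j).differentiableAt
  have hCI : ∀ m i j, DifferentiableAt ℝ (fun v => (C m v * (G s v)⁻¹) i j) u := fun m =>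
    differentiableAt_matrix_mul (hCd m) (hL.differentiableAt_inv hu)
  rw [hL.divDens_eq hu fun k => (hG.smooth_palatiniV hs hu k).differentiableAt (by simp)]
  congr 1
  have hd : ∀ k m, pdM k (fun v => C m v * (G s v)⁻¹) u =
      pdM k (C m) u * I - C m u * Γ k * I - X m * (Γ k).transpose := by
    intro k m
    rw [pdM_mul (hCd m) (hL.differentiableAt_inv hu), hL.pdM_inv hu]
    simp only [hX, hΓ, ← hI, mul_neg, mul_add, mul_assoc]
    abel
  have h1 : ∀ k, pdV k (palatiniV G s) u k = ∑ m,
      ((pdM k (C m) u * I - C m u * Γ k * I - X m * (Γ k).transpose) k m -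
        (pdM k (C m) u * I - C m u * Γ k * I - X m * (Γ k).transpose) m k) := by
    intro k
    have e : pdV k (palatiniV G s) u k =
        pd k (fun v => ∑ m, ((C m v * (G s v)⁻¹) k m - (C m v * (G s v)⁻¹) m k)) u := rfl
    rw [e, pd_sum fun m _ => (hCI m k m).fun_sub (hCI m m k)]
    refine Finset.sum_congr rfl fun m _ => ?_
    rw [pd_sub (hCI m k m) (hCI m m k), ← hd]
    rfl
  have h2 : ∀ k, (conn (G s) k u).mulVec (palatiniV G s u) k =
      ∑ l, ∑ m, (Γ k k l * X m l m - Γ k k l * X m m l) := by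
    intro k
    simp only [Matrix.mulVec, dotProduct, palatiniV, Finset.mul_sum, mul_sub]
    rfl
  have hR : (I * dsM (fun s v => ricciLocal (G s) v) s u).trace =
      ∑ k, ∑ m, (dsM (fun s v => curv (G s) k m v) s u * I) k m := by
    simp only [Matrix.trace, Matrix.diag, Matrix.mul_apply, hG.dsM_ric hs hu, Finset.mul_sum]
    rw [Finset.sum_congr rfl fun i _ => Finset.sum_comm, Finset.sum_comm]
    refine Finset.sum_congr rfl fun k _ => Finset.sum_congr rfl fun m _ =>
      Finset.sum_congr rfl fun l _ => ?_
    rw [hI, hL.inv_comm hu m l]; ring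
  -- The remaining identities match quadratic connection terms. Torsion-freeness is needed only in
  -- `t1`; `t2`, `t3` and `t4` merely rename summation indices.
  have hsymm : ∀ k i j, Γ k i j = Γ j i k := fun k i j => hL.christoffel_comm hu i k j
  have t1 : ∑ k, ∑ m, (X m * (Γ k).transpose) k m = ∑ k, ∑ m, (Γ m * X k) k m := by
    simp only [Matrix.mul_apply, Matrix.transpose_apply]
    rw [Finset.sum_comm]
    refine Finset.sum_congr rfl fun m _ => ?_
    rw [Finset.sum_comm]
    refine Finset.sum_congr rfl fun l _ => Finset.sum_congr rfl fun k _ => ?_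
    rw [hsymm k m l]; ring
  have t2 : ∑ k, ∑ m, (X k * (Γ m).transpose) k m = ∑ k, ∑ l, ∑ m, Γ k k l * X m m l := by
    simp only [Matrix.mul_apply, Matrix.transpose_apply]
    rw [Finset.sum_comm]
    refine Finset.sum_congr rfl fun k _ => ?_
    rw [Finset.sum_comm]
    refine Finset.sum_congr rfl fun l _ => Finset.sum_congr rfl fun m _ => ?_
    ring
  have t3 : ∑ k, ∑ m, (Γ k * X m) k m = ∑ k, ∑ l, ∑ m, Γ k k l * X m l m := by
    simp only [Matrix.mul_apply]
    refine Finset.sum_congr rfl fun k _ => ?_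
    rw [Finset.sum_comm]
  have t4 : ∑ k, ∑ m, (pdM k (C m) u * I - C m u * Γ k * I - X m * (Γ k).transpose) m k =
      ∑ k, ∑ m, (pdM m (C k) u * I - C k u * Γ m * I - X k * (Γ m).transpose) k m := by
    rw [Finset.sum_comm]
  have hK : ∀ k m, dsM (fun s v => curv (G s) k m v) s u * I =
      pdM k (C m) u * I - pdM m (C k) u * I + (C k u * Γ m * I + Γ k * X m - (C m u * Γ k * I +
        Γ m * X k)) := by
    intro k m
    rw [hG.dsM_curv hs hu]
    simp only [hX, add_mul, sub_mul, mul_assoc]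
    rfl
  simp only [Pi.add_apply, Finset.sum_add_distrib, h1, h2, hR, hK, Finset.sum_sub_distrib,
    Matrix.sub_apply, Matrix.add_apply] at t4 ⊢
  linarith [t1, t2, t3, t4]

/-- The vector field `V` is dual to `div h - d (tr h)`. -/
lemma metric_mulVec_palatiniV (hG : IsMetricFamily G S Ω) (hs : s ∈ S) (hu : u ∈ Ω) :
    (G s u).mulVec (palatiniV G s u) = divM (G s) (dsM G s) u -
      dv (fun v => ((G s v)⁻¹ * dsM G s v).trace) u := by
  have hL := hG.isLocalMetric hs
  set C : Fin n → Matrix (Fin n) (Fin n) ℝ := fun m => dsM (fun s v => conn (G s) m v) s u with hC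
  set I := (G s u)⁻¹ with hI
  have hCs : ∀ k l j, C k l j = C j l k := hG.dsM_conn_comm hs hu
  have hY : ∀ k l j, (G s u * C k) l j = (G s u * C j) l k := by
    intro k l j
    simp only [Matrix.mul_apply]
    exact Finset.sum_congr rfl fun p _ => by rw [hCs]
  have hIY : ∀ k, I * (G s u * C k) = C k := fun k =>
    Matrix.nonsing_inv_mul_cancel_left _ _ (hL.isUnit_det hu)
  have hcov : ∀ k, covM (G s) (dsM G s) k u = G s u * C k + (G s u * C k).transpose :=
    hG.covM_variation hs hu
  have hIt : I.transpose = I := hL.inv_transpose hu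
  have htr : ∀ a, (I * (G s u * C a).transpose).trace = (C a).trace := by
    intro a
    rw [← Matrix.trace_transpose, Matrix.transpose_mul, Matrix.transpose_transpose, hIt,
      Matrix.trace_mul_comm, hIY]
  ext a
  have h1 : dv (fun v => ((G s v)⁻¹ * dsM G s v).trace) u a = 2 * (C a).trace := by
    have := hL.pd_trace_inv_mul hu (X := dsM G s)
      (fun i j => (SmAt.deriv (hG.smooth s hs u hu i j)).differentiableAt) a
    have e : covM (G s) (dsM G s) a u = pdM a (dsM G s) u - dsM G s u * conn (G s) a u -
      (conn (G s) a u).transpose * dsM G s u := rfl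
    unfold dv
    rw [this, ← e, hcov, mul_add, Matrix.trace_add, ← hI, htr, hIY]
    ring
  have h2 : divM (G s) (dsM G s) u a =
      (C a).trace + ∑ m, (G s u * C m * I) a m := by
    simp only [divM, hcov, mul_add, Matrix.add_apply, Finset.sum_add_distrib, ← hI]
    congr 1
    · simp only [hIY, Matrix.trace, Matrix.diag]
      exact Finset.sum_congr rfl fun i _ => hCs i i a
    · refine Finset.sum_congr rfl fun i _ => ?_
      have : (I * (G s u * C i).transpose) i a = ((G s u * C i) * I.transpose) a i := by
        rw [← Matrix.transpose_apply ((G s u * C i) * I.transpose),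
          Matrix.transpose_mul _ I.transpose, Matrix.transpose_transpose]
      rw [this, hIt]
  have h3 : (G s u).mulVec (palatiniV G s u) a = ∑ m, (G s u * C m * I) a m - (C a).trace := by
    have e1 : (G s u).mulVec (palatiniV G s u) a =
        ∑ k, ∑ m, (G s u a k * (C m * I) k m - G s u a k * (C m * I) m k) := by
      simp only [Matrix.mulVec, dotProduct, palatiniV, Finset.mul_sum, mul_sub]
      rfl
    rw [e1, Finset.sum_comm]
    simp only [Finset.sum_sub_distrib]
    congr 1
    · refine Finset.sum_congr rfl fun m _ => ?_
      rw [mul_assoc, Matrix.mul_apply]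
    · refine Finset.sum_congr rfl fun m _ => ?_
      have : ∑ k, G s u a k * (C m * I) m k = (C m * I * G s u) m a := by
        rw [Matrix.mul_apply]
        exact Finset.sum_congr rfl fun k _ => by rw [hL.apply_comm hu a k, mul_comm]
      rw [this, Matrix.nonsing_inv_mul_cancel_right _ _ (hL.isUnit_det hu), Matrix.diag, hCs]
  rw [h3, Pi.sub_apply, h1, h2]
  ring

/-- The divergence form of the variation of the scalar curvature. -/
lemma divDens_variation (hG : IsMetricFamily G S Ω) (hs : s ∈ S) (hu : u ∈ Ω)
    {χ : EuclideanSpace ℝ (Fin n) → ℝ} (hχ : ContDiffAt ℝ ∞ χ u) :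
    divDens (G s) (fun v => χ v • palatiniV G s v) u -
      divDens (G s) (fun v => ((G s v)⁻¹ * dsM G s v).mulVec (gr (G s) χ v)) u +
      divDens (G s) (fun v => ((G s v)⁻¹ * dsM G s v).trace • gr (G s) χ v) u =
    Real.sqrt (G s u).det *
      (χ u * deriv (fun s => ((G s u)⁻¹ * ricciLocal (G s) u).trace) s +
        χ u * ((G s u)⁻¹ * dsM G s u * (G s u)⁻¹ * ricciLocal (G s) u).trace -
        ((G s u)⁻¹ * dsM G s u * (G s u)⁻¹ * hessLocal (G s) χ u).trace +
        ((G s u)⁻¹ * dsM G s u).trace * lapLocal (G s) χ u) := by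
  have hL := hG.isLocalMetric hs
  have hH : MSmAt (dsM G) s u := MSmAt.dsM (hG.smooth s hs u hu)
  have hq : SmAt (fun s v => ((G s v)⁻¹ * dsM G s v).trace) s u :=
    MSmAt.trace ((hG.sm_inv hs hu).mul hH)
  rw [hL.divDens_smul hu (hχ.differentiableAt (by simp))
      fun k => (hG.smooth_palatiniV hs hu k).differentiableAt (by simp),
    hL.divDens_inv_mul_gr hu (fun i j => (hH i j).differentiableAt) hχ,
    hL.divDens_smul_gr hu hq.differentiableAt hχ, hG.divDens_palatiniV hs hu,
    deriv_trace ((hG.sm_inv hs hu).mul (hG.sm_ric hs hu)),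
    dsM_mul (hG.sm_inv hs hu) (hG.sm_ric hs hu), hG.dsM_inv hs hu]
  -- Pairing through the metric brings in `div h - d(tr h)`; these two terms cancel the `div h` and
  -- `d(tr h)` terms of the other two divergences.
  have h1 : dv χ u ⬝ᵥ palatiniV G s u = gr (G s) χ u ⬝ᵥ (G s u).mulVec (palatiniV G s u) := by
    unfold gr
    rw [← hL.dotProduct_inv hu, Matrix.mulVec_mulVec, Matrix.nonsing_inv_mul _ (hL.isUnit_det hu),
      Matrix.one_mulVec]
  rw [h1, hG.metric_mulVec_palatiniV hs hu, dotProduct_sub]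
  unfold dot
  rw [dotProduct_comm (gr (G s) χ u) (divM _ _ _), dotProduct_comm (gr (G s) χ u) (dv _ _),
    Matrix.trace_add, neg_mul, Matrix.trace_neg]
  ring

end IsMetricFamily

end Palatini

/-! ### Tensors in charts -/

section Charts

variable {n : ℕ} {M : Type*} [TopologicalSpace M] [ChartedSpace (EuclideanSpace ℝ (Fin n)) M]

/-- The change of coordinates from the chart around `c'` to the chart around `c`. -/
def trans (c' c : M) : OpenPartialHomeomorph (EuclideanSpace ℝ (Fin n)) (EuclideanSpace ℝ (Fin n)) :=
  (chartAt (EuclideanSpace ℝ (Fin n)) c').symm.trans (chartAt (EuclideanSpace ℝ (Fin n)) c)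

lemma trans_apply (c' c : M) (v : EuclideanSpace ℝ (Fin n)) :
    trans c' c v = chartAt (EuclideanSpace ℝ (Fin n)) c
      ((chartAt (EuclideanSpace ℝ (Fin n)) c').symm v) := rfl

lemma mem_trans_source {c' c : M} {v : EuclideanSpace ℝ (Fin n)} : v ∈ (trans c' c).source ↔
    v ∈ (chartAt (EuclideanSpace ℝ (Fin n)) c').target ∧
      (chartAt (EuclideanSpace ℝ (Fin n)) c').symm v ∈
        (chartAt (EuclideanSpace ℝ (Fin n)) c).source := by
  simp [trans]

lemma trans_mem_target {c' c : M} {v : EuclideanSpace ℝ (Fin n)} (hv : v ∈ (trans c' c).source) :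
    trans c' c v ∈ (chartAt (EuclideanSpace ℝ (Fin n)) c).target :=
  (chartAt (EuclideanSpace ℝ (Fin n)) c).map_source (mem_trans_source.1 hv).2

lemma symm_trans {c' c : M} {v : EuclideanSpace ℝ (Fin n)} (hv : v ∈ (trans c' c).source) :
    (chartAt (EuclideanSpace ℝ (Fin n)) c).symm (trans c' c v) =
      (chartAt (EuclideanSpace ℝ (Fin n)) c').symm v :=
  (chartAt (EuclideanSpace ℝ (Fin n)) c).left_inv (mem_trans_source.1 hv).2

lemma funComp_trans (f : M → ℝ) {c' c : M} {v : EuclideanSpace ℝ (Fin n)}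
    (hv : v ∈ (trans c' c).source) : funComp f c' v = (funComp f c ∘ trans c' c) v := by
  simp only [funComp, Function.comp_apply, symm_trans hv]

variable [IsManifold (𝓡 n) ∞ M]

lemma contMDiffAt_chart_symm {c : M} {u : EuclideanSpace ℝ (Fin n)}
    (hu : u ∈ (chartAt (EuclideanSpace ℝ (Fin n)) c).target) :
    ContMDiffAt (𝓡 n) (𝓡 n) ∞ (chartAt (EuclideanSpace ℝ (Fin n)) c).symm u :=
  (contMDiffOn_chart_symm (I := 𝓡 n) (n := ∞)).contMDiffAt
    ((chartAt (EuclideanSpace ℝ (Fin n)) c).open_target.mem_nhds hu)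

/-- The coordinate field is the image of a constant field under the tangent map of the inverse
chart, and that tangent map is smooth on the chart target. -/
lemma contMDiffAt_coordVec {c : M} {u : EuclideanSpace ℝ (Fin n)}
    (hu : u ∈ (chartAt (EuclideanSpace ℝ (Fin n)) c).target) (i : Fin n) :
    ContMDiffAt (𝓡 n) (𝓡 n).tangent ∞ (fun u => (⟨(chartAt (EuclideanSpace ℝ (Fin n)) c).symm u,
      coordVec c u i⟩ : TangentBundle (𝓡 n) M)) u := by
  set e := chartAt (EuclideanSpace ℝ (Fin n)) c with he
  have h1 := ContMDiffOn.contMDiffOn_tangentMapWithin (m := ∞) (n := ∞)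
    (contMDiffOn_chart_symm (I := 𝓡 n) (n := ∞) (x := c)) (by simp)
    e.open_target.uniqueMDiffOn
  have h2 : ContMDiff (𝓡 n) (𝓡 n).tangent ∞ (fun u : EuclideanSpace ℝ (Fin n) =>
      (⟨u, EuclideanSpace.single i 1⟩ : TangentBundle (𝓡 n) (EuclideanSpace ℝ (Fin n)))) :=
    contMDiff_vectorSpace_iff_contDiff.2 contDiff_const
  have h3 : ContMDiffOn (𝓡 n) (𝓡 n).tangent ∞ (fun u => tangentMapWithin (𝓡 n) (𝓡 n) e.symm e.target
      (⟨u, EuclideanSpace.single i 1⟩ : TangentBundle (𝓡 n) (EuclideanSpace ℝ (Fin n)))) e.target :=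
    h1.comp h2.contMDiffOn (fun u hu => hu)
  refine (h3.contMDiffAt (e.open_target.mem_nhds hu)).congr_of_eventuallyEq ?_
  filter_upwards [e.open_target.mem_nhds hu] with v hv
  unfold tangentMapWithin coordVec
  rw [mfderivWithin_of_mem_nhds (e.open_target.mem_nhds hv)]

lemma comps_smooth {h : Tensor2 n M} (hh : h.Smooth) {c : M} {u : EuclideanSpace ℝ (Fin n)}
    (hu : u ∈ (chartAt (EuclideanSpace ℝ (Fin n)) c).target) (i j : Fin n) :
    ContDiffAt ℝ ∞ (fun u => comps h c u i j) u := by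
  have h1 := (hh.contMDiffAt (x := (chartAt (EuclideanSpace ℝ (Fin n)) c).symm u)).comp u
    (contMDiffAt_chart_symm hu)
  have h2 := ContMDiffAt.clm_bundle_apply₂ (E₃ := Bundle.Trivial M ℝ) (F₃ := ℝ) h1
    (contMDiffAt_coordVec hu i) (contMDiffAt_coordVec hu j)
  exact (Bundle.contMDiffAt_totalSpace.1 h2).2.contDiffAt

lemma contDiffAt_trans {c' c : M} {v : EuclideanSpace ℝ (Fin n)} (hv : v ∈ (trans c' c).source) :
    ContDiffAt ℝ ∞ (trans c' c) v := by
  rw [← contMDiffAt_iff_contDiffAt]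
  have h1 := contMDiffAt_chart_symm (mem_trans_source.1 hv).1
  have h2 : ContMDiffAt (𝓡 n) (𝓡 n) ∞ (chartAt (EuclideanSpace ℝ (Fin n)) c)
      ((chartAt (EuclideanSpace ℝ (Fin n)) c').symm v) :=
    (contMDiffOn_chart (I := 𝓡 n) (n := ∞)).contMDiffAt
      ((chartAt (EuclideanSpace ℝ (Fin n)) c).open_source.mem_nhds (mem_trans_source.1 hv).2)
  exact h2.comp v h1

lemma fderiv_single_eq_sum {ψ : EuclideanSpace ℝ (Fin n) → EuclideanSpace ℝ (Fin n)}
    {v : EuclideanSpace ℝ (Fin n)} (hψ : DifferentiableAt ℝ ψ v) (j : Fin n) :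
    fderiv ℝ ψ v (EuclideanSpace.single j 1) =
      ∑ k, jac ψ v k j • EuclideanSpace.single k (1 : ℝ) := by
  have hc : ∀ i, jac ψ v i j = fderiv ℝ ψ v (EuclideanSpace.single j 1) i := by
    intro i
    have h1 : HasFDerivAt (fun w => ψ w i)
        ((EuclideanSpace.proj i : EuclideanSpace ℝ (Fin n) →L[ℝ] ℝ).comp (fderiv ℝ ψ v)) v :=
      (EuclideanSpace.proj i : EuclideanSpace ℝ (Fin n) →L[ℝ] ℝ).hasFDerivAt.comp v
        hψ.hasFDerivAt
    simp only [jac, Matrix.of_apply, pd]; rw [h1.fderiv]; rfl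
  ext k
  simp [hc, Pi.single_apply]

lemma comps_trans (h : Tensor2 n M) {c' c : M} {v : EuclideanSpace ℝ (Fin n)}
    (hv : v ∈ (trans c' c).source) :
    comps h c' v = (jac (trans c' c) v).transpose * comps h c (trans c' c v) *
      jac (trans c' c) v := by
  -- All tangent spaces are definitionally the model space; retyping the tensor and the chart
  -- differentials there allows ordinary linear algebra across different base points.
  let hE : M → EuclideanSpace ℝ (Fin n) →L[ℝ] EuclideanSpace ℝ (Fin n) →L[ℝ] ℝ := h
  let D : EuclideanSpace ℝ (Fin n) →L[ℝ] EuclideanSpace ℝ (Fin n) :=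
    mfderiv (𝓡 n) (𝓡 n) (chartAt (EuclideanSpace ℝ (Fin n)) c).symm (trans c' c v)
  let D' : EuclideanSpace ℝ (Fin n) →L[ℝ] EuclideanSpace ℝ (Fin n) :=
    mfderiv (𝓡 n) (𝓡 n) (chartAt (EuclideanSpace ℝ (Fin n)) c').symm v
  have hd : DifferentiableAt ℝ (trans c' c) v := (contDiffAt_trans hv).differentiableAt (by simp)
  have hD : D' = D.comp (fderiv ℝ (trans c' c) v) := by
    have h1 : (chartAt (EuclideanSpace ℝ (Fin n)) c').symm =ᶠ[𝓝 v]
        (chartAt (EuclideanSpace ℝ (Fin n)) c).symm ∘ trans c' c := by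
      filter_upwards [(trans c' c).open_source.mem_nhds hv] with w hw using (symm_trans hw).symm
    have h2 := mfderiv_comp (I := 𝓡 n) (I' := 𝓡 n) (I'' := 𝓡 n) v
      ((contMDiffAt_chart_symm (trans_mem_target hv)).mdifferentiableAt (by simp))
      hd.mdifferentiableAt
    have h3 := h1.mfderiv_eq (I := 𝓡 n) (I' := 𝓡 n)
    rw [mfderiv_eq_fderiv] at h2
    exact h3.trans h2
  have hDj : ∀ j, D' (EuclideanSpace.single j 1) =
      ∑ k, jac (trans c' c) v k j • D (EuclideanSpace.single k 1) := by
    intro j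
    rw [hD, ContinuousLinearMap.comp_apply, fderiv_single_eq_sum hd, map_sum]
    simp
  ext i j
  have e1 : comps h c' v i j = hE ((chartAt (EuclideanSpace ℝ (Fin n)) c').symm v)
      (D' (EuclideanSpace.single i 1)) (D' (EuclideanSpace.single j 1)) := rfl
  have e2 : ∀ k l, comps h c (trans c' c v) k l =
      hE ((chartAt (EuclideanSpace ℝ (Fin n)) c').symm v)
        (D (EuclideanSpace.single k 1)) (D (EuclideanSpace.single l 1)) := by
    intro k l
    rw [← symm_trans hv]; rfl
  rw [e1, hDj, hDj]
  simp only [Matrix.mul_apply, Matrix.transpose_apply, e2, map_sum, map_smul,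
    sum_apply, smul_apply, smul_eq_mul, Finset.sum_mul,
    Finset.mul_sum]
  refine Finset.sum_congr rfl fun l _ => Finset.sum_congr rfl fun k _ => ?_
  ring

end Charts

/-! ### Integrals of divergences -/

section DivergenceTheorem

variable {n : ℕ}

/-- Vanishing off a compact subset of `Ω` lets `Z` be extended by zero to a compactly supported `C¹`
function on the whole space; integration by parts against the constant `1` then gives zero. -/
lemma integral_pd_eq_zero {Ω K : Set (EuclideanSpace ℝ (Fin n))} (hΩ : IsOpen Ω) (hK : IsCompact K)
    (hKΩ : K ⊆ Ω) {Z : EuclideanSpace ℝ (Fin n) → ℝ} (hZ : ∀ u ∈ Ω, ContDiffAt ℝ ∞ Z u)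
    (h0 : ∀ u ∈ Ω, u ∉ K → Z u = 0) (i : Fin n) : ∫ u in Ω, pd i Z u = 0 := by
  classical
  set Y : EuclideanSpace ℝ (Fin n) → ℝ := Ω.indicator Z with hY
  have hYZ : ∀ u ∈ Ω, Y =ᶠ[𝓝 u] Z := fun u hu => by
    filter_upwards [hΩ.mem_nhds hu] with v hv using Set.indicator_of_mem hv _
  have hYK : ∀ u, u ∉ K → Y u = 0 := fun u hu => by
    by_cases h : u ∈ Ω
    · rw [hY, Set.indicator_of_mem h, h0 u h hu]
    · exact Set.indicator_of_notMem h _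
  have hY0 : ∀ u, u ∉ Ω → Y =ᶠ[𝓝 u] fun _ => 0 := fun u hu => by
    filter_upwards [hK.isClosed.isOpen_compl.mem_nhds (fun h => hu (hKΩ h))] with v hv
      using hYK v hv
  have hs : ContDiff ℝ 1 Y := by
    rw [contDiff_iff_contDiffAt]
    intro u
    by_cases h : u ∈ Ω
    · exact ((hZ u h).congr_of_eventuallyEq (hYZ u h)).of_le (by simp)
    · exact contDiffAt_const.congr_of_eventuallyEq (hY0 u h)
  have hc : HasCompactSupport Y := HasCompactSupport.intro hK hYK
  have h1 : ∫ u in Ω, pd i Z u = ∫ u, fderiv ℝ Y u (EuclideanSpace.single i 1) := by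
    rw [← integral_indicator hΩ.measurableSet]
    congr 1
    funext u
    by_cases h : u ∈ Ω
    · rw [Set.indicator_of_mem h]; exact (pd_congr (hYZ u h)).symm
    · rw [Set.indicator_of_notMem h, (hY0 u h).fderiv_eq]; simp
  rw [h1]
  have hint : Integrable Y := hs.continuous.integrable_of_hasCompactSupport hc
  have hint' : Integrable (fun u => fderiv ℝ Y u (EuclideanSpace.single i 1)) :=
    Continuous.integrable_of_hasCompactSupport
      ((hs.continuous_fderiv one_ne_zero).clm_apply continuous_const)
      (hc.fderiv_apply ℝ _)
  have := integral_mul_fderiv_eq_neg_fderiv_mul_of_integrable (μ := volume) (f := Y)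
    (g := fun _ => (1 : ℝ)) (v := EuclideanSpace.single i 1) (by simpa using hint') (by simp)
    (by simpa using hint) (fun u _ => (hs.differentiable one_ne_zero).differentiableAt)
    (fun u _ => differentiableAt_const _)
  simpa using this.symm

lemma integral_divDens_eq_zero {G : EuclideanSpace ℝ (Fin n) → Matrix (Fin n) (Fin n) ℝ}
    {Ω K : Set (EuclideanSpace ℝ (Fin n))} (hG : IsLocalMetric G Ω) (hK : IsCompact K)
    (hKΩ : K ⊆ Ω) {x : EuclideanSpace ℝ (Fin n) → Fin n → ℝ}
    (hx : ∀ u ∈ Ω, ∀ i, ContDiffAt ℝ ∞ (fun v => x v i) u)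
    (h0 : ∀ u ∈ Ω, u ∉ K → x u = 0) :
    IntegrableOn (divDens G x) Ω ∧ ∫ u in Ω, divDens G x u = 0 := by
  have hsm : ∀ i, ∀ u ∈ Ω, ContDiffAt ℝ ∞ (fun v => Real.sqrt (G v).det * x v i) u := fun i u hu =>
    (hG.smooth_sqrt_det hu).mul (hx u hu i)
  have hz : ∀ i, ∀ u ∈ Ω, u ∉ K → Real.sqrt (G u).det * x u i = 0 := fun i u hu hk => by
    rw [h0 u hu hk]; simp
  have hint : ∀ i, IntegrableOn (pd i fun v => Real.sqrt (G v).det * x v i) Ω := by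
    intro i
    have hzero : ∀ u ∈ Ω, u ∉ K → pd i (fun v => Real.sqrt (G v).det * x v i) u = 0 := by
      intro u hu hk
      have : (fun v => Real.sqrt (G v).det * x v i) =ᶠ[𝓝 u] fun _ => 0 := by
        filter_upwards [hG.mem_nhds hu, hK.isClosed.isOpen_compl.mem_nhds hk] with v hv hvk
          using hz i v hv hvk
      rw [pd_congr this, pd_const]
    have hK' : IntegrableOn (pd i fun v => Real.sqrt (G v).det * x v i) K :=
      ContinuousOn.integrableOn_compact hK fun u hu =>
        (contDiffAt_pd i (hsm i u (hKΩ hu))).continuousAt.continuousWithinAt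
    exact (integrableOn_iff_integrable_of_support_subset (s := K) (f := Ω.indicator (pd i fun v =>
      Real.sqrt (G v).det * x v i)) (by
        intro u hu
        by_contra hk
        refine hu ?_
        by_cases h : u ∈ Ω
        · rw [Set.indicator_of_mem h, hzero u h hk]
        · exact Set.indicator_of_notMem h _)).1
      ((integrableOn_congr_fun (fun u hu => (Set.indicator_of_mem (hKΩ hu) _).symm)
        hK.measurableSet).1 hK') |> (integrable_indicator_iff hG.isOpen.measurableSet).1
  refine ⟨integrable_finsetSum _ fun i _ => hint i, ?_⟩
  unfold divDens
  rw [integral_finsetSum _ fun i _ => hint i]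
  exact Finset.sum_eq_zero fun i _ =>
    integral_pd_eq_zero hG.isOpen hK hKΩ (hsm i) (hz i) i

end DivergenceTheorem

/-! ### The Riemannian volume in charts -/

section Volume

variable {n : ℕ} {M : Type*} [TopologicalSpace M] [ChartedSpace (EuclideanSpace ℝ (Fin n)) M]

/-- Smoothness of the components of a tensor in all charts. -/
def SmoothComps (k : Tensor2 n M) : Prop :=
  ∀ c : M, ∀ u ∈ (chartAt (EuclideanSpace ℝ (Fin n)) c).target, ∀ i j,
    ContDiffAt ℝ ∞ (fun u => comps k c u i j) u

lemma det_fderiv (ψ : EuclideanSpace ℝ (Fin n) → EuclideanSpace ℝ (Fin n))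
    {v : EuclideanSpace ℝ (Fin n)} (hψ : DifferentiableAt ℝ ψ v) :
    (fderiv ℝ ψ v).det = (jac ψ v).det := by
  let b := (EuclideanSpace.basisFun (Fin n) ℝ).toBasis
  unfold ContinuousLinearMap.det
  rw [← LinearMap.det_toMatrix b]
  congr 1
  ext i j
  rw [LinearMap.toMatrix_apply]
  simp [b, fderiv_single_eq_sum hψ]

lemma SmoothComps.continuousOn_sqrt_det {k : Tensor2 n M} (hk : SmoothComps k) (c : M) :
    ContinuousOn (fun u => Real.sqrt (comps k c u).det)
      (chartAt (EuclideanSpace ℝ (Fin n)) c).target := fun u hu =>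
  (Real.continuous_sqrt.continuousAt.comp
    (SmAt.det (s := 0) fun i j => SmAt.static (hk c u hu i j)).slice.continuousAt).continuousWithinAt

variable [MeasurableSpace M] [BorelSpace M]

lemma measurableSet_target_inter_preimage (c : M) {A : Set M} (hA : MeasurableSet A) :
    MeasurableSet ((chartAt (EuclideanSpace ℝ (Fin n)) c).target ∩
      (chartAt (EuclideanSpace ℝ (Fin n)) c).symm ⁻¹' A) := by
  classical
  set e := chartAt (EuclideanSpace ℝ (Fin n)) c with he
  -- The inverse chart is controlled only on its target; replacing it by a constant elsewhere gives
  -- a measurable map with the same preimage there.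
  have h1 : Measurable (e.target.piecewise e.symm fun _ => c) :=
    ContinuousOn.measurable_piecewise e.continuousOn_symm continuousOn_const
      e.open_target.measurableSet
  have h2 := e.open_target.measurableSet.inter (h1 hA)
  convert h2 using 1
  ext u
  simp only [Set.mem_inter_iff, Set.mem_preimage]
  refine and_congr_right fun hu => ?_
  rw [Set.piecewise_eq_of_mem _ _ _ hu]

lemma aemeasurable_chart_symm (c : M) : AEMeasurable (chartAt (EuclideanSpace ℝ (Fin n)) c).symm
    (volume.restrict (chartAt (EuclideanSpace ℝ (Fin n)) c).target) :=
  (chartAt (EuclideanSpace ℝ (Fin n)) c).continuousOn_symm.aemeasurable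
    (chartAt (EuclideanSpace ℝ (Fin n)) c).open_target.measurableSet

lemma chartVol_apply (k : Tensor2 n M) (c : M) {A : Set M} (hA : MeasurableSet A) :
    chartVol k c A = ∫⁻ u in (chartAt (EuclideanSpace ℝ (Fin n)) c).target ∩
      (chartAt (EuclideanSpace ℝ (Fin n)) c).symm ⁻¹' A,
        ENNReal.ofReal (Real.sqrt (comps k c u).det) := by
  unfold chartVol
  rw [Measure.map_apply_of_aemeasurable ((aemeasurable_chart_symm c).mono_ac
      (withDensity_absolutelyContinuous _ _)) hA, withDensity_apply',
    Measure.restrict_restrict' (chartAt (EuclideanSpace ℝ (Fin n)) c).open_target.measurableSet,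
    Set.inter_comm]

lemma chartVol_compl (k : Tensor2 n M) (c : M) :
    chartVol k c (chartAt (EuclideanSpace ℝ (Fin n)) c).sourceᶜ = 0 := by
  rw [chartVol_apply k c (chartAt (EuclideanSpace ℝ (Fin n)) c).open_source.measurableSet.compl]
  have : (chartAt (EuclideanSpace ℝ (Fin n)) c).target ∩
      (chartAt (EuclideanSpace ℝ (Fin n)) c).symm ⁻¹'
        (chartAt (EuclideanSpace ℝ (Fin n)) c).sourceᶜ = ∅ := by
    ext u
    simp only [Set.mem_inter_iff, Set.mem_preimage, Set.mem_compl_iff, Set.mem_empty_iff_false,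
      iff_false, not_and, not_not]
    exact fun hu => (chartAt (EuclideanSpace ℝ (Fin n)) c).map_target hu
  rw [this]; simp

variable [IsManifold (𝓡 n) ∞ M]

/-- Change of variables: the factor `|det J|` is exactly the factor by which `√det g` changes,
because `g` pulls back as `Jᵀ g J`. -/
lemma chartVol_eq_chartVol (k : Tensor2 n M) (c c' : M) {A : Set M} (hA : MeasurableSet A)
    (hc : A ⊆ (chartAt (EuclideanSpace ℝ (Fin n)) c).source)
    (hc' : A ⊆ (chartAt (EuclideanSpace ℝ (Fin n)) c').source) :
    chartVol k c A = chartVol k c' A := by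
  set e := chartAt (EuclideanSpace ℝ (Fin n)) c with he
  set e' := chartAt (EuclideanSpace ℝ (Fin n)) c' with he'
  rw [chartVol_apply k c hA, chartVol_apply k c' hA, ← he, ← he']
  set S := e'.target ∩ e'.symm ⁻¹' A with hS
  have hsrc : ∀ v ∈ S, v ∈ (trans c' c).source := fun v hv =>
    mem_trans_source.2 ⟨hv.1, hc hv.2⟩
  have himg : e.target ∩ e.symm ⁻¹' A = trans c' c '' S := by
    ext u
    constructor
    · rintro ⟨hu, huA⟩
      refine ⟨e' (e.symm u), ⟨e'.map_source (hc' huA), ?_⟩, ?_⟩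
      · rw [Set.mem_preimage, e'.left_inv (hc' huA)]; exact huA
      · rw [trans_apply, ← he, ← he', e'.left_inv (hc' huA), e.right_inv hu]
    · rintro ⟨v, hv, rfl⟩
      refine ⟨trans_mem_target (hsrc v hv), ?_⟩
      rw [Set.mem_preimage, symm_trans (hsrc v hv)]; exact hv.2
  have hd : ∀ v ∈ S, DifferentiableAt ℝ (trans c' c) v := fun v hv =>
    (contDiffAt_trans (hsrc v hv)).differentiableAt (by simp)
  rw [himg, lintegral_image_eq_lintegral_abs_det_fderiv_mul volume
    (measurableSet_target_inter_preimage c' hA)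
    (fun v hv => (hd v hv).hasFDerivAt.hasFDerivWithinAt)
    ((trans c' c).injOn.mono hsrc)]
  refine setLIntegral_congr_fun (measurableSet_target_inter_preimage c' hA) fun v hv => ?_
  rw [det_fderiv _ (hd v hv), comps_trans k (hsrc v hv), Matrix.det_mul, Matrix.det_mul,
    Matrix.det_transpose, ← ENNReal.ofReal_mul (abs_nonneg _)]
  congr 1
  rw [show (jac (trans c' c) v).det * (comps k c (trans c' c v)).det * (jac (trans c' c) v).det =
    (jac (trans c' c) v).det ^ 2 * (comps k c (trans c' c v)).det by ring,
    Real.sqrt_mul (sq_nonneg _), Real.sqrt_sq_eq_abs]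

/-- A supremum of measures is awkward to evaluate, but `chartVol k c` plus the part of `vol k`
outside the chart dominates every chart measure, hence also the supremum. Overlap invariance handles
the part inside the chart. -/
lemma vol_restrict (k : Tensor2 n M) (c : M) :
    (vol k).restrict (chartAt (EuclideanSpace ℝ (Fin n)) c).source = chartVol k c := by
  set U := (chartAt (EuclideanSpace ℝ (Fin n)) c).source with hU
  have hUm : MeasurableSet U := (chartAt (EuclideanSpace ℝ (Fin n)) c).open_source.measurableSet
  have hle : vol k ≤ chartVol k c + (vol k).restrict Uᶜ := by
    refine iSup_le fun c' => Measure.le_iff.2 fun A hA => ?_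
    set U' := (chartAt (EuclideanSpace ℝ (Fin n)) c').source with hU'
    have hUm' : MeasurableSet U' :=
      (chartAt (EuclideanSpace ℝ (Fin n)) c').open_source.measurableSet
    have h1 : chartVol k c' (A ∩ U) ≤ chartVol k c A := by
      have h2 : chartVol k c' (A ∩ U) ≤ chartVol k c' (A ∩ U ∩ U') := by
        refine (measure_le_inter_add_sdiff _ _ U').trans ?_
        have : chartVol k c' ((A ∩ U) \ U') = 0 :=
          measure_mono_null (fun x hx => hx.2) (chartVol_compl k c')
        rw [this, add_zero]
      refine h2.trans ?_
      rw [chartVol_eq_chartVol k c' c ((hA.inter hUm).inter hUm') (fun x hx => hx.2)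
        (fun x hx => hx.1.2)]
      exact measure_mono fun x hx => hx.1.1
    have h3 : chartVol k c' (A \ U) ≤ (vol k).restrict Uᶜ A := by
      rw [Measure.restrict_apply hA]
      exact le_iSup (fun c => chartVol k c) c' (A ∩ Uᶜ)
    rw [Measure.add_apply, ← measure_inter_add_sdiff (μ := chartVol k c') A hUm]
    exact add_le_add h1 h3
  refine le_antisymm ?_ ?_
  · refine Measure.le_iff.2 fun A hA => ?_
    rw [Measure.restrict_apply hA]
    refine (hle (A ∩ U)).trans ?_
    rw [Measure.add_apply, Measure.restrict_apply (hA.inter hUm)]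
    have : A ∩ U ∩ Uᶜ = ∅ := by ext x; simp +contextual
    rw [this, measure_empty, add_zero]
    exact measure_mono Set.inter_subset_left
  · refine Measure.le_iff.2 fun A hA => ?_
    rw [Measure.restrict_apply hA]
    calc chartVol k c A ≤ chartVol k c (A ∩ U) + chartVol k c (A \ U) :=
          measure_le_inter_add_sdiff _ _ _
      _ = chartVol k c (A ∩ U) := by
          have h0 : chartVol k c (A \ U) = 0 :=
            measure_mono_null (fun x hx => hx.2) (chartVol_compl k c)
          rw [h0, add_zero]
      _ ≤ vol k (A ∩ U) := le_iSup (fun c => chartVol k c) c (A ∩ U)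

/-- By compactness it suffices that each point has a neighbourhood of finite volume. A compact piece
of the chart works, the density being continuous and so bounded on it. -/
lemma isFiniteMeasure_vol [CompactSpace M] {k : Tensor2 n M} (hk : SmoothComps k) :
    IsFiniteMeasure (vol k) := by
  refine ⟨isCompact_univ.measure_lt_top_of_nhdsWithin fun x _ => ?_⟩
  set e := chartAt (EuclideanSpace ℝ (Fin n)) x with he
  have hx : x ∈ e.source := mem_chart_source _ x
  obtain ⟨K, hK, hKt, hKc⟩ := exists_compact_subset e.open_target (e.map_source hx)
  rw [nhdsWithin_univ]
  refine ⟨e.source ∩ e ⁻¹' interior K, e.continuousOn.isOpen_inter_preimage e.open_source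
    isOpen_interior |>.mem_nhds ⟨hx, hKt⟩, ?_⟩
  have hopen : MeasurableSet (e.source ∩ e ⁻¹' interior K) :=
    (e.continuousOn.isOpen_inter_preimage e.open_source isOpen_interior).measurableSet
  have h1 : vol k (e.source ∩ e ⁻¹' interior K) = chartVol k x (e.source ∩ e ⁻¹' interior K) := by
    rw [← vol_restrict k x, Measure.restrict_apply hopen, ← he,
      Set.inter_eq_left.2 Set.inter_subset_left]
  rw [h1, chartVol_apply k x hopen, ← he]
  have h2 : e.target ∩ e.symm ⁻¹' (e.source ∩ e ⁻¹' interior K) ⊆ K := by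
    rintro u ⟨hu, -, huK⟩
    rw [Set.mem_preimage, e.right_inv hu] at huK
    exact interior_subset huK
  refine (lintegral_mono_set h2).trans_lt ?_
  obtain ⟨C, hC⟩ := (hK.image_of_continuousOn
    ((hk.continuousOn_sqrt_det x).mono hKc)).bddAbove
  calc ∫⁻ u in K, ENNReal.ofReal (Real.sqrt (comps k x u).det)
      ≤ ∫⁻ _ in K, ENNReal.ofReal C := setLIntegral_mono measurable_const fun u hu =>
        ENNReal.ofReal_le_ofReal (hC ⟨u, hu, rfl⟩)
    _ = ENNReal.ofReal C * volume K := by simp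
    _ < ⊤ := ENNReal.mul_lt_top ENNReal.ofReal_lt_top hK.measure_lt_top

lemma integral_vol_of_support {k : Tensor2 n M} (hk : SmoothComps k) (c : M) {B : M → ℝ}
    (hB : Continuous B) (hs : Function.support B ⊆ (chartAt (EuclideanSpace ℝ (Fin n)) c).source) :
    ∫ x, B x ∂(vol k) = ∫ u in (chartAt (EuclideanSpace ℝ (Fin n)) c).target,
      Real.sqrt (comps k c u).det * funComp B c u := by
  set e := chartAt (EuclideanSpace ℝ (Fin n)) c with he
  have h1 : ∫ x, B x ∂(vol k) = ∫ x, B x ∂(chartVol k c) := by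
    rw [← vol_restrict k c]
    exact (setIntegral_eq_integral_of_forall_compl_eq_zero fun x hx => by
      by_contra h; exact hx (hs h)).symm
  have hsymm : AEMeasurable e.symm ((volume.restrict e.target).withDensity fun u =>
      ENNReal.ofReal (Real.sqrt (comps k c u).det)) :=
    (aemeasurable_chart_symm c).mono_ac (withDensity_absolutelyContinuous _ _)
  have hdens : AEMeasurable (fun u => ENNReal.ofReal (Real.sqrt (comps k c u).det))
      (volume.restrict e.target) :=
    ((hk.continuousOn_sqrt_det c).aemeasurable e.open_target.measurableSet).ennreal_ofReal
  rw [h1, chartVol, integral_map hsymm hB.aestronglyMeasurable,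
    integral_withDensity_eq_integral_toReal_smul₀ hdens (by simp)]
  refine integral_congr_ae (Eventually.of_forall fun u => ?_)
  simp only [smul_eq_mul, funComp, ENNReal.toReal_ofReal (Real.sqrt_nonneg _)]
  rfl

end Volume

/-! ### Functions on a manifold given by invariant local expressions -/

section Glue

variable {n : ℕ} {M : Type*} [TopologicalSpace M] [ChartedSpace (EuclideanSpace ℝ (Fin n)) M]

lemma coord_mem_target (p : M) : coord p ∈ (chartAt (EuclideanSpace ℝ (Fin n)) p).target :=
  mem_chart_target _ p

lemma chart_symm_coord (p : M) : (chartAt (EuclideanSpace ℝ (Fin n)) p).symm (coord p) = p :=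
  (chartAt (EuclideanSpace ℝ (Fin n)) p).left_inv (mem_chart_source _ p)

/-- The function with the given local expressions in the charts. -/
def glue (L : M → EuclideanSpace ℝ (Fin n) → ℝ) (p : M) : ℝ := L p (coord p)

/-- A family of local expressions that does not depend on the choice of the chart. -/
def ChartInvariant (L : M → EuclideanSpace ℝ (Fin n) → ℝ) : Prop :=
  ∀ c' c : M, ∀ v ∈ (trans c' c).source, L c' v = L c (trans c' c v)

/-- `glue` reads each value in the preferred chart of that very point, and this chart may jump with
the point. Invariance lets one fixed chart serve on its whole domain, which is how smoothness is
then obtained. -/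
lemma ChartInvariant.glue_eq {L : M → EuclideanSpace ℝ (Fin n) → ℝ} (hL : ChartInvariant L)
    {c p : M} (hp : p ∈ (chartAt (EuclideanSpace ℝ (Fin n)) c).source) :
    glue L p = L c (chartAt (EuclideanSpace ℝ (Fin n)) c p) := by
  have h1 : (coord p : EuclideanSpace ℝ (Fin n)) ∈ (trans p c).source := mem_trans_source.2
    ⟨coord_mem_target p, by rwa [chart_symm_coord]⟩
  rw [glue, hL p c _ h1, trans_apply, chart_symm_coord]

lemma ChartInvariant.funComp_glue {L : M → EuclideanSpace ℝ (Fin n) → ℝ} (hL : ChartInvariant L)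
    {c : M} {u : EuclideanSpace ℝ (Fin n)}
    (hu : u ∈ (chartAt (EuclideanSpace ℝ (Fin n)) c).target) :
    funComp (glue L) c u = L c u := by
  rw [funComp, hL.glue_eq ((chartAt (EuclideanSpace ℝ (Fin n)) c).map_target hu),
    (chartAt (EuclideanSpace ℝ (Fin n)) c).right_inv hu]

/-- Smoothness of a function in all charts. -/
def SmoothFun (n : ℕ) {M : Type*} [TopologicalSpace M]
    [ChartedSpace (EuclideanSpace ℝ (Fin n)) M] (a : M → ℝ) : Prop :=
  ∀ c : M, ∀ u ∈ (chartAt (EuclideanSpace ℝ (Fin n)) c).target, ContDiffAt ℝ ∞ (funComp a c) u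

/-- Joint smoothness of a one-parameter family of functions in all charts. -/
def SmoothFam (n : ℕ) {M : Type*} [TopologicalSpace M]
    [ChartedSpace (EuclideanSpace ℝ (Fin n)) M] (A : ℝ → M → ℝ) (S : Set ℝ) : Prop :=
  ∀ c : M, ∀ s ∈ S, ∀ u ∈ (chartAt (EuclideanSpace ℝ (Fin n)) c).target,
    SmAt (fun s => funComp (A s) c) s u

lemma ChartInvariant.smoothFun {L : M → EuclideanSpace ℝ (Fin n) → ℝ} (hL : ChartInvariant L)
    (h : ∀ c : M, ∀ u ∈ (chartAt (EuclideanSpace ℝ (Fin n)) c).target, ContDiffAt ℝ ∞ (L c) u) :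
    SmoothFun n (glue L) := fun c u hu => by
  refine (h c u hu).congr_of_eventuallyEq ?_
  filter_upwards [(chartAt (EuclideanSpace ℝ (Fin n)) c).open_target.mem_nhds hu] with v hv
    using hL.funComp_glue hv

lemma smoothFam_glue {L : ℝ → M → EuclideanSpace ℝ (Fin n) → ℝ} {S : Set ℝ} (hS : IsOpen S)
    (hL : ∀ s ∈ S, ChartInvariant (L s))
    (h : ∀ c : M, ∀ s ∈ S, ∀ u ∈ (chartAt (EuclideanSpace ℝ (Fin n)) c).target,
      SmAt (fun s => L s c) s u) :
    SmoothFam n (fun s => glue (L s)) S := fun c s hs u hu => by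
  refine ContDiffAt.congr_of_eventuallyEq (h c s hs u hu) ?_
  have h1 : S ×ˢ (chartAt (EuclideanSpace ℝ (Fin n)) c).target ∈ 𝓝 (s, u) :=
    prod_mem_nhds (hS.mem_nhds hs)
      ((chartAt (EuclideanSpace ℝ (Fin n)) c).open_target.mem_nhds hu)
  filter_upwards [h1] with q hq using (hL q.1 hq.1).funComp_glue hq.2

lemma SmoothFam.smoothFun {A : ℝ → M → ℝ} {S : Set ℝ} (h : SmoothFam n A S) {s : ℝ} (hs : s ∈ S) :
    SmoothFun n (A s) := fun c u hu => (h c s hs u hu).slice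

lemma SmoothFun.smoothFam {a : M → ℝ} (h : SmoothFun n a) (S : Set ℝ) : SmoothFam n (fun _ => a) S :=
  fun c _ _ u hu => SmAt.static (h c u hu)

lemma SmoothFam.mono {A : ℝ → M → ℝ} {S S' : Set ℝ} (h : SmoothFam n A S) (hS : S' ⊆ S) :
    SmoothFam n A S' := fun c s hs u hu => h c s (hS hs) u hu

lemma SmoothFam.deriv {A : ℝ → M → ℝ} {S : Set ℝ} (h : SmoothFam n A S) :
    SmoothFam n (fun s x => deriv (fun s => A s x) s) S := fun c s hs u hu => (h c s hs u hu).deriv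

lemma SmoothFam.hasDerivAt {A : ℝ → M → ℝ} {S : Set ℝ} (h : SmoothFam n A S) {s : ℝ} (hs : s ∈ S)
    (x : M) : HasDerivAt (fun s => A s x) (_root_.deriv (fun s => A s x) s) s := by
  have := (h x s hs (coord x) (coord_mem_target x)).hasDerivAt
  simpa only [funComp, chart_symm_coord] using this

lemma SmoothFam.continuousAt {A : ℝ → M → ℝ} {S : Set ℝ} (h : SmoothFam n A S) {s : ℝ} (hs : s ∈ S)
    (x : M) : ContinuousAt (fun q : ℝ × M => A q.1 q.2) (s, x) := by
  set e := chartAt (EuclideanSpace ℝ (Fin n)) x with he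
  have h1 : ContinuousAt (fun q : ℝ × EuclideanSpace ℝ (Fin n) => funComp (A q.1) x q.2)
      (s, e x) := (h x s hs (coord x) (coord_mem_target x)).continuousAt
  have hx : e.source ∈ 𝓝 x := e.open_source.mem_nhds (mem_chart_source _ x)
  have h2 : ContinuousAt (fun q : ℝ × M => (q.1, e q.2)) (s, x) :=
    continuousAt_fst.prodMk
      (ContinuousAt.comp (e.continuousAt (mem_chart_source _ x)) continuousAt_snd)
  refine (ContinuousAt.comp (f := fun q : ℝ × M => (q.1, e q.2)) h1 h2).congr ?_
  filter_upwards [prod_mem_nhds univ_mem hx] with q hq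
  simp only [Function.comp_apply, funComp, ← he, e.left_inv hq.2]

lemma SmoothFun.continuous {a : M → ℝ} (h : SmoothFun n a) : Continuous a :=
  continuous_iff_continuousAt.2 fun x =>
    ContinuousAt.comp (f := fun x : M => ((0 : ℝ), x))
      ((h.smoothFam Set.univ).continuousAt (Set.mem_univ 0) x)
      (continuousAt_const.prodMk continuousAt_id)

section Algebra

variable {a b : M → ℝ} {A B : ℝ → M → ℝ} {S : Set ℝ}

lemma SmoothFam.add (hA : SmoothFam n A S) (hB : SmoothFam n B S) :
    SmoothFam n (fun s x => A s x + B s x) S := fun c s hs u hu => (hA c s hs u hu).add (hB c s hs u hu)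

lemma SmoothFam.mul (hA : SmoothFam n A S) (hB : SmoothFam n B S) :
    SmoothFam n (fun s x => A s x * B s x) S := fun c s hs u hu => (hA c s hs u hu).mul (hB c s hs u hu)

lemma SmoothFam.exp_neg (hA : SmoothFam n A S) : SmoothFam n (fun s x => Real.exp (-A s x)) S :=
  fun c s hs u hu => ContDiffAt.exp (ContDiffAt.neg (hA c s hs u hu))

lemma SmoothFun.add (ha : SmoothFun n a) (hb : SmoothFun n b) : SmoothFun n (fun x => a x + b x) :=
  fun c u hu => (ha c u hu).add (hb c u hu)

lemma SmoothFun.sub (ha : SmoothFun n a) (hb : SmoothFun n b) : SmoothFun n (fun x => a x - b x) :=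
  fun c u hu => (ha c u hu).sub (hb c u hu)

lemma SmoothFun.mul (ha : SmoothFun n a) (hb : SmoothFun n b) : SmoothFun n (fun x => a x * b x) :=
  fun c u hu => (ha c u hu).mul (hb c u hu)

lemma SmoothFun.const (r : ℝ) : SmoothFun n (fun _ : M => r) := fun _ _ _ => contDiffAt_const

lemma SmoothFun.const_mul (r : ℝ) (ha : SmoothFun n a) : SmoothFun n (fun x => r * a x) :=
  SmoothFun.mul (SmoothFun.const r) ha

lemma SmoothFun.exp_neg (ha : SmoothFun n a) : SmoothFun n (fun x => Real.exp (-a x)) :=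
  fun c u hu => ContDiffAt.exp (ContDiffAt.neg (ha c u hu))

lemma SmoothFun.sum {κ : Type*} {t : Finset κ} {a : κ → M → ℝ} (h : ∀ k ∈ t, SmoothFun n (a k)) :
    SmoothFun n (fun x => ∑ k ∈ t, a k x) := fun c u hu => ContDiffAt.sum fun k hk => h k hk c u hu

end Algebra

variable [IsManifold (𝓡 n) ∞ M]

lemma smoothFun_iff {a : M → ℝ} : SmoothFun n a ↔ ContMDiff (𝓡 n) 𝓘(ℝ, ℝ) ∞ a := by
  constructor
  · intro h x
    set e := chartAt (EuclideanSpace ℝ (Fin n)) x with he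
    have hx := mem_chart_source (EuclideanSpace ℝ (Fin n)) x
    have h1 : ContMDiffAt (𝓡 n) 𝓘(ℝ, ℝ) ∞ (funComp a x) (e x) :=
      (h x (coord x) (coord_mem_target x)).contMDiffAt
    have h2 : ContMDiffAt (𝓡 n) (𝓡 n) ∞ e x :=
      (contMDiffOn_chart (I := 𝓡 n) (n := ∞)).contMDiffAt (e.open_source.mem_nhds hx)
    refine (h1.comp x h2).congr_of_eventuallyEq ?_
    filter_upwards [e.open_source.mem_nhds hx] with y hy
    simp only [Function.comp_apply, funComp, ← he, e.left_inv hy]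
  · intro h c u hu
    exact ((h _).comp u (contMDiffAt_chart_symm hu)).contDiffAt

lemma smoothFam_of_contMDiffOn {A : ℝ → M → ℝ} {S : Set ℝ} (hS : IsOpen S)
    (h : ContMDiffOn (𝓘(ℝ, ℝ).prod (𝓡 n)) 𝓘(ℝ, ℝ) ∞ (fun q : ℝ × M => A q.1 q.2)
      (S ×ˢ Set.univ)) : SmoothFam n A S := by
  intro c s hs u hu
  set e := chartAt (EuclideanSpace ℝ (Fin n)) c with he
  have h1 : ContMDiffAt (𝓘(ℝ, ℝ).prod (𝓡 n)) 𝓘(ℝ, ℝ) ∞ (fun q : ℝ × M => A q.1 q.2)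
      (s, e.symm u) := h.contMDiffAt ((hS.prod isOpen_univ).mem_nhds ⟨hs, Set.mem_univ _⟩)
  have h2 : ContMDiffAt (𝓘(ℝ, ℝ).prod (𝓡 n)) (𝓘(ℝ, ℝ).prod (𝓡 n)) ∞
      (fun q : ℝ × EuclideanSpace ℝ (Fin n) => (q.1, e.symm q.2)) (s, u) :=
    contMDiffAt_fst.prodMk ((contMDiffAt_chart_symm hu).comp (s, u) contMDiffAt_snd)
  have h3 := ContMDiffAt.comp (g := fun q : ℝ × M => A q.1 q.2) (s, u) h1 h2
  rw [← modelWithCornersSelf_prod, chartedSpaceSelf_prod] at h3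
  exact h3.contDiffAt

end Glue

/-! ### Metrics on a manifold and their scalar invariants -/

section Metrics

variable {n : ℕ} {M : Type*} [TopologicalSpace M] [ChartedSpace (EuclideanSpace ℝ (Fin n)) M]

/-- The components of `k` in each chart form a metric. -/
def IsMetric (k : Tensor2 n M) : Prop :=
  ∀ c : M, IsLocalMetric (comps k c) (chartAt (EuclideanSpace ℝ (Fin n)) c).target

/-- `Δa`. -/
def lapM (k : Tensor2 n M) (a : M → ℝ) : M → ℝ :=
  glue fun c u => lapLocal (comps k c) (funComp a c) u

/-- `⟨∇a, ∇b⟩`. -/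
def dotM (k : Tensor2 n M) (a b : M → ℝ) : M → ℝ :=
  glue fun c u => dot (comps k c) (funComp a c) (funComp b c) u

/-- `tr h`. -/
def trM (k h : Tensor2 n M) : M → ℝ :=
  glue fun c u => ((comps k c u)⁻¹ * comps h c u).trace

/-- `⟨h, ∇²a⟩`. -/
def hessInner (k h : Tensor2 n M) (a : M → ℝ) : M → ℝ :=
  glue fun c u => ((comps k c u)⁻¹ * comps h c u * (comps k c u)⁻¹ *
    hessLocal (comps k c) (funComp a c) u).trace

/-- `h(∇a, ∇b)`. -/
def gradForm (k h : Tensor2 n M) (a b : M → ℝ) : M → ℝ :=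
  glue fun c u => gr (comps k c) (funComp a c) u ⬝ᵥ
    (comps h c u).mulVec (gr (comps k c) (funComp b c) u)

/-- `Rc(∇a, ∇a)`. -/
def ricGrad (k : Tensor2 n M) (a : M → ℝ) : M → ℝ :=
  glue fun c u => gr (comps k c) (funComp a c) u ⬝ᵥ
    (ricS (comps k c) u).mulVec (gr (comps k c) (funComp a c) u)

/-- `|Rc|²`. -/
def ricSq (k : Tensor2 n M) : M → ℝ :=
  glue fun c u => ((comps k c u)⁻¹ * ricS (comps k c) u * (comps k c u)⁻¹ *
    ricS (comps k c) u).trace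

/-- `|∇²a|²`. -/
def hessSq (k : Tensor2 n M) (a : M → ℝ) : M → ℝ :=
  glue fun c u => ((comps k c u)⁻¹ * hessLocal (comps k c) (funComp a c) u * (comps k c u)⁻¹ *
    hessLocal (comps k c) (funComp a c) u).trace

lemma ricS_transpose (G : EuclideanSpace ℝ (Fin n) → Matrix (Fin n) (Fin n) ℝ)
    (u : EuclideanSpace ℝ (Fin n)) : (ricS G u).transpose = ricS G u := by
  rw [ricS, Matrix.transpose_smul, Matrix.transpose_add, Matrix.transpose_transpose, add_comm]

/-- Contraction with a symmetric matrix sees only the symmetric part. This transfers the invariance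
of `ricS` to `scal` and `ricciInner`, which are written with the unsymmetrized Ricci matrix. -/
lemma trace_mul_ricS {G : EuclideanSpace ℝ (Fin n) → Matrix (Fin n) (Fin n) ℝ}
    {u : EuclideanSpace ℝ (Fin n)} {B : Matrix (Fin n) (Fin n) ℝ} (hB : B.transpose = B) :
    (B * ricS G u).trace = (B * ricciLocal G u).trace := by
  have h1 : (B * (ricciLocal G u).transpose).trace = (B * ricciLocal G u).trace := by
    rw [← Matrix.trace_transpose, Matrix.transpose_mul, Matrix.transpose_transpose, hB,
      Matrix.trace_mul_comm]
  rw [ricS, Matrix.mul_smul, Matrix.trace_smul, mul_add, Matrix.trace_add, h1, smul_eq_mul]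
  ring

variable {k h : Tensor2 n M}

lemma IsMetric.smoothComps (hk : IsMetric k) : SmoothComps k := fun c u hu i j =>
  (hk c).smooth u hu i j

lemma IsMetric.scal_eq_glue (hk : IsMetric k) :
    scal k = glue fun c u => ((comps k c u)⁻¹ * ricciLocal (comps k c) u).trace := by
  funext p
  simp only [scal, glue, compsAt, ricci, Matrix.trace, Matrix.diag, Matrix.mul_apply]
  rw [Finset.sum_comm]
  refine Finset.sum_congr rfl fun i _ => Finset.sum_congr rfl fun j _ => ?_
  rw [(hk p).inv_comm (coord_mem_target p)]

lemma gradSq_eq_dotM (k : Tensor2 n M) (a : M → ℝ) : gradSq k a = dotM k a a := by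
  funext p
  simp only [gradSq, dotM, glue, dot, gr, dv, dotProduct, Matrix.mulVec, Finset.mul_sum, compsAt]
  refine Finset.sum_congr rfl fun i _ => Finset.sum_congr rfl fun j _ => ?_
  ring

lemma comps_transpose (hsymm : ∀ (x : M) (v w : TangentSpace (𝓡 n) x), h x v w = h x w v) (c : M)
    (u : EuclideanSpace ℝ (Fin n)) : (comps h c u).transpose = comps h c u := by
  ext i j
  exact hsymm _ _ _

lemma IsMetric.ricciInner_eq_glue (hk : IsMetric k)
    (hsymm : ∀ (x : M) (v w : TangentSpace (𝓡 n) x), h x v w = h x w v) :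
    ricciInner k h = glue fun c u => ((comps k c u)⁻¹ * comps h c u * (comps k c u)⁻¹ *
      ricciLocal (comps k c) u).trace := by
  funext p
  have hI := (hk p).inv_comm (coord_mem_target p)
  have hH : ∀ i j, comps h p (coord p) i j = comps h p (coord p) j i := fun i j => hsymm _ _ _
  simp only [ricciInner, glue, compsAt, ricci, Matrix.trace, Matrix.diag, Matrix.mul_apply,
    Finset.sum_mul]
  rw [Finset.sum_comm]
  refine Finset.sum_congr rfl fun j _ => Finset.sum_congr rfl fun i _ => ?_
  refine Finset.sum_congr rfl fun m _ => Finset.sum_congr rfl fun l _ => ?_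
  rw [hI i m, hH m l]; ring

lemma inv_mul_mul_inv_transpose (hk : IsMetric k) {c : M} {u : EuclideanSpace ℝ (Fin n)}
    (hu : u ∈ (chartAt (EuclideanSpace ℝ (Fin n)) c).target)
    {Q : Matrix (Fin n) (Fin n) ℝ} (hQ : Q.transpose = Q) :
    ((comps k c u)⁻¹ * Q * (comps k c u)⁻¹).transpose = (comps k c u)⁻¹ * Q * (comps k c u)⁻¹ := by
  rw [Matrix.transpose_mul, Matrix.transpose_mul, (hk c).inv_transpose hu, hQ, mul_assoc]

variable {a b : M → ℝ}

lemma gr_congr {G : EuclideanSpace ℝ (Fin n) → Matrix (Fin n) (Fin n) ℝ}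
    {a b : EuclideanSpace ℝ (Fin n) → ℝ} {u : EuclideanSpace ℝ (Fin n)} (h : a =ᶠ[𝓝 u] b) :
    gr G a u = gr G b u := by
  have : dv a u = dv b u := by funext i; exact pd_congr h
  rw [gr, gr, this]

lemma funComp_eventuallyEq (a : M → ℝ) {c' c : M} {v : EuclideanSpace ℝ (Fin n)}
    (hv : v ∈ (trans c' c).source) : funComp a c' =ᶠ[𝓝 v] funComp a c ∘ trans c' c := by
  filter_upwards [(trans c' c).open_source.mem_nhds hv] with w hw using funComp_trans a hw

lemma IsMetric.smooth_ricS (hk : IsMetric k) {c : M} {u : EuclideanSpace ℝ (Fin n)}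
    (hu : u ∈ (chartAt (EuclideanSpace ℝ (Fin n)) c).target)
    (i j : Fin n) : ContDiffAt ℝ ∞ (fun v => ricS (comps k c) v i j) u := by
  simp only [ricS, Matrix.smul_apply, Matrix.add_apply, Matrix.transpose_apply, smul_eq_mul]
  exact contDiffAt_const.mul (((hk c).smooth_ricci hu i j).add ((hk c).smooth_ricci hu j i))

variable [IsManifold (𝓡 n) ∞ M]

lemma IsMetric.isCoordChange (hk : IsMetric k) (c' c : M) :
    IsCoordChange (trans c' c) (comps k c') (trans c' c).source (comps k c)
      (chartAt (EuclideanSpace ℝ (Fin n)) c).target where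
  source :=
    { isOpen := (trans c' c).open_source
      smooth := fun u hu => (hk c').smooth u (mem_trans_source.1 hu).1
      symm := fun u hu => (hk c').symm u (mem_trans_source.1 hu).1
      det_pos := fun u hu => (hk c').det_pos u (mem_trans_source.1 hu).1 }
  target := hk c
  mapsTo := fun _ hv => trans_mem_target hv
  smooth := fun _ hv => contDiffAt_trans hv
  pullback := fun _ hv => comps_trans k hv

namespace IsMetric

lemma hess_trans (hk : IsMetric k) (ha : SmoothFun n a) {c' c : M} {v : EuclideanSpace ℝ (Fin n)}
    (hv : v ∈ (trans c' c).source) :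
    hessLocal (comps k c') (funComp a c') v = (jac (trans c' c) v).transpose *
      hessLocal (comps k c) (funComp a c) (trans c' c v) * jac (trans c' c) v := by
  rw [hessLocal_congr (funComp_eventuallyEq a hv), (hk.isCoordChange c' c).hess_comp hv (ha c)]

lemma jac_gr_trans (hk : IsMetric k) (ha : SmoothFun n a) {c' c : M}
    {v : EuclideanSpace ℝ (Fin n)} (hv : v ∈ (trans c' c).source) :
    (jac (trans c' c) v).mulVec (gr (comps k c') (funComp a c') v) =
      gr (comps k c) (funComp a c) (trans c' c v) := by
  rw [gr_congr (funComp_eventuallyEq a hv),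
    (hk.isCoordChange c' c).jac_gr hv (ha c _ (trans_mem_target hv))]

lemma chartInvariant_lap (hk : IsMetric k) (ha : SmoothFun n a) :
    ChartInvariant fun c u => lapLocal (comps k c) (funComp a c) u := fun c' c _ hv =>
  (hk.isCoordChange c' c).trace_inv_mul hv (hk.hess_trans ha hv)

lemma chartInvariant_dot (hk : IsMetric k) (ha : SmoothFun n a) (hb : SmoothFun n b) :
    ChartInvariant fun c u => dot (comps k c) (funComp a c) (funComp b c) u := fun c' c v hv => by
  have h1 := (hk.isCoordChange c' c).dot_comp hv (ha c _ (trans_mem_target hv))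
    (hb c _ (trans_mem_target hv))
  beta_reduce
  rw [← h1, dot, dot, gr_congr (funComp_eventuallyEq b hv)]
  congr 1
  funext i
  exact pd_congr (funComp_eventuallyEq a hv)

lemma chartInvariant_tr (hk : IsMetric k) (h : Tensor2 n M) :
    ChartInvariant fun c u => ((comps k c u)⁻¹ * comps h c u).trace := fun c' c _ hv =>
  (hk.isCoordChange c' c).trace_inv_mul hv (comps_trans h hv)

lemma chartInvariant_hessInner (hk : IsMetric k) (h : Tensor2 n M) (ha : SmoothFun n a) :
    ChartInvariant fun c u => ((comps k c u)⁻¹ * comps h c u * (comps k c u)⁻¹ *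
      hessLocal (comps k c) (funComp a c) u).trace := fun c' c _ hv =>
  (hk.isCoordChange c' c).trace_inv_mul_inv_mul hv (comps_trans h hv) (hk.hess_trans ha hv)

lemma chartInvariant_gradForm (hk : IsMetric k) (h : Tensor2 n M) (ha : SmoothFun n a)
    (hb : SmoothFun n b) :
    ChartInvariant fun c u => gr (comps k c) (funComp a c) u ⬝ᵥ
      (comps h c u).mulVec (gr (comps k c) (funComp b c) u) := fun c' c v hv => by
  beta_reduce
  rw [comps_trans h hv, ← mulVec_dotProduct_mulVec, hk.jac_gr_trans ha hv, hk.jac_gr_trans hb hv]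

lemma chartInvariant_ricSq (hk : IsMetric k) :
    ChartInvariant fun c u => ((comps k c u)⁻¹ * ricS (comps k c) u * (comps k c u)⁻¹ *
      ricS (comps k c) u).trace := fun c' c _ hv =>
  (hk.isCoordChange c' c).trace_inv_mul_inv_mul hv ((hk.isCoordChange c' c).ricS_pullback hv)
    ((hk.isCoordChange c' c).ricS_pullback hv)

lemma chartInvariant_hessSq (hk : IsMetric k) (ha : SmoothFun n a) :
    ChartInvariant fun c u => ((comps k c u)⁻¹ * hessLocal (comps k c) (funComp a c) u *
      (comps k c u)⁻¹ * hessLocal (comps k c) (funComp a c) u).trace := fun c' c _ hv =>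
  (hk.isCoordChange c' c).trace_inv_mul_inv_mul hv (hk.hess_trans ha hv) (hk.hess_trans ha hv)

lemma chartInvariant_scal (hk : IsMetric k) :
    ChartInvariant fun c u => ((comps k c u)⁻¹ * ricciLocal (comps k c) u).trace :=
  fun c' c v hv => by
    have h1 := (hk c').inv_transpose (mem_trans_source.1 hv).1
    have h2 := (hk c).inv_transpose (trans_mem_target hv)
    have := (hk.isCoordChange c' c).trace_inv_mul hv ((hk.isCoordChange c' c).ricS_pullback hv)
    rwa [trace_mul_ricS h1, trace_mul_ricS h2] at this

lemma chartInvariant_ricciInner (hk : IsMetric k)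
    (hsymm : ∀ (x : M) (v w : TangentSpace (𝓡 n) x), h x v w = h x w v) :
    ChartInvariant fun c u => ((comps k c u)⁻¹ * comps h c u * (comps k c u)⁻¹ *
      ricciLocal (comps k c) u).trace := fun c' c v hv => by
  have h1 := inv_mul_mul_inv_transpose hk (mem_trans_source.1 hv).1 (comps_transpose hsymm c' v)
  have h2 := inv_mul_mul_inv_transpose hk (trans_mem_target hv)
    (comps_transpose hsymm c (trans c' c v))
  have := (hk.isCoordChange c' c).trace_inv_mul_inv_mul hv (comps_trans h hv)
    ((hk.isCoordChange c' c).ricS_pullback hv)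
  rwa [trace_mul_ricS h1, trace_mul_ricS h2] at this

variable {c : M} {u : EuclideanSpace ℝ (Fin n)}

lemma smooth_trace_mul {X Y : EuclideanSpace ℝ (Fin n) → Matrix (Fin n) (Fin n) ℝ}
    (hX : ∀ i j, ContDiffAt ℝ ∞ (fun v => X v i j) u)
    (hY : ∀ i j, ContDiffAt ℝ ∞ (fun v => Y v i j) u) :
    ContDiffAt ℝ ∞ (fun v => (X v * Y v).trace) u := by
  simp only [Matrix.trace, Matrix.diag, Matrix.mul_apply]
  exact ContDiffAt.sum fun i _ => ContDiffAt.sum fun j _ => (hX i j).mul (hY j i)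

lemma smooth_matrix_mul {X Y : EuclideanSpace ℝ (Fin n) → Matrix (Fin n) (Fin n) ℝ}
    (hX : ∀ i j, ContDiffAt ℝ ∞ (fun v => X v i j) u)
    (hY : ∀ i j, ContDiffAt ℝ ∞ (fun v => Y v i j) u) (i j : Fin n) :
    ContDiffAt ℝ ∞ (fun v => (X v * Y v) i j) u := by
  simp only [Matrix.mul_apply]
  exact ContDiffAt.sum fun l _ => (hX i l).mul (hY l j)

lemma smooth_quadratic {X : EuclideanSpace ℝ (Fin n) → Matrix (Fin n) (Fin n) ℝ}
    {x y : EuclideanSpace ℝ (Fin n) → Fin n → ℝ}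
    (hX : ∀ i j, ContDiffAt ℝ ∞ (fun v => X v i j) u) (hx : ∀ i, ContDiffAt ℝ ∞ (fun v => x v i) u)
    (hy : ∀ i, ContDiffAt ℝ ∞ (fun v => y v i) u) :
    ContDiffAt ℝ ∞ (fun v => x v ⬝ᵥ (X v).mulVec (y v)) u := by
  simp only [dotProduct, Matrix.mulVec]
  exact ContDiffAt.sum fun i _ => (hx i).mul (ContDiffAt.sum fun j _ => (hX i j).mul (hy j))

lemma smooth_lapM (hk : IsMetric k) (ha : SmoothFun n a) : SmoothFun n (lapM k a) :=
  (hk.chartInvariant_lap ha).smoothFun fun c u hu => (hk c).smooth_lap hu (ha c u hu)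

lemma smooth_dotM (hk : IsMetric k) (ha : SmoothFun n a) (hb : SmoothFun n b) :
    SmoothFun n (dotM k a b) :=
  (hk.chartInvariant_dot ha hb).smoothFun fun c u hu =>
    (hk c).smooth_dot hu (ha c u hu) (hb c u hu)

lemma smooth_trM (hk : IsMetric k) (hh : SmoothComps h) : SmoothFun n (trM k h) :=
  (hk.chartInvariant_tr h).smoothFun fun c u hu =>
    smooth_trace_mul ((hk c).smooth_inv hu) (hh c u hu)

lemma smooth_hessInner (hk : IsMetric k) (hh : SmoothComps h) (ha : SmoothFun n a) :
    SmoothFun n (hessInner k h a) :=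
  (hk.chartInvariant_hessInner h ha).smoothFun fun c u hu =>
    smooth_trace_mul (smooth_matrix_mul (smooth_matrix_mul ((hk c).smooth_inv hu) (hh c u hu))
      ((hk c).smooth_inv hu)) ((hk c).smooth_hess hu (ha c u hu))

lemma smooth_gradForm (hk : IsMetric k) (hh : SmoothComps h) (ha : SmoothFun n a)
    (hb : SmoothFun n b) : SmoothFun n (gradForm k h a b) :=
  (hk.chartInvariant_gradForm h ha hb).smoothFun fun c u hu =>
    smooth_quadratic (hh c u hu) ((hk c).smooth_gr hu (ha c u hu)) ((hk c).smooth_gr hu (hb c u hu))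

lemma smooth_ricSq (hk : IsMetric k) : SmoothFun n (ricSq k) :=
  hk.chartInvariant_ricSq.smoothFun fun c _ hu =>
    smooth_trace_mul (smooth_matrix_mul (smooth_matrix_mul ((hk c).smooth_inv hu)
      (hk.smooth_ricS hu)) ((hk c).smooth_inv hu)) (hk.smooth_ricS hu)

lemma smooth_hessSq (hk : IsMetric k) (ha : SmoothFun n a) : SmoothFun n (hessSq k a) :=
  (hk.chartInvariant_hessSq ha).smoothFun fun c u hu =>
    smooth_trace_mul (smooth_matrix_mul (smooth_matrix_mul ((hk c).smooth_inv hu)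
      ((hk c).smooth_hess hu (ha c u hu))) ((hk c).smooth_inv hu))
      ((hk c).smooth_hess hu (ha c u hu))

lemma smooth_scal (hk : IsMetric k) : SmoothFun n (scal k) := by
  rw [hk.scal_eq_glue]
  exact hk.chartInvariant_scal.smoothFun fun c u hu =>
    smooth_trace_mul ((hk c).smooth_inv hu) ((hk c).smooth_ricci hu)

lemma smooth_ricciInner (hk : IsMetric k) (hh : SmoothComps h)
    (hsymm : ∀ (x : M) (v w : TangentSpace (𝓡 n) x), h x v w = h x w v) :
    SmoothFun n (ricciInner k h) := by
  rw [hk.ricciInner_eq_glue hsymm]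
  exact (hk.chartInvariant_ricciInner hsymm).smoothFun fun c u hu =>
    smooth_trace_mul (smooth_matrix_mul (smooth_matrix_mul ((hk c).smooth_inv hu) (hh c u hu))
      ((hk c).smooth_inv hu)) ((hk c).smooth_ricci hu)

end IsMetric

end Metrics

/-! ### Localisation of integral identities -/

section Localisation

variable {n : ℕ} {M : Type*} [TopologicalSpace M] [ChartedSpace (EuclideanSpace ℝ (Fin n)) M]

lemma funComp_eventuallyEq_zero {a : M → ℝ} {c : M} {u : EuclideanSpace ℝ (Fin n)}
    (hu : u ∈ (chartAt (EuclideanSpace ℝ (Fin n)) c).target)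
    (ha : (chartAt (EuclideanSpace ℝ (Fin n)) c).symm u ∉ tsupport a) :
    funComp a c =ᶠ[𝓝 u] fun _ => 0 :=
  ((chartAt (EuclideanSpace ℝ (Fin n)) c).continuousAt_symm hu).eventually
    (notMem_tsupport_iff_eventuallyEq.1 ha)

lemma funComp_coord_eventuallyEq_zero {a : M → ℝ} {p : M} (ha : p ∉ tsupport a) :
    funComp a p =ᶠ[𝓝 (coord p : EuclideanSpace ℝ (Fin n))] fun _ => 0 :=
  funComp_eventuallyEq_zero (coord_mem_target p) (by rwa [chart_symm_coord])

lemma dv_zero (u : EuclideanSpace ℝ (Fin n)) : dv (fun _ => 0) u = 0 := by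
  funext i; exact pd_const i 0 u

lemma gr_zero (G : EuclideanSpace ℝ (Fin n) → Matrix (Fin n) (Fin n) ℝ)
    (u : EuclideanSpace ℝ (Fin n)) : gr G (fun _ => 0) u = 0 := by
  rw [gr, dv_zero, Matrix.mulVec_zero]

lemma hessLocal_zero (G : EuclideanSpace ℝ (Fin n) → Matrix (Fin n) (Fin n) ℝ)
    (u : EuclideanSpace ℝ (Fin n)) : hessLocal G (fun _ => 0) u = 0 := by
  ext i j
  have : ∀ k, pd k (fun _ : EuclideanSpace ℝ (Fin n) => (0 : ℝ)) = fun _ => 0 := fun k => by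
    funext v; exact pd_const k 0 v
  simp [hessLocal, this, pd_const]

lemma lapM_eq_zero (k : Tensor2 n M) {a : M → ℝ} {p : M} (ha : p ∉ tsupport a) :
    lapM k a p = 0 := by
  rw [lapM, glue, lapLocal_congr (funComp_coord_eventuallyEq_zero ha), lapLocal, hessLocal_zero,
    mul_zero, Matrix.trace_zero]

lemma dotM_eq_zero (k : Tensor2 n M) {a : M → ℝ} (b : M → ℝ) {p : M} (ha : p ∉ tsupport a) :
    dotM k a b p = 0 := by
  have : dv (funComp a p) (coord p) = (0 : Fin n → ℝ) := by
    rw [← dv_zero (coord p)]; funext i; exact pd_congr (funComp_coord_eventuallyEq_zero ha)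
  rw [dotM, glue, dot, this, zero_dotProduct]

lemma hessInner_eq_zero (k h : Tensor2 n M) {a : M → ℝ} {p : M} (ha : p ∉ tsupport a) :
    hessInner k h a p = 0 := by
  rw [hessInner, glue, hessLocal_congr (funComp_coord_eventuallyEq_zero ha), hessLocal_zero,
    mul_zero, Matrix.trace_zero]

lemma SmoothFun.funComp_add (a b : M → ℝ) (c : M) :
    (funComp (fun x => a x + b x) c : EuclideanSpace ℝ (Fin n) → ℝ) =
      fun u => funComp a c u + funComp b c u := rfl

lemma dv_add {a b : EuclideanSpace ℝ (Fin n) → ℝ} {u : EuclideanSpace ℝ (Fin n)}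
    (ha : DifferentiableAt ℝ a u) (hb : DifferentiableAt ℝ b u) :
    dv (fun v => a v + b v) u = dv a u + dv b u := by
  funext i; exact pd_add ha hb

lemma hessLocal_add (G : EuclideanSpace ℝ (Fin n) → Matrix (Fin n) (Fin n) ℝ)
    {a b : EuclideanSpace ℝ (Fin n) → ℝ} {u : EuclideanSpace ℝ (Fin n)}
    (ha : ContDiffAt ℝ ∞ a u) (hb : ContDiffAt ℝ ∞ b u) :
    hessLocal G (fun v => a v + b v) u = hessLocal G a u + hessLocal G b u := by
  ext i j
  have hev : ∀ {a : EuclideanSpace ℝ (Fin n) → ℝ}, ContDiffAt ℝ ∞ a u →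
      ∀ᶠ v in 𝓝 u, DifferentiableAt ℝ a v := fun {a} ha => by
    have h1 : ContDiffAt ℝ 1 a u := ha.of_le (by simp)
    filter_upwards [h1.eventually (by simp)] with v hv using hv.differentiableAt one_ne_zero
  have h1 : pd j (fun v => a v + b v) =ᶠ[𝓝 u] fun v => pd j a v + pd j b v := by
    filter_upwards [hev ha, hev hb] with v hva hvb using pd_add hva hvb
  have h2 : ∀ k, pd k (fun v => a v + b v) u = pd k a u + pd k b u := fun k =>
    pd_add (ha.differentiableAt (by simp)) (hb.differentiableAt (by simp))
  simp only [hessLocal, Matrix.of_apply, Matrix.add_apply, pd_congr h1, h2, mul_add,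
    Finset.sum_add_distrib]
  rw [pd_add ((contDiffAt_pd j ha).differentiableAt (by simp))
    ((contDiffAt_pd j hb).differentiableAt (by simp))]
  ring

variable {a b d : M → ℝ}

lemma SmoothFun.differentiableAt (ha : SmoothFun n a) (p : M) :
    DifferentiableAt ℝ (funComp a p) (coord p : EuclideanSpace ℝ (Fin n)) :=
  (ha p _ (coord_mem_target p)).differentiableAt (by simp)

lemma dotM_add_left (k : Tensor2 n M) (ha : SmoothFun n a) (hb : SmoothFun n b) (p : M) :
    dotM k (fun x => a x + b x) d p = dotM k a d p + dotM k b d p := by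
  simp only [dotM, glue, dot, SmoothFun.funComp_add]
  rw [dv_add (ha.differentiableAt p) (hb.differentiableAt p), add_dotProduct]

lemma lapM_add (k : Tensor2 n M) (ha : SmoothFun n a) (hb : SmoothFun n b) (p : M) :
    lapM k (fun x => a x + b x) p = lapM k a p + lapM k b p := by
  simp only [lapM, glue, lapLocal, SmoothFun.funComp_add]
  rw [hessLocal_add _ (ha p _ (coord_mem_target p)) (hb p _ (coord_mem_target p)), mul_add,
    Matrix.trace_add]

lemma hessInner_add (k h : Tensor2 n M) (ha : SmoothFun n a) (hb : SmoothFun n b) (p : M) :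
    hessInner k h (fun x => a x + b x) p = hessInner k h a p + hessInner k h b p := by
  simp only [hessInner, glue, SmoothFun.funComp_add]
  rw [hessLocal_add _ (ha p _ (coord_mem_target p)) (hb p _ (coord_mem_target p)), mul_add,
    Matrix.trace_add]

variable [T2Space M] [CompactSpace M] [IsManifold (𝓡 n) ∞ M]

variable (n M) in
lemma exists_partition_charts : ∃ (t : Finset M) (ρ : M → M → ℝ), (∀ c, SmoothFun n (ρ c)) ∧
    (∀ c, tsupport (ρ c) ⊆ (chartAt (EuclideanSpace ℝ (Fin n)) c).source) ∧
    ∀ x, ∑ c ∈ t, ρ c x = 1 := by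
  obtain ⟨ρ, hρ⟩ := SmoothPartitionOfUnity.exists_isSubordinate_chartAt_source (𝓡 n) M
  have hfin : {c | (Function.support (ρ c)).Nonempty}.Finite :=
    ρ.locallyFinite.finite_nonempty_of_compact
  refine ⟨hfin.toFinset, fun c => ρ c, fun c => smoothFun_iff.2 (ρ c).contMDiff, hρ, fun x => ?_⟩
  rw [← ρ.sum_eq_one (Set.mem_univ x)]
  refine (finsum_eq_sum_of_support_subset _ fun c hc => ?_).symm
  simp only [Set.Finite.coe_toFinset, Set.mem_ofPred_eq]
  exact ⟨x, hc⟩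

/-- An additive functional that vanishes on the functions supported in a chart vanishes. -/
lemma eq_zero_of_localised {Λ : (M → ℝ) → ℝ}
    (hadd : ∀ a b, SmoothFun n a → SmoothFun n b → Λ (fun x => a x + b x) = Λ a + Λ b)
    (hloc : ∀ c a, SmoothFun n a → tsupport a ⊆ (chartAt (EuclideanSpace ℝ (Fin n)) c).source →
      Λ a = 0) (ha : SmoothFun n a) : Λ a = 0 := by
  classical
  obtain ⟨t, ρ, hρ, hs, h1⟩ := exists_partition_charts n M
  have hzero : Λ (fun _ => 0) = 0 := by
    have := hadd (fun _ => 0) (fun _ => 0) (SmoothFun.const 0) (SmoothFun.const 0)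
    simp only [add_zero] at this
    linarith
  have hsum : ∀ t : Finset M, Λ (fun x => ∑ c ∈ t, ρ c x * a x) = 0 := by
    intro t
    induction t using Finset.induction_on with
    | empty => simpa using hzero
    | insert c t hc ih =>
      simp only [Finset.sum_insert hc]
      rw [hadd _ _ ((hρ c).mul ha) (SmoothFun.sum fun c _ => (hρ c).mul ha), ih, add_zero]
      exact hloc c _ ((hρ c).mul ha) ((tsupport_mul_subset_left).trans (hs c))
  have := hsum t
  simpa only [← Finset.sum_mul, h1, one_mul] using this

omit [T2Space M] [IsManifold (𝓡 n) ∞ M] in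
lemma isCompact_chart_image {K : Set M} (hK : IsClosed K) {c : M}
    (hc : K ⊆ (chartAt (EuclideanSpace ℝ (Fin n)) c).source) :
    IsCompact (chartAt (EuclideanSpace ℝ (Fin n)) c '' K) :=
  hK.isCompact.image_of_continuousOn
    ((chartAt (EuclideanSpace ℝ (Fin n)) c).continuousOn.mono hc)

variable [MeasurableSpace M] [BorelSpace M] {k h : Tensor2 n M}

omit [T2Space M] in
lemma SmoothFun.integrable (ha : SmoothFun n a) (hk : SmoothComps k) : Integrable a (vol k) := by
  have := isFiniteMeasure_vol hk
  exact ha.continuous.integrable_of_hasCompactSupport (HasCompactSupport.of_compactSpace a)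

omit [T2Space M] in
/-- The divergence theorem for a vector field with support in a chart. -/
lemma integral_eq_zero_of_divDens (hk : IsMetric k) (c : M) {K : Set M} (hK : IsClosed K)
    (hKc : K ⊆ (chartAt (EuclideanSpace ℝ (Fin n)) c).source) {B : M → ℝ} (hB : Continuous B)
    (hBK : ∀ x, x ∉ K → B x = 0) {x : EuclideanSpace ℝ (Fin n) → Fin n → ℝ}
    (hx : ∀ u ∈ (chartAt (EuclideanSpace ℝ (Fin n)) c).target, ∀ i,
      ContDiffAt ℝ ∞ (fun v => x v i) u)
    (hx0 : ∀ u ∈ (chartAt (EuclideanSpace ℝ (Fin n)) c).target,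
      (chartAt (EuclideanSpace ℝ (Fin n)) c).symm u ∉ K → x u = 0)
    (hBx : ∀ u ∈ (chartAt (EuclideanSpace ℝ (Fin n)) c).target,
      divDens (comps k c) x u = Real.sqrt (comps k c u).det * funComp B c u) :
    ∫ x, B x ∂(vol k) = 0 := by
  have hs : Function.support B ⊆ (chartAt (EuclideanSpace ℝ (Fin n)) c).source := fun x hx =>
    hKc (by_contra fun h => hx (hBK x h))
  rw [integral_vol_of_support hk.smoothComps c hB hs]
  have h1 := (integral_divDens_eq_zero (hk c) (isCompact_chart_image hK hKc)
    (Set.image_subset_iff.2 fun y hy =>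
      (chartAt (EuclideanSpace ℝ (Fin n)) c).map_source (hKc hy)) hx
    (fun u hu hn => hx0 u hu fun h => hn
      ⟨_, h, (chartAt (EuclideanSpace ℝ (Fin n)) c).right_inv hu⟩)).2
  rw [← h1]
  exact setIntegral_congr_fun (chartAt (EuclideanSpace ℝ (Fin n)) c).open_target.measurableSet
    fun u hu => (hBx u hu).symm

/-- Green's identity. -/
lemma integral_mul_lapM_add_dotM (hk : IsMetric k) (ha : SmoothFun n a) (hb : SmoothFun n b) :
    ∫ x, (a x * lapM k b x + dotM k a b x) ∂(vol k) = 0 := by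
  refine eq_zero_of_localised (n := n)
    (Λ := fun a => ∫ x, (a x * lapM k b x + dotM k a b x) ∂(vol k)) ?_ ?_ ha
  · intro a d ha hd
    beta_reduce
    rw [← integral_add (((ha.mul (hk.smooth_lapM hb)).add (hk.smooth_dotM ha hb)).integrable
        hk.smoothComps)
      (((hd.mul (hk.smooth_lapM hb)).add (hk.smooth_dotM hd hb)).integrable hk.smoothComps)]
    refine integral_congr_ae (Eventually.of_forall fun x => ?_)
    simp only [dotM_add_left k ha hd]; ring
  · intro c a ha hc
    refine integral_eq_zero_of_divDens hk c (isClosed_tsupport a) hc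
      ((ha.mul (hk.smooth_lapM hb)).add (hk.smooth_dotM ha hb)).continuous ?_
      (x := fun u => funComp a c u • gr (comps k c) (funComp b c) u) ?_ ?_ ?_
    · intro x hx
      rw [dotM_eq_zero k b hx, image_eq_zero_of_notMem_tsupport hx]; ring
    · intro u hu i
      simp only [Pi.smul_apply, smul_eq_mul]
      exact (ha c u hu).mul ((hk c).smooth_gr hu (hb c u hu) i)
    · intro u hu hn
      rw [(funComp_eventuallyEq_zero hu hn).eq_of_nhds, zero_smul]
    · intro u hu
      rw [(hk c).divDens_smul_gr hu ((ha c u hu).differentiableAt (by simp)) (hb c u hu),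
        ← (hk.chartInvariant_lap hb).funComp_glue hu,
        ← (hk.chartInvariant_dot ha hb).funComp_glue hu]
      rfl

end Localisation

/-! ### One-parameter families of metrics -/

section DivDens

variable {n : ℕ} {G : EuclideanSpace ℝ (Fin n) → Matrix (Fin n) (Fin n) ℝ}
  {Ω : Set (EuclideanSpace ℝ (Fin n))} {u : EuclideanSpace ℝ (Fin n)}
  {x y : EuclideanSpace ℝ (Fin n) → Fin n → ℝ}

lemma IsLocalMetric.divDens_add (hG : IsLocalMetric G Ω) (hu : u ∈ Ω)
    (hx : ∀ i, DifferentiableAt ℝ (fun v => x v i) u)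
    (hy : ∀ i, DifferentiableAt ℝ (fun v => y v i) u) :
    divDens G (fun v => x v + y v) u = divDens G x u + divDens G y u := by
  have hs := (hG.smooth_sqrt_det hu).differentiableAt (by simp)
  unfold divDens
  rw [← Finset.sum_add_distrib]
  refine Finset.sum_congr rfl fun i _ => ?_
  rw [← pd_add (hs.fun_mul (hx i)) (hs.fun_mul (hy i))]
  simp only [Pi.add_apply, mul_add]

lemma IsLocalMetric.divDens_sub (hG : IsLocalMetric G Ω) (hu : u ∈ Ω)
    (hx : ∀ i, DifferentiableAt ℝ (fun v => x v i) u)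
    (hy : ∀ i, DifferentiableAt ℝ (fun v => y v i) u) :
    divDens G (fun v => x v - y v) u = divDens G x u - divDens G y u := by
  have hs := (hG.smooth_sqrt_det hu).differentiableAt (by simp)
  unfold divDens
  rw [← Finset.sum_sub_distrib]
  refine Finset.sum_congr rfl fun i _ => ?_
  rw [← pd_sub (hs.fun_mul (hx i)) (hs.fun_mul (hy i))]
  simp only [Pi.sub_apply, mul_sub]

end DivDens


section Families

variable {n : ℕ} {M : Type*} [TopologicalSpace M] [ChartedSpace (EuclideanSpace ℝ (Fin n)) M]

/-- A smooth one-parameter family of metrics. -/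
def IsMetricFam (k : ℝ → Tensor2 n M) (S : Set ℝ) : Prop :=
  ∀ c : M, IsMetricFamily (fun s => comps (k s) c) S
    (chartAt (EuclideanSpace ℝ (Fin n)) c).target

lemma IsMetricFam.mono {k : ℝ → Tensor2 n M} {S S' : Set ℝ} (hk : IsMetricFam k S) (hS' : IsOpen S')
    (h : S' ⊆ S) : IsMetricFam k S' := fun c =>
  { isOpen_param := hS'
    isOpen := (hk c).isOpen
    smooth := fun s hs => (hk c).smooth s (h hs)
    symm := fun s hs => (hk c).symm s (h hs)
    det_pos := fun s hs => (hk c).det_pos s (h hs) }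

/-- The density `dV_{k'} / dV_k`. -/
def volRatio (k k' : Tensor2 n M) : M → ℝ :=
  glue fun c u => Real.sqrt (comps k' c u).det * (Real.sqrt (comps k c u).det)⁻¹

variable {k : ℝ → Tensor2 n M} {S : Set ℝ} {s : ℝ} {F : ℝ → M → ℝ} {h : Tensor2 n M}

lemma IsMetricFam.isMetric (hk : IsMetricFam k S) (hs : s ∈ S) : IsMetric (k s) := fun c =>
  (hk c).isLocalMetric hs

lemma IsMetricFam.smoothComps_deriv (hk : IsMetricFam k S) (hs : s ∈ S)
    (hd : ∀ c : M, ∀ u ∈ (chartAt (EuclideanSpace ℝ (Fin n)) c).target,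
      dsM (fun s => comps (k s) c) s u = comps h c u) : SmoothComps h := fun c u hu i j => by
  have h1 : MSmAt (dsM fun s => comps (k s) c) s u := MSmAt.dsM ((hk c).smooth s hs u hu)
  refine (h1 i j).slice.congr_of_eventuallyEq ?_
  filter_upwards [(chartAt (EuclideanSpace ℝ (Fin n)) c).open_target.mem_nhds hu] with v hv
  rw [hd c v hv]

variable [IsManifold (𝓡 n) ∞ M]

/-- Both densities are multiplied by the same `|det J|`, so the quotient is a genuine function. With
it, integrals over the varying volume become integrals over a fixed measure. -/
lemma chartInvariant_volRatio {k k' : Tensor2 n M} (hk : IsMetric k) :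
    ChartInvariant fun c u =>
      Real.sqrt (comps k' c u).det * (Real.sqrt (comps k c u).det)⁻¹ := fun c' c v hv => by
  have hJ := (hk.isCoordChange c' c).isUnit_jac hv
  have h1 : ∀ k : Tensor2 n M, Real.sqrt (comps k c' v).det =
      |(jac (trans c' c) v).det| * Real.sqrt (comps k c (trans c' c v)).det := fun k => by
    rw [comps_trans k hv, Matrix.det_mul, Matrix.det_mul, Matrix.det_transpose,
      show (jac (trans c' c) v).det * (comps k c (trans c' c v)).det * (jac (trans c' c) v).det =
        (jac (trans c' c) v).det ^ 2 * (comps k c (trans c' c v)).det by ring,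
      Real.sqrt_mul (sq_nonneg _), Real.sqrt_sq_eq_abs]
  have h2 : |(jac (trans c' c) v).det| ≠ 0 := abs_ne_zero.2 hJ.ne_zero
  beta_reduce
  rw [h1, h1, mul_inv]
  field_simp

lemma smoothFam_volRatio (hk : IsMetricFam k S) {k₀ : Tensor2 n M} (h₀ : IsMetric k₀) (hS : IsOpen S) :
    SmoothFam n (fun s => volRatio k₀ (k s)) S :=
  smoothFam_glue hS (fun _ _ => chartInvariant_volRatio h₀) fun c s hs u hu =>
    ((SmAt.det ((hk c).smooth s hs u hu)).sqrt ((hk c).det_pos s hs u hu).ne').mul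
      (SmAt.static (((h₀ c).smooth_sqrt_det hu).inv
        (Real.sqrt_pos.2 ((h₀ c).det_pos u hu)).ne'))

omit [IsManifold (𝓡 n) ∞ M] in
lemma volRatio_self {k : Tensor2 n M} (hk : IsMetric k) (x : M) : volRatio k k x = 1 :=
  mul_inv_cancel₀ (Real.sqrt_pos.2 ((hk x).det_pos _ (coord_mem_target x))).ne'

omit [IsManifold (𝓡 n) ∞ M] in
-- Jacobi's formula gives the trace, and the square root gives the factor one half.
lemma hasDerivAt_volRatio (hk : IsMetricFam k S) (hs : s ∈ S)
    (hd : ∀ c : M, ∀ u ∈ (chartAt (EuclideanSpace ℝ (Fin n)) c).target,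
      dsM (fun s => comps (k s) c) s u = comps h c u) (x : M) :
    HasDerivAt (fun s' => volRatio (k s) (k s') x) (1 / 2 * trM (k s) h x) s := by
  have hu := coord_mem_target (n := n) x
  have hpos := (hk x).det_pos s hs _ hu
  have h1 := hasDerivAt_det (A := fun s => comps (k s) x (coord x))
    (B := dsM (fun s => comps (k s) x) s (coord x))
    (fun i j => ((hk x).smooth s hs _ hu i j).hasDerivAt) hpos.ne'
  rw [hd x _ hu] at h1
  have h2 := (h1.sqrt hpos.ne').mul_const (Real.sqrt (comps (k s) x (coord x)).det)⁻¹
  refine h2.congr_deriv ?_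
  have h3 := Real.sq_sqrt hpos.le
  have h4 := (Real.sqrt_pos.2 hpos).ne'
  simp only [trM, glue]
  field_simp
  rw [h3, mul_comm]

/-! ### Derivatives of geometric quantities in a family -/

lemma smoothFam_scal (hk : IsMetricFam k S) (hS : IsOpen S) :
    SmoothFam n (fun s => scal (k s)) S := by
  have h1 := smoothFam_glue (L := fun s c u => ((comps (k s) c u)⁻¹ *
    ricciLocal (comps (k s) c) u).trace) hS (fun s hs => (hk.isMetric hs).chartInvariant_scal)
    fun c s hs u hu => MSmAt.trace (((hk c).sm_inv hs hu).mul ((hk c).sm_ric hs hu))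
  intro c s hs u hu
  refine ContDiffAt.congr_of_eventuallyEq (h1 c s hs u hu) ?_
  have h2 : S ×ˢ Set.univ ∈ 𝓝 (s, u) := prod_mem_nhds (hS.mem_nhds hs) univ_mem
  filter_upwards [h2] with q hq
  rw [(hk.isMetric hq.1).scal_eq_glue]

lemma deriv_scal (hk : IsMetricFam k S) (hS : IsOpen S) (hs : s ∈ S) {c : M}
    {u : EuclideanSpace ℝ (Fin n)} (hu : u ∈ (chartAt (EuclideanSpace ℝ (Fin n)) c).target) :
    funComp (fun x => deriv (fun s => scal (k s) x) s) c u =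
      deriv (fun s => ((comps (k s) c u)⁻¹ * ricciLocal (comps (k s) c) u).trace) s := by
  refine Filter.EventuallyEq.deriv_eq ?_
  filter_upwards [hS.mem_nhds hs] with s' hs'
  rw [(hk.isMetric hs').scal_eq_glue]
  exact (hk.isMetric hs').chartInvariant_scal.funComp_glue hu

lemma smoothFam_dotM (hk : IsMetricFam k S) (hS : IsOpen S) {A B : ℝ → M → ℝ}
    (hA : SmoothFam n A S) (hB : SmoothFam n B S) :
    SmoothFam n (fun s => dotM (k s) (A s) (B s)) S :=
  smoothFam_glue hS (fun s hs => (hk.isMetric hs).chartInvariant_dot (hA.smoothFun hs)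
    (hB.smoothFun hs)) fun c s hs u hu => by
      unfold dot gr dv dotProduct Matrix.mulVec dotProduct
      exact SmAt.sum fun i _ => ((hA c s hs u hu).pd i).mul (SmAt.sum fun j _ =>
        ((hk c).sm_inv hs hu i j).mul ((hB c s hs u hu).pd j))

omit [IsManifold (𝓡 n) ∞ M] in
-- Varying `g⁻¹` by `-g⁻¹ h g⁻¹` yields `-h(∇F,∇F)`; varying the two differentials yields twice the
-- product with the gradient of the derivative of `F`.
lemma hasDerivAt_dotM (hk : IsMetricFam k S) (hs : s ∈ S)
    (hd : ∀ c : M, ∀ u ∈ (chartAt (EuclideanSpace ℝ (Fin n)) c).target,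
      dsM (fun s => comps (k s) c) s u = comps h c u) (hF : SmoothFam n F S) (x : M) :
    HasDerivAt (fun s => dotM (k s) (F s) (F s) x)
      (2 * dotM (k s) (F s) (fun x => deriv (fun s => F s x) s) x -
        gradForm (k s) h (F s) (F s) x) s := by
  set u : EuclideanSpace ℝ (Fin n) := coord x with hux
  have hu := coord_mem_target (n := n) x
  have hm : IsMetric (k s) := hk.isMetric hs
  set v : M → ℝ := fun x => deriv (fun s => F s x) s with hv
  have hI : ∀ i j, HasDerivAt (fun s => (comps (k s) x u)⁻¹ i j)
      (-((comps (k s) x u)⁻¹ * comps h x u * (comps (k s) x u)⁻¹) i j) s := fun i j => by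
    have := ((hk x).sm_inv hs hu i j).hasDerivAt
    rw [← hd x u hu]
    convert this using 1
    exact (congrFun (congrFun ((hk x).dsM_inv hs hu) i) j).symm
  have hp : ∀ i, HasDerivAt (fun s => dv (funComp (F s) x) u i) (dv (funComp v x) u i) s :=
    fun i => by
      have h1 := (hF x s hs u hu).pd_deriv_comm i
      have h2 := ((hF x s hs u hu).pd i).hasDerivAt
      rw [← h1] at h2
      exact h2
  have h3 := HasDerivAt.fun_sum (u := Finset.univ) fun i _ => (hp i).fun_mul
    (HasDerivAt.fun_sum (u := Finset.univ) fun j _ => (hI i j).fun_mul (hp j))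
  refine h3.congr_deriv ?_
  have e1 : ∀ p q : Fin n → ℝ, q ⬝ᵥ (comps (k s) x u)⁻¹.mulVec p =
      p ⬝ᵥ (comps (k s) x u)⁻¹.mulVec q := fun p q => by
    rw [Matrix.dotProduct_mulVec, ← Matrix.mulVec_transpose, (hm x).inv_transpose hu,
      dotProduct_comm]
  have e2 : gradForm (k s) h (F s) (F s) x = dv (funComp (F s) x) u ⬝ᵥ
      ((comps (k s) x u)⁻¹ * comps h x u * (comps (k s) x u)⁻¹).mulVec (dv (funComp (F s) x) u) := by
    simp only [gradForm, glue, gr, ← hux]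
    rw [← Matrix.mulVec_mulVec, ← Matrix.mulVec_mulVec, e1, dotProduct_comm]
  have e3 : dotM (k s) (F s) v x = dv (funComp v x) u ⬝ᵥ
      (comps (k s) x u)⁻¹.mulVec (dv (funComp (F s) x) u) := e1 _ _
  have e4 : dotM (k s) (F s) v x = dv (funComp (F s) x) u ⬝ᵥ
      (comps (k s) x u)⁻¹.mulVec (dv (funComp v x) u) := rfl
  rw [e2, two_mul]
  nth_rewrite 1 [e3]
  rw [e4]
  simp only [dotProduct, Matrix.mulVec]
  rw [← Finset.sum_add_distrib, ← Finset.sum_sub_distrib]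
  refine Finset.sum_congr rfl fun i _ => ?_
  rw [Finset.sum_add_distrib]
  simp only [neg_mul, Finset.sum_neg_distrib]
  ring

end Families

/-! ### Integral formulas for a varying metric -/

section FamilyIntegrals

variable {n : ℕ} {M : Type*} [TopologicalSpace M] [ChartedSpace (EuclideanSpace ℝ (Fin n)) M]
  [T2Space M] [CompactSpace M] [IsManifold (𝓡 n) ∞ M] [MeasurableSpace M] [BorelSpace M]
  {k : ℝ → Tensor2 n M} {S : Set ℝ} {s : ℝ} {h : Tensor2 n M}

/-- The first variation of the scalar curvature, integrated against a function. -/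
lemma integral_variation_scal (hk : IsMetricFam k S) (hS : IsOpen S) (hs : s ∈ S)
    (hd : ∀ c : M, ∀ u ∈ (chartAt (EuclideanSpace ℝ (Fin n)) c).target,
      dsM (fun s => comps (k s) c) s u = comps h c u)
    (hsymm : ∀ (x : M) (v w : TangentSpace (𝓡 n) x), h x v w = h x w v)
    {χ : M → ℝ} (hχ : SmoothFun n χ) :
    ∫ x, (χ x * deriv (fun s => scal (k s) x) s + χ x * ricciInner (k s) h x -
      hessInner (k s) h χ x + trM (k s) h x * lapM (k s) χ x) ∂(vol (k s)) = 0 := by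
  have hm : IsMetric (k s) := hk.isMetric hs
  have hh : SmoothComps h := hk.smoothComps_deriv hs hd
  have hsm : ∀ {χ : M → ℝ}, SmoothFun n χ → SmoothFun n fun x =>
      χ x * deriv (fun s => scal (k s) x) s + χ x * ricciInner (k s) h x -
      hessInner (k s) h χ x + trM (k s) h x * lapM (k s) χ x := fun {χ} hχ =>
    (((hχ.mul ((smoothFam_scal hk hS).deriv.smoothFun hs)).add
      (hχ.mul (hm.smooth_ricciInner hh hsymm))).sub (hm.smooth_hessInner hh hχ)).add
      ((hm.smooth_trM hh).mul (hm.smooth_lapM hχ))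
  refine eq_zero_of_localised (n := n) (Λ := fun χ => ∫ x, (χ x * deriv (fun s => scal (k s) x) s +
    χ x * ricciInner (k s) h x - hessInner (k s) h χ x + trM (k s) h x * lapM (k s) χ x)
      ∂(vol (k s))) ?_ ?_ hχ
  · intro a b ha hb
    beta_reduce
    rw [← integral_add ((hsm ha).integrable hm.smoothComps) ((hsm hb).integrable hm.smoothComps)]
    refine integral_congr_ae (Eventually.of_forall fun x => ?_)
    simp only [hessInner_add _ _ ha hb, lapM_add _ ha hb]; ring
  · intro c χ hχ hc
    have hIH : ∀ u ∈ (chartAt (EuclideanSpace ℝ (Fin n)) c).target,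
        MSmAt (fun s u => (comps (k s) c u)⁻¹ * dsM (fun s => comps (k s) c) s u) s u :=
      fun u hu => ((hk c).sm_inv hs hu).mul (MSmAt.dsM ((hk c).smooth s hs u hu))
    have hx₁ : ∀ u ∈ (chartAt (EuclideanSpace ℝ (Fin n)) c).target, ∀ i, ContDiffAt ℝ ∞ (fun u =>
        (funComp χ c u • IsMetricFamily.palatiniV (fun s => comps (k s) c) s u) i) u :=
      fun u hu i => (hχ c u hu).mul ((hk c).smooth_palatiniV hs hu i)
    have hx₂ : ∀ u ∈ (chartAt (EuclideanSpace ℝ (Fin n)) c).target, ∀ i, ContDiffAt ℝ ∞ (fun u =>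
        (((comps (k s) c u)⁻¹ * dsM (fun s => comps (k s) c) s u).mulVec
          (gr (comps (k s) c) (funComp χ c) u)) i) u := fun u hu i => by
      simp only [Matrix.mulVec, dotProduct]
      exact ContDiffAt.sum fun j _ =>
        ((hIH u hu) i j).slice.mul ((hm c).smooth_gr hu (hχ c u hu) j)
    have hx₃ : ∀ u ∈ (chartAt (EuclideanSpace ℝ (Fin n)) c).target, ∀ i, ContDiffAt ℝ ∞ (fun u =>
        (((comps (k s) c u)⁻¹ * dsM (fun s => comps (k s) c) s u).trace •
          gr (comps (k s) c) (funComp χ c) u) i) u := fun u hu i =>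
      (hIH u hu).trace.slice.mul ((hm c).smooth_gr hu (hχ c u hu) i)
    -- The vector field is the combination whose divergence is computed in `divDens_variation`. Each
    -- summand contains `χ` or `∇χ`, so it vanishes off the support of `χ`.
    refine integral_eq_zero_of_divDens hm c (isClosed_tsupport χ) hc (hsm hχ).continuous ?_
      (x := fun u => funComp χ c u • IsMetricFamily.palatiniV (fun s => comps (k s) c) s u -
        ((comps (k s) c u)⁻¹ * dsM (fun s => comps (k s) c) s u).mulVec
          (gr (comps (k s) c) (funComp χ c) u) +
        ((comps (k s) c u)⁻¹ * dsM (fun s => comps (k s) c) s u).trace •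
          gr (comps (k s) c) (funComp χ c) u) ?_ ?_ ?_
    · intro x hx
      rw [hessInner_eq_zero _ _ hx, lapM_eq_zero _ hx, image_eq_zero_of_notMem_tsupport hx]; ring
    · intro u hu i
      exact ((hx₁ u hu i).sub (hx₂ u hu i)).add (hx₃ u hu i)
    · intro u hu hn
      have h0 := funComp_eventuallyEq_zero hu hn
      rw [h0.eq_of_nhds, gr_congr h0, gr_zero, Matrix.mulVec_zero, smul_zero, zero_smul]
      simp
    · intro u hu
      have hd₁ := fun i => (hx₁ u hu i).differentiableAt (by simp)
      have hd₂ := fun i => (hx₂ u hu i).differentiableAt (by simp)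
      have hd₃ := fun i => (hx₃ u hu i).differentiableAt (by simp)
      rw [(hm c).divDens_add hu ?diff hd₃,
        (hm c).divDens_sub hu hd₁ hd₂, (hk c).divDens_variation hs hu (hχ c u hu), hd c u hu,
        ← deriv_scal hk hS hs hu,
        ← (hm.chartInvariant_hessInner h hχ).funComp_glue hu,
        ← (hm.chartInvariant_tr h).funComp_glue hu, ← (hm.chartInvariant_lap hχ).funComp_glue hu,
        ← (hm.chartInvariant_ricciInner hsymm).funComp_glue hu, ← hm.ricciInner_eq_glue hsymm]
      · rfl
      · exact fun i => (hd₁ i).fun_sub (hd₂ i)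

/-- The change of the volume measure. -/
lemma integral_vol_eq {k k' : Tensor2 n M} (hk : IsMetric k) (hk' : IsMetric k') {a : M → ℝ}
    (ha : SmoothFun n a) :
    ∫ x, a x ∂(vol k') = ∫ x, a x * volRatio k k' x ∂(vol k) := by
  have hr : SmoothFun n (volRatio k k') := (chartInvariant_volRatio hk).smoothFun fun c u hu =>
    ((hk' c).smooth_sqrt_det hu).mul (((hk c).smooth_sqrt_det hu).inv
      (Real.sqrt_pos.2 ((hk c).det_pos u hu)).ne')
  rw [← sub_eq_zero]
  refine eq_zero_of_localised (n := n)
    (Λ := fun a => ∫ x, a x ∂(vol k') - ∫ x, a x * volRatio k k' x ∂(vol k)) ?_ ?_ ha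
  · intro a b ha hb
    rw [integral_add (ha.integrable hk'.smoothComps) (hb.integrable hk'.smoothComps)]
    simp only [add_mul]
    rw [integral_add ((ha.mul hr).integrable hk.smoothComps)
      ((hb.mul hr).integrable hk.smoothComps)]
    ring
  · intro c a ha hc
    rw [sub_eq_zero, integral_vol_of_support hk'.smoothComps c ha.continuous
      ((subset_tsupport a).trans hc), integral_vol_of_support hk.smoothComps c
      (ha.mul hr).continuous ((Function.support_mul_subset_left _ _).trans
        ((subset_tsupport a).trans hc))]
    refine setIntegral_congr_fun (chartAt (EuclideanSpace ℝ (Fin n)) c).open_target.measurableSet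
      fun u hu => ?_
    have h1 : funComp (fun x => a x * volRatio k k' x) c u =
        funComp a c u * funComp (volRatio k k') c u := rfl
    have h2 := (Real.sqrt_pos.2 ((hk c).det_pos u hu)).ne'
    rw [h1, volRatio, (chartInvariant_volRatio hk).funComp_glue hu]
    field_simp

omit [T2Space M] [IsManifold (𝓡 n) ∞ M] in
/-- Differentiation under the integral sign. -/
lemma hasDerivAt_integral_smoothFam {μ : Measure M} [IsFiniteMeasure μ] {A : ℝ → M → ℝ}
    (hS : IsOpen S) (hs : s ∈ S) (hA : SmoothFam n A S) :
    HasDerivAt (fun s => ∫ x, A s x ∂μ) (∫ x, deriv (fun s => A s x) s ∂μ) s := by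
  obtain ⟨r, hr, hrS⟩ := Metric.isOpen_iff.1 hS s hs
  set K := Metric.closedBall s (r / 2) with hK
  have hKS : K ⊆ S := (Metric.closedBall_subset_ball (by linarith)).trans hrS
  -- Joint continuity of the parameter derivative on (closed ball) × `M`, which is compact, provides
  -- a constant dominating function.
  have hcont : ContinuousOn (fun q : ℝ × M => deriv (fun s => A s q.2) q.1) (K ×ˢ Set.univ) :=
    fun q hq => (hA.deriv.continuousAt (hKS hq.1) q.2).continuousWithinAt
  obtain ⟨C, hC⟩ := ((isCompact_closedBall s (r / 2)).prod isCompact_univ).exists_bound_of_continuousOn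
    hcont
  have hint : ∀ {a : M → ℝ}, SmoothFun n a → Integrable a μ := fun ha =>
    ha.continuous.integrable_of_hasCompactSupport (HasCompactSupport.of_compactSpace _)
  refine (hasDerivAt_integral_of_dominated_loc_of_deriv_le (bound := fun _ => C)
    (Metric.closedBall_mem_nhds s (half_pos hr)) ?_ (hint (hA.smoothFun hs))
    (F' := fun s x => deriv (fun s => A s x) s) (hint (hA.deriv.smoothFun hs)).aestronglyMeasurable
    (Eventually.of_forall fun x t ht => hC (t, x) ⟨ht, Set.mem_univ _⟩) (integrable_const C)
    (Eventually.of_forall fun x t ht => hA.hasDerivAt (hKS ht) x)).2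
  filter_upwards [hS.mem_nhds hs] with t ht using (hint (hA.smoothFun ht)).aestronglyMeasurable

/-- The derivative of an integral with respect to a varying metric. -/
lemma hasDerivAt_integral_vol (hk : IsMetricFam k S) (hS : IsOpen S) (hs : s ∈ S)
    (hd : ∀ c : M, ∀ u ∈ (chartAt (EuclideanSpace ℝ (Fin n)) c).target,
      dsM (fun s => comps (k s) c) s u = comps h c u) {A : ℝ → M → ℝ} (hA : SmoothFam n A S) :
    HasDerivAt (fun s => ∫ x, A s x ∂(vol (k s)))
      (∫ x, (deriv (fun s => A s x) s + 1 / 2 * trM (k s) h x * A s x) ∂(vol (k s))) s := by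
  have hm := hk.isMetric hs
  have := isFiniteMeasure_vol hm.smoothComps
  have h1 := hasDerivAt_integral_smoothFam (μ := vol (k s)) hS hs
    (hA.mul (smoothFam_volRatio hk hm hS))
  have h2 : ∀ x, deriv (fun s' => A s' x * volRatio (k s) (k s') x) s =
      deriv (fun s => A s x) s + 1 / 2 * trM (k s) h x * A s x := fun x => by
    rw [((hA.hasDerivAt hs x).fun_mul (hasDerivAt_volRatio hk hs hd x)).deriv, volRatio_self hm]
    ring
  simp only [h2] at h1
  refine h1.congr_of_eventuallyEq ?_
  filter_upwards [hS.mem_nhds hs] with t ht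
  exact integral_vol_eq hm (hk.isMetric ht) (hA.smoothFun ht)

end FamilyIntegrals

/-! ### Calculus with the gradient, the Laplacian and the Hessian -/

section Local

variable {n : ℕ} {u : EuclideanSpace ℝ (Fin n)} {a : EuclideanSpace ℝ (Fin n) → ℝ} {η η₁ η₂ : ℝ → ℝ}

lemma dv_comp_real (hη : ∀ t, HasDerivAt η (η₁ t) t) (ha : DifferentiableAt ℝ a u) :
    dv (fun v => η (a v)) u = η₁ (a u) • dv a u := by
  funext i; exact pd_comp (hη _) ha

lemma hessLocal_comp_real (G : EuclideanSpace ℝ (Fin n) → Matrix (Fin n) (Fin n) ℝ)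
    (hη : ∀ t, HasDerivAt η (η₁ t) t) (hη₁ : ∀ t, HasDerivAt η₁ (η₂ t) t)
    (ha : ContDiffAt ℝ ∞ a u) : hessLocal G (fun v => η (a v)) u =
      η₁ (a u) • hessLocal G a u + η₂ (a u) • Matrix.vecMulVec (dv a u) (dv a u) := by
  ext i j
  have hd : DifferentiableAt ℝ a u := ha.differentiableAt (by simp)
  have h1 : pd j (fun v => η (a v)) =ᶠ[𝓝 u] fun v => η₁ (a v) * pd j a v := by
    have h2 : ContDiffAt ℝ 1 a u := ha.of_le (by simp)
    filter_upwards [h2.eventually (by simp)] with v hv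
      using pd_comp (hη _) (hv.differentiableAt one_ne_zero)
  have h3 : DifferentiableAt ℝ (fun v => η₁ (a v)) u :=
    (hη₁ (a u)).differentiableAt.comp u hd
  simp only [hessLocal, Matrix.of_apply, Matrix.add_apply, Matrix.smul_apply, smul_eq_mul,
    Matrix.vecMulVec_apply, dv]
  rw [pd_congr h1, pd_mul h3 ((contDiffAt_pd j ha).differentiableAt (by simp)),
    pd_comp (hη₁ _) hd, Finset.sum_congr rfl fun k _ => by rw [pd_comp (hη _) hd], mul_sub,
    Finset.mul_sum, Finset.sum_congr rfl fun k _ => mul_left_comm _ _ _]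
  ring

lemma trace_mul_vecMulVec' (X : Matrix (Fin n) (Fin n) ℝ) (d : Fin n → ℝ) :
    (X * Matrix.vecMulVec d d).trace = d ⬝ᵥ X.mulVec d := by
  simp only [Matrix.trace, Matrix.diag, Matrix.mul_apply, Matrix.vecMulVec_apply, dotProduct,
    Matrix.mulVec, Finset.mul_sum]
  exact Finset.sum_congr rfl fun i _ => Finset.sum_congr rfl fun j _ => by ring

end Local

/-! ### Product and chain rules on the manifold -/

section Calculus

variable {n : ℕ} {M : Type*} [TopologicalSpace M] [ChartedSpace (EuclideanSpace ℝ (Fin n)) M]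
  {k h : Tensor2 n M} {a b d : M → ℝ} {η η₁ η₂ : ℝ → ℝ}

lemma IsMetric.dotM_comm (hk : IsMetric k) (a b : M → ℝ) (x : M) : dotM k a b x = dotM k b a x :=
  (hk x).dot_comm (coord_mem_target x) _ _

lemma dotM_mul_left (k : Tensor2 n M) (ha : SmoothFun n a) (hb : SmoothFun n b) (d : M → ℝ)
    (x : M) : dotM k (fun x => a x * b x) d x = a x * dotM k b d x + b x * dotM k a d x := by
  have h1 : dv (funComp (fun x => a x * b x) x) (coord x : EuclideanSpace ℝ (Fin n)) =
      a x • dv (funComp b x) (coord x) + b x • dv (funComp a x) (coord x) := by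
    funext i
    have h2 : ∀ a : M → ℝ, funComp a x (coord x : EuclideanSpace ℝ (Fin n)) = a x := fun a =>
      congrArg a (chart_symm_coord x)
    have h3 := pd_mul (i := i) (ha.differentiableAt x) (hb.differentiableAt x)
    rw [h2, h2] at h3
    refine h3.trans ?_
    simp only [Pi.add_apply, Pi.smul_apply, smul_eq_mul, dv]
    ring
  simp only [dotM, glue, dot]
  rw [h1, add_dotProduct, smul_dotProduct, smul_dotProduct, smul_eq_mul, smul_eq_mul]

lemma dotM_const_left (k : Tensor2 n M) (r : ℝ) (d : M → ℝ) (x : M) :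
    dotM k (fun _ => r) d x = 0 := by
  have : dv (funComp (fun _ => r) x) (coord x) = (0 : Fin n → ℝ) := by
    funext i; exact pd_const i r _
  rw [dotM, glue, dot, this, zero_dotProduct]

lemma dotM_comp_left (k : Tensor2 n M) (hη : ∀ t, HasDerivAt η (η₁ t) t) (ha : SmoothFun n a)
    (d : M → ℝ) (x : M) : dotM k (fun x => η (a x)) d x = η₁ (a x) * dotM k a d x := by
  have h1 : dv (funComp (fun x => η (a x)) x) (coord x) =
      η₁ (a x) • dv (funComp a x) (coord x : EuclideanSpace ℝ (Fin n)) := by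
    have := dv_comp_real hη (ha.differentiableAt x)
    rwa [funComp, chart_symm_coord] at this
  rw [dotM, glue, dot, h1, smul_dotProduct]
  rfl

lemma hessLocal_funComp_comp (hη : ∀ t, HasDerivAt η (η₁ t) t)
    (hη₁ : ∀ t, HasDerivAt η₁ (η₂ t) t) (ha : SmoothFun n a) (x : M) :
    hessLocal (comps k x) (funComp (fun x => η (a x)) x) (coord x) =
      η₁ (a x) • hessLocal (comps k x) (funComp a x) (coord x) +
      η₂ (a x) • Matrix.vecMulVec (dv (funComp a x) (coord x)) (dv (funComp a x) (coord x)) := by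
  have := hessLocal_comp_real (comps k x) hη hη₁ (ha x _ (coord_mem_target x))
  have h2 : funComp a x (coord x : EuclideanSpace ℝ (Fin n)) = a x := by
    rw [funComp, chart_symm_coord]
  rwa [h2] at this

lemma lapM_comp (k : Tensor2 n M) (hη : ∀ t, HasDerivAt η (η₁ t) t)
    (hη₁ : ∀ t, HasDerivAt η₁ (η₂ t) t) (ha : SmoothFun n a) (x : M) :
    lapM k (fun x => η (a x)) x = η₁ (a x) * lapM k a x + η₂ (a x) * dotM k a a x := by
  rw [lapM, glue, lapLocal, hessLocal_funComp_comp hη hη₁ ha x, mul_add, Matrix.trace_add,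
    Matrix.mul_smul, Matrix.mul_smul, Matrix.trace_smul, Matrix.trace_smul, trace_mul_vecMulVec']
  rfl

lemma IsMetric.hessInner_comp (hk : IsMetric k) (h : Tensor2 n M)
    (hη : ∀ t, HasDerivAt η (η₁ t) t)
    (hη₁ : ∀ t, HasDerivAt η₁ (η₂ t) t) (ha : SmoothFun n a) (x : M) :
    hessInner k h (fun x => η (a x)) x =
      η₁ (a x) * hessInner k h a x + η₂ (a x) * gradForm k h a a x := by
  rw [hessInner, glue, hessLocal_funComp_comp hη hη₁ ha x, mul_add, Matrix.trace_add,
    Matrix.mul_smul, Matrix.mul_smul, Matrix.trace_smul, Matrix.trace_smul, trace_mul_vecMulVec']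
  have e1 : gradForm k h a a x = dv (funComp a x) (coord x) ⬝ᵥ
      ((comps k x (coord x))⁻¹ * comps h x (coord x) * (comps k x (coord x))⁻¹).mulVec
        (dv (funComp a x) (coord x)) := by
    simp only [gradForm, glue, gr]
    rw [← Matrix.mulVec_mulVec, ← Matrix.mulVec_mulVec, Matrix.dotProduct_mulVec (dv _ _),
      ← Matrix.mulVec_transpose, (hk x).inv_transpose (coord_mem_target x)]
  rw [e1]
  rfl

end Calculus

/-! ### Integration by parts against `e^{-f} dV` -/

section Weighted

variable {n : ℕ} {M : Type*} [TopologicalSpace M] [ChartedSpace (EuclideanSpace ℝ (Fin n)) M]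
  [T2Space M] [CompactSpace M] [IsManifold (𝓡 n) ∞ M] [MeasurableSpace M] [BorelSpace M]
  {k h : Tensor2 n M} {a b f : M → ℝ}

lemma hasDerivAt_exp_neg (t : ℝ) : HasDerivAt (fun t => Real.exp (-t)) (-Real.exp (-t)) t := by
  simpa using (hasDerivAt_neg t).exp

lemma hasDerivAt_neg_exp_neg (t : ℝ) : HasDerivAt (fun t => -Real.exp (-t)) (Real.exp (-t)) t := by
  simpa using (hasDerivAt_exp_neg t).fun_neg

/-- Green's identity for the measure `e^{-f} dV`. -/
lemma integral_weighted_green (hk : IsMetric k) (hf : SmoothFun n f) (ha : SmoothFun n a)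
    (hb : SmoothFun n b) :
    ∫ x, (a x * (lapM k b x - dotM k f b x) + dotM k a b x) * Real.exp (-f x) ∂(vol k) = 0 := by
  rw [← integral_mul_lapM_add_dotM hk (ha.mul hf.exp_neg) hb]
  refine integral_congr_ae (Eventually.of_forall fun x => ?_)
  simp only [dotM_mul_left k ha hf.exp_neg, dotM_comp_left k hasDerivAt_exp_neg hf]
  ring

end Weighted

/-! ### Gradient shrinkers -/

section Soliton

variable {n : ℕ} {M : Type*} [TopologicalSpace M] [ChartedSpace (EuclideanSpace ℝ (Fin n)) M]
  {k h : Tensor2 n M} {f : M → ℝ} {τ : ℝ}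

lemma IsMetric.soliton_scal (hk : IsMetric k) (hs : IsGradientShrinker k f τ) (x : M) :
    scal k x + lapM k f x = n / (2 * τ) := by
  have hu := coord_mem_target (n := n) x
  have h1 := hs.2.2 x
  simp only [ricci, hess, compsAt] at h1
  rw [hk.scal_eq_glue, lapM, glue, glue, lapLocal, ← Matrix.trace_add, ← mul_add, h1,
    Matrix.mul_smul, Matrix.nonsing_inv_mul _ ((hk x).isUnit_det hu), Matrix.trace_smul,
    Matrix.trace_one, Fintype.card_fin, smul_eq_mul]
  ring

lemma IsMetric.soliton_ricciInner (hk : IsMetric k) (hs : IsGradientShrinker k f τ)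
    (hsymm : ∀ (x : M) (v w : TangentSpace (𝓡 n) x), h x v w = h x w v) (x : M) :
    ricciInner k h x + hessInner k h f x = 1 / (2 * τ) * trM k h x := by
  have hu := coord_mem_target (n := n) x
  have h1 := hs.2.2 x
  simp only [ricci, hess, compsAt] at h1
  rw [hk.ricciInner_eq_glue hsymm, hessInner, glue, glue, ← Matrix.trace_add, ← mul_add, h1,
    Matrix.mul_smul, Matrix.trace_smul, mul_assoc,
    Matrix.nonsing_inv_mul _ ((hk x).isUnit_det hu), mul_one]
  rfl

variable [IsManifold (𝓡 n) ∞ M]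

/-- On a shrinker the Ricci matrix is symmetric, since the Hessian and the metric are; the symmetric
part can therefore stand for it. -/
lemma IsMetric.soliton_hess (hk : IsMetric k) (hs : IsGradientShrinker k f τ) (x : M) :
    hessLocal (comps k x) (funComp f x) (coord x) =
      (1 / (2 * τ)) • comps k x (coord x) - ricS (comps k x) (coord x) := by
  have hu := coord_mem_target (n := n) x
  have hf := smoothFun_iff.2 hs.1
  have h1 := hs.2.2 x
  simp only [ricci, hess, compsAt] at h1
  have h2 : (hessLocal (comps k x) (funComp f x) (coord x)).transpose =
      hessLocal (comps k x) (funComp f x) (coord x) := by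
    ext i j; exact (hk x).hess_comm hu (hf x _ hu) j i
  have h3 := congrArg Matrix.transpose h1
  rw [Matrix.transpose_add, Matrix.transpose_smul, (hk x).symm _ hu, h2] at h3
  have h4 : (ricciLocal (comps k x) (coord x)).transpose = ricciLocal (comps k x) (coord x) :=
    add_right_cancel (h3.trans h1.symm)
  have h5 : ricS (comps k x) (coord x) = ricciLocal (comps k x) (coord x) := by
    rw [ricS, h4, ← two_smul ℝ, smul_smul]; norm_num
  rw [h5, ← h1]; abel

/-- Expand the norm of `∇²f = g/(2τ) - Rc`; the cross term is a multiple of `R`, and `|g|² = n`. -/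
lemma IsMetric.soliton_hessSq (hk : IsMetric k) (hs : IsGradientShrinker k f τ) (x : M) :
    hessSq k f x = n / (4 * τ ^ 2) - 1 / τ * scal k x + ricSq k x := by
  have hu := coord_mem_target (n := n) x
  have hI := Matrix.nonsing_inv_mul _ ((hk x).isUnit_det hu)
  have hR := trace_mul_ricS (G := comps k x) (u := coord x) ((hk x).inv_transpose hu)
  rw [hk.scal_eq_glue, hessSq, ricSq, glue, glue, glue, hk.soliton_hess hs x, ← hR]
  simp only [mul_sub, sub_mul, Matrix.mul_smul, Matrix.smul_mul, hI, one_mul, Matrix.trace_sub,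
    Matrix.trace_smul, smul_eq_mul, Matrix.trace_one, Fintype.card_fin]
  rw [mul_assoc ((comps k x (coord x))⁻¹ * ricS (comps k x) (coord x)), hI, mul_one]
  have := hs.2.1.ne'
  field_simp
  ring

/-- Evaluate the soliton equation on `(∇f,∇f)` and use `∇²f(∇f,∇f) = ½⟨∇f,∇|∇f|²⟩`. -/
lemma IsMetric.soliton_ricGrad (hk : IsMetric k) (hs : IsGradientShrinker k f τ) (x : M) :
    ricGrad k f x = 1 / (2 * τ) * dotM k f f x - 1 / 2 * dotM k f (dotM k f f) x := by
  have hu := coord_mem_target (n := n) x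
  have hf := smoothFun_iff.2 hs.1
  have hc := hf x _ hu
  have h1 := (hk x).hess_gr_gr hu hc hc hc
  have h2 : dotM k f (dotM k f f) x =
      dot (comps k x) (funComp f x) (dot (comps k x) (funComp f x) (funComp f x)) (coord x) := by
    refine dot_congr_right ?_
    filter_upwards [(hk x).mem_nhds hu] with v hv
      using (hk.chartInvariant_dot hf hf).funComp_glue hv
  have h3 : dotM k f f x = gr (comps k x) (funComp f x) (coord x) ⬝ᵥ
      (comps k x (coord x)).mulVec (gr (comps k x) (funComp f x) (coord x)) := by
    rw [gr, Matrix.mulVec_mulVec, Matrix.mul_nonsing_inv _ ((hk x).isUnit_det hu),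
      Matrix.one_mulVec, dotProduct_comm]
    rfl
  rw [hk.soliton_hess hs x, Matrix.sub_mulVec, dotProduct_sub, Matrix.smul_mulVec,
    dotProduct_smul, ← h3, smul_eq_mul] at h1
  rw [h2, ricGrad, glue]
  linarith

lemma IsMetric.bochner (hk : IsMetric k) (hf : SmoothFun n f) (x : M) :
    1 / 2 * lapM k (dotM k f f) x - hessSq k f x - dotM k f (lapM k f) x = ricGrad k f x := by
  have hu := coord_mem_target (n := n) x
  have h1 := (hk x).bochner hu (hf x)
  have h2 : dotM k f (lapM k f) x =
      dot (comps k x) (funComp f x) (lapLocal (comps k x) (funComp f x)) (coord x) := by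
    refine dot_congr_right ?_
    filter_upwards [(hk x).mem_nhds hu] with v hv using (hk.chartInvariant_lap hf).funComp_glue hv
  have h3 : lapM k (dotM k f f) x =
      lapLocal (comps k x) (dot (comps k x) (funComp f x) (funComp f x)) (coord x) := by
    refine lapLocal_congr ?_
    filter_upwards [(hk x).mem_nhds hu] with v hv
      using (hk.chartInvariant_dot hf hf).funComp_glue hv
  have h4 : ∀ (B : Matrix (Fin n) (Fin n) ℝ) (y : Fin n → ℝ),
      y ⬝ᵥ ((1 / 2 : ℝ) • (B + B.transpose)).mulVec y = y ⬝ᵥ B.mulVec y := fun B y => by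
    have : y ⬝ᵥ B.transpose.mulVec y = y ⬝ᵥ B.mulVec y := by
      rw [Matrix.mulVec_transpose, dotProduct_comm, ← Matrix.dotProduct_mulVec]
    rw [Matrix.smul_mulVec, Matrix.add_mulVec, dotProduct_smul, dotProduct_add, this, smul_eq_mul]
    ring
  rw [h2, h3, ricGrad, glue, ricS, h4, ← h1]
  rfl

end Soliton

/-! ### Positivity of the norm and the bound `R² ≤ n|Rc|²` -/

section PosDef

variable {n : ℕ}

open scoped MatrixOrder in
-- With `I = Lᵀ L`, cyclicity turns the trace into the squared Frobenius norm of `L B Lᵀ`.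
lemma trace_mul_mul_mul_nonneg {I B : Matrix (Fin n) (Fin n) ℝ} (hI : I.PosSemidef)
    (hB : B.transpose = B) : 0 ≤ (I * B * I * B).trace := by
  obtain ⟨L, rfl⟩ := CStarAlgebra.nonneg_iff_eq_star_mul_self.mp hI.nonneg
  rw [Matrix.star_eq_conjTranspose]
  set X := L * B * L.transpose with hX
  have hXt : X.transpose = X := by
    rw [hX, Matrix.transpose_mul, Matrix.transpose_mul, Matrix.transpose_transpose, hB, mul_assoc]
  have h1 : (L.conjTranspose * L * B * (L.conjTranspose * L) * B).trace = (X * X.transpose).trace := by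
    rw [hXt, hX, Matrix.conjTranspose_eq_transpose_of_trivial]
    simp only [mul_assoc]
    rw [Matrix.trace_mul_comm]
    simp only [mul_assoc]
  rw [h1]
  simp only [Matrix.trace, Matrix.diag, Matrix.mul_apply, Matrix.transpose_apply]
  exact Finset.sum_nonneg fun i _ => Finset.sum_nonneg fun j _ => mul_self_nonneg _

variable {M : Type*} [TopologicalSpace M] [ChartedSpace (EuclideanSpace ℝ (Fin n)) M]
  {k : Tensor2 n M}

/-- This is the nonnegativity of `|Rc - (R/n)g|²`, expanded. -/
lemma IsMetric.sq_scal_le (hn : 0 < n) (hk : IsMetric k) {x : M}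
    (hpos : (comps k x (coord x)).PosDef) : scal k x ^ 2 ≤ n * ricSq k x := by
  have hu := coord_mem_target (n := n) x
  have hI := Matrix.nonsing_inv_mul _ ((hk x).isUnit_det hu)
  have hn' : (0 : ℝ) < n := Nat.cast_pos.2 hn
  have hR := trace_mul_ricS (G := comps k x) (u := coord x) ((hk x).inv_transpose hu)
  have h1 := trace_mul_mul_mul_nonneg hpos.inv.posSemidef
    (B := ricS (comps k x) (coord x) - (scal k x / n) • comps k x (coord x)) (by
      rw [Matrix.transpose_sub, Matrix.transpose_smul, ricS_transpose, (hk x).symm _ hu])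
  have h2 : scal k x = ((comps k x (coord x))⁻¹ * ricS (comps k x) (coord x)).trace := by
    rw [hR, hk.scal_eq_glue]; rfl
  have h3 : ricSq k x = ((comps k x (coord x))⁻¹ * ricS (comps k x) (coord x) *
    (comps k x (coord x))⁻¹ * ricS (comps k x) (coord x)).trace := rfl
  simp only [mul_sub, sub_mul, Matrix.mul_smul, Matrix.smul_mul, hI, one_mul, Matrix.trace_sub,
    Matrix.trace_smul, smul_eq_mul, Matrix.trace_one, Fintype.card_fin] at h1
  rw [mul_assoc _ _ (comps k x (coord x)), hI, mul_one, ← h2, ← mul_assoc, ← h3] at h1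
  field_simp at h1
  nlinarith

end PosDef

/-! ### Linear variations of a Riemannian metric -/

section LinearFamily

variable {n : ℕ} {M : Type*} [TopologicalSpace M] [ChartedSpace (EuclideanSpace ℝ (Fin n)) M]
  [IsManifold (𝓡 n) ∞ M]
  (g : Bundle.ContMDiffRiemannianMetric (𝓡 n) ∞ (EuclideanSpace ℝ (Fin n))
      (fun x : M => TangentSpace (𝓡 n) x)) {h : Tensor2 n M}

/-- The differential of an inverse chart is injective, so positivity of the form on the tangent
space passes to its matrix of components. -/
lemma comps_posDef {c : M} {u : EuclideanSpace ℝ (Fin n)}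
    (hu : u ∈ (chartAt (EuclideanSpace ℝ (Fin n)) c).target) : (comps g.inner c u).PosDef := by
  let p : M := (chartAt (EuclideanSpace ℝ (Fin n)) c).symm u
  let B : EuclideanSpace ℝ (Fin n) →L[ℝ] EuclideanSpace ℝ (Fin n) →L[ℝ] ℝ := g.inner p
  let D : EuclideanSpace ℝ (Fin n) →L[ℝ] EuclideanSpace ℝ (Fin n) :=
    mfderiv (𝓡 n) (𝓡 n) (chartAt (EuclideanSpace ℝ (Fin n)) c).symm u
  have hD : Function.Injective D :=
    (mdifferentiable_chart (I := 𝓡 n) c).symm.mfderiv_injective hu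
  refine Matrix.PosDef.of_dotProduct_mulVec_pos ?_ fun x hx => ?_
  · rw [Matrix.IsHermitian, Matrix.conjTranspose_eq_transpose_of_trivial]
    exact comps_transpose (fun x v w => g.symm x v w) c u
  · set X : EuclideanSpace ℝ (Fin n) := ∑ i, x i • EuclideanSpace.single i (1 : ℝ) with hX
    have hXx : ∀ i, X i = x i := fun i => by
      simp [hX, Pi.single_apply]
    have hX0 : X ≠ 0 := fun h0 => hx (by
      funext i; rw [← hXx, h0]; rfl)
    have hDX : D X ≠ 0 := fun h0 => hX0 (hD (h0.trans (map_zero D).symm))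
    have h1 : 0 < B (D X) (D X) := g.pos p (D X) hDX
    have h2 : star x ⬝ᵥ (comps g.inner c u).mulVec x = B (D X) (D X) := by
      have h3 : ∀ i j, comps g.inner c u i j =
          B (D (EuclideanSpace.single i 1)) (D (EuclideanSpace.single j 1)) := fun i j => rfl
      rw [hX]
      simp only [star_trivial, dotProduct, Matrix.mulVec, h3, map_sum, map_smul, sum_apply,
        smul_apply, smul_eq_mul, Finset.mul_sum]
      rw [Finset.sum_comm]
      refine Finset.sum_congr rfl fun i _ => Finset.sum_congr rfl fun j _ => ?_
      ring
    rwa [h2]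

lemma isMetric_inner : IsMetric g.inner := fun c =>
  { isOpen := (chartAt (EuclideanSpace ℝ (Fin n)) c).open_target
    smooth := fun _ hu => comps_smooth (h := g.inner) g.contMDiff hu
    symm := fun u _ => comps_transpose (fun x v w => g.symm x v w) c u
    det_pos := fun _ hu => (comps_posDef g hu).det_pos }

omit [IsManifold (𝓡 n) ∞ M] in
lemma add_zero_smul (k h : Tensor2 n M) : (fun x => k x + (0 : ℝ) • h x) = k := by
  funext x
  refine ContinuousLinearMap.ext fun v => ContinuousLinearMap.ext fun w => ?_
  change k x v w + 0 * h x v w = k x v w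
  rw [zero_mul, add_zero]

omit [IsManifold (𝓡 n) ∞ M] in
lemma comps_add_smul (k h : Tensor2 n M) (s : ℝ) (c : M) (u : EuclideanSpace ℝ (Fin n)) :
    comps (fun x => k x + s • h x) c u = comps k c u + s • comps h c u := rfl

lemma chartInvariant_det_mul_inv {k k' : Tensor2 n M} (hk : IsMetric k) :
    ChartInvariant fun c u => (comps k' c u).det * (comps k c u).det⁻¹ := fun c' c v hv => by
  have hJ := ((hk.isCoordChange c' c).isUnit_jac hv).ne_zero
  beta_reduce
  rw [comps_trans k hv, comps_trans k' hv, Matrix.det_mul, Matrix.det_mul, Matrix.det_mul,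
    Matrix.det_mul, Matrix.det_transpose]
  field_simp

omit [IsManifold (𝓡 n) ∞ M] in
lemma dsM_comps_add_smul (k h : Tensor2 n M) (s : ℝ) (c : M) (u : EuclideanSpace ℝ (Fin n)) :
    dsM (fun s => comps (fun x => k x + s • h x) c) s u = comps h c u := by
  ext i j
  have h1 : HasDerivAt (fun s => comps k c u i j + s * comps h c u i j) (comps h c u i j) s := by
    simpa using ((hasDerivAt_id s).mul_const (comps h c u i j)).const_add (comps k c u i j)
  exact h1.deriv

omit [IsManifold (𝓡 n) ∞ M] in
lemma smAt_comps_add_smul {k h : Tensor2 n M} (hk : SmoothComps k) (hh : SmoothComps h) (s : ℝ)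
    {c : M} {u : EuclideanSpace ℝ (Fin n)}
    (hu : u ∈ (chartAt (EuclideanSpace ℝ (Fin n)) c).target) (i j : Fin n) :
    SmAt (fun s v => comps (fun x => k x + s • h x) c v i j) s u := by
  have h1 : SmAt (fun s (_ : EuclideanSpace ℝ (Fin n)) => s) s u := contDiffAt_fst
  exact (SmAt.static (hk c u hu i j)).add (h1.mul (SmAt.static (hh c u hu i j)))

/-- `IsMetricFamily` asks only for a positive determinant. The quotient `det(g + s h)/det g` is a
continuous function on `ℝ × M` equal to `1` at `s = 0`; since `M` is compact, the tube lemma keeps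
it positive for all small `s` at once. -/
lemma exists_isMetricFam [CompactSpace M] (hsmooth : h.Smooth)
    (hsymm : ∀ (x : M) (v w : TangentSpace (𝓡 n) x), h x v w = h x w v) :
    ∃ δ > 0, IsMetricFam (fun s x => g.inner x + s • h x) (Set.Ioo (-δ) δ) := by
  have hg := isMetric_inner g
  have hh : SmoothComps h := fun c u hu => comps_smooth hsmooth hu
  have hL : ∀ s : ℝ, ChartInvariant fun c u =>
      (comps (fun x => g.inner x + s • h x) c u).det * (comps g.inner c u).det⁻¹ := fun s =>
    chartInvariant_det_mul_inv hg
  have hsm := smoothFam_glue isOpen_univ (fun s _ => hL s) fun c s _ u hu =>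
    (SmAt.det fun i j => smAt_comps_add_smul hg.smoothComps hh s hu i j).mul
      ((SmAt.det fun i j => SmAt.static ((hg c).smooth u hu i j)).inv ((hg c).det_pos u hu).ne')
  set D : ℝ × M → ℝ := fun q => glue (fun c u =>
      (comps (fun x => g.inner x + q.1 • h x) c u).det * (comps g.inner c u).det⁻¹) q.2 with hDdef
  have hcont : Continuous D := continuous_iff_continuousAt.2 fun q =>
    hsm.continuousAt (Set.mem_univ q.1) q.2
  have h0 : ∀ x, D (0, x) = 1 := fun x => by
    simp only [hDdef, glue, comps_add_smul, zero_smul, add_zero]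
    exact mul_inv_cancel₀ ((hg x).det_pos _ (coord_mem_target x)).ne'
  obtain ⟨U, V, hU, -, hU0, hV, hUV⟩ := generalized_tube_lemma (isCompact_singleton (x := (0 : ℝ)))
    (isCompact_univ (X := M)) (isOpen_lt continuous_const hcont)
    (s := {0}) (t := Set.univ) (n := {q | 0 < D q}) (by
      rintro ⟨s, x⟩ ⟨hs, -⟩
      rw [Set.mem_singleton_iff] at hs
      subst hs
      change 0 < D (0, x)
      rw [h0]; exact one_pos)
  obtain ⟨δ, hδ, hball⟩ := Metric.isOpen_iff.1 hU 0 (hU0 rfl)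
  refine ⟨δ, hδ, fun c => ?_⟩
  refine ⟨isOpen_Ioo, (chartAt (EuclideanSpace ℝ (Fin n)) c).open_target,
    fun s _ u hu i j => smAt_comps_add_smul hg.smoothComps hh s hu i j, fun s _ u _ => ?_,
    fun s hs u hu => ?_⟩
  · rw [comps_add_smul, Matrix.transpose_add, Matrix.transpose_smul,
      comps_transpose (fun x v w => g.symm x v w), comps_transpose hsymm]
  · have h1 : 0 < D (s, (chartAt (EuclideanSpace ℝ (Fin n)) c).symm u) := by
      refine hUV ⟨hball ?_, hV (Set.mem_univ _)⟩
      rw [Metric.mem_ball, dist_zero_right, Real.norm_eq_abs, abs_lt]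
      exact hs
    have h2 : D (s, (chartAt (EuclideanSpace ℝ (Fin n)) c).symm u) = _ :=
      (hL s).funComp_glue hu
    rw [h2] at h1
    exact (pos_iff_pos_of_mul_pos h1).2 (inv_pos.2 ((hg c).det_pos u hu))

end LinearFamily

/-! ### The Euler-Lagrange equations of `ν` -/

section EulerLagrange

variable {n : ℕ} {M : Type*} [TopologicalSpace M] [ChartedSpace (EuclideanSpace ℝ (Fin n)) M]
  {k : Tensor2 n M} {f f' χ : M → ℝ} {τ τ' : ℝ}

lemma dotM_sub_const (hk : IsMetric k) (hf : SmoothFun n f) (r : ℝ) (x : M) :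
    dotM k (fun x => f x - r) (fun x => f x - r) x = dotM k f f x := by
  simp only [sub_eq_add_neg]
  rw [dotM_add_left k hf (SmoothFun.const (-r)), dotM_const_left, hk.dotM_comm,
    dotM_add_left k hf (SmoothFun.const (-r)), dotM_const_left, add_zero, add_zero]

lemma dotM_add_mul (hk : IsMetric k) (hf : SmoothFun n f) (hχ : SmoothFun n χ) (t r : ℝ) (x : M) :
    dotM k (fun x => f x + t * χ x + r) (fun x => f x + t * χ x + r) x =
      dotM k f f x + 2 * t * dotM k f χ x + t ^ 2 * dotM k χ χ x := by
  have h1 : SmoothFun n fun x => t * χ x := hχ.const_mul t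
  have hr : SmoothFun n fun _ : M => r := SmoothFun.const r
  have h2 : ∀ d, dotM k (fun x => f x + t * χ x + r) d x = dotM k f d x + t * dotM k χ d x :=
    fun d => by
      rw [dotM_add_left k (hf.add h1) hr, dotM_const_left, dotM_add_left k hf h1,
        dotM_mul_left k (SmoothFun.const t) hχ, dotM_const_left]
      ring
  rw [h2, hk.dotM_comm f, hk.dotM_comm χ, h2, h2, hk.dotM_comm χ f]
  ring

variable [MeasurableSpace M]

lemma Realizes.W_le (hr : Realizes k f τ) (ha : Admissible k f' τ') : W k f τ ≤ W k f' τ' := by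
  rw [← EReal.coe_le_coe_iff, hr.2]
  exact sInf_le ⟨f', τ', ha, rfl⟩

/-- `∫ e^{-f} dV`. -/
def mass (k : Tensor2 n M) (f : M → ℝ) : ℝ := ∫ x, Real.exp (-f x) ∂(vol k)

lemma Admissible.mass_pos (ha : Admissible k f τ) : 0 < mass k f := by
  have h1 : 0 < (4 * Real.pi * τ) ^ (-(n : ℝ) / 2) :=
    Real.rpow_pos_of_pos (by have := ha.2.1; positivity) _
  have h2 : (4 * Real.pi * τ) ^ (-(n : ℝ) / 2) * mass k f = 1 := ha.2.2
  exact (pos_iff_pos_of_mul_pos (h2 ▸ one_pos)).1 h1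

lemma Admissible.mass_eq (ha : Admissible k f τ) : mass k f = (4 * Real.pi * τ) ^ ((n : ℝ) / 2) := by
  have h0 : 0 < 4 * Real.pi * τ := by have := ha.2.1; positivity
  have h2 : (4 * Real.pi * τ) ^ (-(n : ℝ) / 2) * mass k f = 1 := ha.2.2
  rw [neg_div, Real.rpow_neg h0.le] at h2
  have h3 := (Real.rpow_pos_of_pos h0 ((n : ℝ) / 2)).ne'
  field_simp at h2
  exact h2

lemma rpow_mul_div {x y : ℝ} (hx : 0 < x) (hy : 0 < y) (r : ℝ) :
    y ^ (-r) * Real.exp (r * Real.log (y / x)) = x ^ (-r) := by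
  rw [Real.rpow_def_of_pos hx, Real.rpow_def_of_pos hy, Real.log_div hy.ne' hx.ne', ← Real.exp_add]
  congr 1; ring

variable [CompactSpace M] [IsManifold (𝓡 n) ∞ M] [BorelSpace M]

/-- Compare with the pairs `(f - r(t), t)`, where `r(t)` is chosen so that the normalized density
does not change. Along them `𝒲` is affine in `t` minus `r(t)`, and its derivative vanishes at `t =
τ`. -/
lemma Realizes.scale_equation (hk : IsMetric k) (hr : Realizes k f τ) :
    τ * ∫ x, (scal k x + dotM k f f x) * Real.exp (-f x) ∂(vol k) = n / 2 * mass k f := by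
  have hf : SmoothFun n f := smoothFun_iff.2 hr.1.1
  have hτ := hr.1.2.1
  set κ := (4 * Real.pi * τ) ^ (-(n : ℝ) / 2) with hκ
  have hm : κ * mass k f = 1 := hr.1.2.2
  set S1 := ∫ x, (scal k x + dotM k f f x) * Real.exp (-f x) ∂(vol k) with hS1
  set a := ∫ x, f x * Real.exp (-f x) ∂(vol k) with ha
  -- This shift makes `(4πt)^{-n/2} e^{r(t)}` constant, equal to `κ`, and vanishes at `t = τ`.
  set r : ℝ → ℝ := fun t => n / 2 * Real.log (t / τ) with hrdef
  have hκr : ∀ t, 0 < t → (4 * Real.pi * t) ^ (-(n : ℝ) / 2) * Real.exp (r t) = κ := fun t ht => by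
    have h1 := rpow_mul_div (x := 4 * Real.pi * τ) (y := 4 * Real.pi * t) (by positivity)
      (by positivity) ((n : ℝ) / 2)
    rw [mul_div_mul_left _ _ (by positivity : 4 * Real.pi ≠ 0), ← neg_div] at h1
    exact h1
  have hexp : ∀ t, 0 < t → ∀ x, (4 * Real.pi * t) ^ (-(n : ℝ) / 2) * Real.exp (-(f x - r t)) =
      κ * Real.exp (-f x) := fun t ht x => by
    rw [← hκr t ht, neg_sub, sub_eq_add_neg, Real.exp_add]; ring
  have hint : ∀ {b : M → ℝ}, SmoothFun n b → Integrable b (vol k) := fun hb =>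
    hb.integrable hk.smoothComps
  have hS : SmoothFun n fun x => scal k x + dotM k f f x :=
    hk.smooth_scal.add (hk.smooth_dotM hf hf)
  have hW : ∀ t, 0 < t → W k (fun x => f x - r t) t = κ * (t * S1 + a) - r t - n := fun t ht => by
    have h1 : ∀ x, (t * (scal k x + gradSq k (fun x => f x - r t) x) + (f x - r t) - n) *
        (4 * Real.pi * t) ^ (-(n : ℝ) / 2) * Real.exp (-(f x - r t)) =
        κ * (t * ((scal k x + dotM k f f x) * Real.exp (-f x)) + f x * Real.exp (-f x) -
          (r t + n) * Real.exp (-f x)) := fun x => by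
      rw [gradSq_eq_dotM, dotM_sub_const hk hf, mul_assoc, hexp t ht]; ring
    unfold W
    rw [integral_congr_ae (Eventually.of_forall h1), integral_const_mul, integral_sub
      (hint (((hS.mul hf.exp_neg).const_mul t).add (hf.mul hf.exp_neg)))
      (hint (hf.exp_neg.const_mul _)), integral_add (hint ((hS.mul hf.exp_neg).const_mul t))
      (hint (hf.mul hf.exp_neg)), integral_const_mul, integral_const_mul]
    change κ * (t * S1 + a - (r t + n) * mass k f) = _
    linear_combination -(r t + n) * hm
  have hr0 : r τ = 0 := by simp [hrdef, div_self hτ.ne']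
  have hadm : ∀ t, 0 < t → Admissible k (fun x => f x - r t) t := fun t ht => by
    refine ⟨smoothFun_iff.1 (hf.sub (SmoothFun.const _)), ht, ?_⟩
    rw [← integral_const_mul, integral_congr_ae (Eventually.of_forall (hexp t ht)),
      integral_const_mul]
    exact hm
  have hmin : IsLocalMin (fun t => κ * (t * S1 + a) - r t - n) τ := by
    filter_upwards [lt_mem_nhds hτ] with t ht
    rw [← hW t ht, ← hW τ hτ, hr0]
    simp only [sub_zero]
    exact hr.W_le (hadm t ht)
  have hrd : HasDerivAt r (n / 2 * (1 / τ)) τ := by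
    have h1 : HasDerivAt (fun t => Real.log (t / τ)) (1 / τ / (τ / τ)) τ :=
      ((hasDerivAt_id τ).div_const τ).log (by simp [hτ.ne'])
    rw [div_self hτ.ne', div_one] at h1
    exact h1.const_mul _
  have hd : HasDerivAt (fun t => κ * (t * S1 + a) - r t - n) (κ * (1 * S1) - n / 2 * (1 / τ)) τ :=
    (((((hasDerivAt_id τ).mul_const S1).add_const a).const_mul κ).fun_sub hrd).sub_const _
  have h0 := hmin.hasDerivAt_eq_zero hd
  field_simp at h0
  linear_combination mass k f / 2 * h0 - τ * S1 * hm

/-- Compare with `f + tχ + log(κ m(t))`, where the last term restores the normalization. Then `𝒲`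
becomes `N(t)/m(t) + log(κ m(t)) - n`, and stationarity at `t = 0` is the weak equation. -/
lemma Realizes.potential_equation (hk : IsMetric k) (hr : Realizes k f τ) (hχ : SmoothFun n χ) :
    ∫ x, (2 * τ * dotM k f χ x - χ x * (τ * (scal k x + dotM k f f x) + f x -
      (n / 2 + (∫ x, f x * Real.exp (-f x) ∂(vol k)) / mass k f))) * Real.exp (-f x) ∂(vol k)
      = 0 := by
  have hf : SmoothFun n f := smoothFun_iff.2 hr.1.1
  have hτ := hr.1.2.1
  have hfin := isFiniteMeasure_vol hk.smoothComps
  set κ := (4 * Real.pi * τ) ^ (-(n : ℝ) / 2) with hκ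
  have hκ0 : 0 < κ := Real.rpow_pos_of_pos (by positivity) _
  have hm : κ * mass k f = 1 := hr.1.2.2
  have hm0 : 0 < mass k f := hr.1.mass_pos
  set a := ∫ x, f x * Real.exp (-f x) ∂(vol k) with ha
  have hint : ∀ {b : M → ℝ}, SmoothFun n b → Integrable b (vol k) := fun hb =>
    hb.integrable hk.smoothComps
  have hS : SmoothFun n fun x => scal k x + dotM k f f x :=
    hk.smooth_scal.add (hk.smooth_dotM hf hf)
  have hft : ∀ t, SmoothFun n fun x => f x + t * χ x := fun t => hf.add (hχ.const_mul t)
  -- Positive mass excludes the zero volume measure; this is needed for `m t > 0`.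
  have hne : NeZero (vol k) := ⟨fun h0 => by
    rw [mass, h0, integral_zero_measure] at hm0; exact lt_irrefl _ hm0⟩
  set P : ℝ → M → ℝ := fun t x => τ * (scal k x + dotM k f f x + 2 * t * dotM k f χ x +
    t ^ 2 * dotM k χ χ x) + (f x + t * χ x) with hP
  have hid : SmoothFam n (fun t (_ : M) => t) Set.univ := fun c s _ u _ => contDiffAt_fst
  have hc : ∀ r : ℝ, SmoothFam n (fun _ (_ : M) => r) Set.univ := fun r =>
    (SmoothFun.const r).smoothFam _
  have hffam : SmoothFam n (fun t x => f x + t * χ x) Set.univ :=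
    (hf.smoothFam _).add (hid.mul (hχ.smoothFam _))
  have hPfam : SmoothFam n P Set.univ := by
    have h2 : SmoothFam n (fun t x => 2 * t * dotM k f χ x) Set.univ :=
      ((hc 2).mul hid).mul ((hk.smooth_dotM hf hχ).smoothFam _)
    have h3 : SmoothFam n (fun t x => t ^ 2 * dotM k χ χ x) Set.univ := by
      simp only [pow_two]
      exact (hid.mul hid).mul ((hk.smooth_dotM hχ hχ).smoothFam _)
    exact ((hc τ).mul (((hS.smoothFam _).add h2).add h3)).add hffam
  set N : ℝ → ℝ := fun t => ∫ x, P t x * Real.exp (-(f x + t * χ x)) ∂(vol k) with hN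
  set m : ℝ → ℝ := fun t => ∫ x, Real.exp (-(f x + t * χ x)) ∂(vol k) with hmdef
  have hmt : ∀ t, 0 < m t := fun t => integral_exp_pos (hint (hft t).exp_neg)
  have hm00 : m 0 = mass k f := by simp [hmdef, mass]
  have hW : ∀ t, W k (fun x => f x + t * χ x + Real.log (κ * m t)) τ =
      N t / m t + Real.log (κ * m t) - n := fun t => by
    have hmt' : m t ≠ 0 := (hmt t).ne'
    have h1 : ∀ x, (τ * (scal k x + gradSq k (fun x => f x + t * χ x + Real.log (κ * m t)) x) +
        (f x + t * χ x + Real.log (κ * m t)) - n) * κ *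
          Real.exp (-(f x + t * χ x + Real.log (κ * m t))) =
        (m t)⁻¹ * (P t x * Real.exp (-(f x + t * χ x)) +
          (Real.log (κ * m t) - n) * Real.exp (-(f x + t * χ x))) := fun x => by
      rw [gradSq_eq_dotM, dotM_add_mul hk hf hχ, neg_add, Real.exp_add (-(f x + t * χ x)),
        Real.exp_neg (Real.log _), Real.exp_log (mul_pos hκ0 (hmt t))]
      simp only [hP]
      field_simp
      ring
    unfold W
    rw [integral_congr_ae (Eventually.of_forall h1), integral_const_mul, integral_add
      (hint ((hPfam.smoothFun (Set.mem_univ t)).mul (hft t).exp_neg))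
      (hint ((hft t).exp_neg.const_mul _)), integral_const_mul]
    change (m t)⁻¹ * (N t + (Real.log (κ * m t) - n) * m t) = _
    field_simp
    ring
  have hadm : ∀ t, Admissible k (fun x => f x + t * χ x + Real.log (κ * m t)) τ := fun t => by
    refine ⟨smoothFun_iff.1 ((hft t).add (SmoothFun.const _)), hτ, ?_⟩
    have h1 : ∀ x, Real.exp (-(f x + t * χ x + Real.log (κ * m t))) =
        (κ * m t)⁻¹ * Real.exp (-(f x + t * χ x)) := fun x => by
      rw [neg_add, Real.exp_add (-(f x + t * χ x)), Real.exp_neg (Real.log _),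
        Real.exp_log (mul_pos hκ0 (hmt t)), mul_comm]
    rw [integral_congr_ae (Eventually.of_forall h1), integral_const_mul]
    change κ * ((κ * m t)⁻¹ * m t) = 1
    have := (hmt t).ne'
    field_simp
  have hmin : IsLocalMin (fun t => N t / m t + Real.log (κ * m t) - n) 0 := by
    refine Eventually.of_forall fun t => ?_
    have h0 : (fun x => f x + 0 * χ x + Real.log (κ * m 0)) = f := by
      funext x; rw [hm00, hm]; simp
    have h1 := hW 0
    rw [h0] at h1
    beta_reduce
    rw [← hW t, ← h1]
    exact hr.W_le (hadm t)
  have hm' : HasDerivAt m (-∫ x, χ x * Real.exp (-f x) ∂(vol k)) 0 := by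
    have h1 := hasDerivAt_integral_smoothFam (μ := vol k) isOpen_univ (Set.mem_univ 0)
      hffam.exp_neg
    refine h1.congr_deriv ?_
    rw [← integral_neg]
    refine integral_congr_ae (Eventually.of_forall fun x => ?_)
    have h2 : HasDerivAt (fun t => f x + t * χ x) (1 * χ x) 0 :=
      ((hasDerivAt_id 0).mul_const (χ x)).const_add (f x)
    beta_reduce
    rw [h2.fun_neg.exp.deriv]
    simp; ring
  have hN' : HasDerivAt N (∫ x, (2 * τ * dotM k f χ x + χ x -
      χ x * (τ * (scal k x + dotM k f f x) + f x)) * Real.exp (-f x) ∂(vol k)) 0 := by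
    have h1 := hasDerivAt_integral_smoothFam (μ := vol k) isOpen_univ (Set.mem_univ 0)
      (hPfam.mul hffam.exp_neg)
    refine h1.congr_deriv ?_
    refine integral_congr_ae (Eventually.of_forall fun x => ?_)
    have h2 : HasDerivAt (fun t => f x + t * χ x) (1 * χ x) 0 :=
      ((hasDerivAt_id 0).mul_const (χ x)).const_add (f x)
    have h3 : HasDerivAt (fun t => P t x) (2 * τ * dotM k f χ x + χ x) 0 := by
      have h4 := ((((hasDerivAt_id (0 : ℝ)).const_mul 2).mul_const (dotM k f χ x)).const_add
        (scal k x + dotM k f f x)).fun_add (((hasDerivAt_id (0 : ℝ)).fun_pow 2).mul_const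
          (dotM k χ χ x))
      refine ((h4.const_mul τ).fun_add h2).congr_deriv ?_
      simp; ring
    beta_reduce
    rw [(h3.fun_mul h2.fun_neg.exp).deriv]
    simp [hP]; ring
  have hm0' : m 0 ≠ 0 := hm00 ▸ hm0.ne'
  have hd := ((hN'.fun_div hm' hm0').fun_add ((hm'.const_mul κ).log
    (mul_ne_zero hκ0.ne' hm0'))).sub_const (n : ℝ)
  have h0 := hmin.hasDerivAt_eq_zero hd
  -- The scale equation evaluates the curvature part of `N 0`, so the constant of the weak equation
  -- is `n/2` plus the weighted mean of `f`.
  have hN0 : N 0 = n / 2 * mass k f + a := by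
    rw [← hr.scale_equation hk, ha, ← integral_const_mul, ← integral_add
      (hint ((hS.mul hf.exp_neg).const_mul τ)) (hint (hf.mul hf.exp_neg))]
    refine integral_congr_ae (Eventually.of_forall fun x => ?_)
    simp [hP]; ring
  rw [hN0, hm00] at h0
  have hsplit : ∫ x, (2 * τ * dotM k f χ x - χ x * (τ * (scal k x + dotM k f f x) + f x -
      (n / 2 + a / mass k f))) * Real.exp (-f x) ∂(vol k) =
      (∫ x, (2 * τ * dotM k f χ x + χ x -
      χ x * (τ * (scal k x + dotM k f f x) + f x)) * Real.exp (-f x) ∂(vol k)) +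
      (n / 2 + a / mass k f - 1) * ∫ x, χ x * Real.exp (-f x) ∂(vol k) := by
    have hD1 : SmoothFun n fun x => 2 * τ * dotM k f χ x := (hk.smooth_dotM hf hχ).const_mul _
    rw [← integral_const_mul, ← integral_add (hint (((hD1.add hχ).sub
      (hχ.mul ((hS.const_mul τ).add hf))).mul hf.exp_neg))
      (hint ((hχ.mul hf.exp_neg).const_mul _))]
    refine integral_congr_ae (Eventually.of_forall fun x => ?_)
    ring
  rw [hsplit]
  field_simp at h0 ⊢
  linear_combination h0

end EulerLagrange

/-! ### The algebra of the second-order identities -/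

section Algebra

variable {A : Type*} [CommRing A] [Algebra ℝ A] (E : A →ₗ[ℝ] ℝ)

/-- The combination of the differentiated Euler-Lagrange equations. Here `E` is the integral against
`e^{-f} dV`, `w = |∇f|²`, `L = Δf`, and `R'` is the variation of the scalar curvature. -/
lemma mul_apply_scal_eq (f v t w L R R' hff hH rc gv : A) {n τ T' N : ℝ} (hτ : τ ≠ 0)
    (hN : E f = N * E 1) (hR : R + L = (n / (2 * τ)) • (1 : A)) (hrc : rc + hH = (1 / (2 * τ)) • t)
    (g₁ : E (L - w) = 0) (g₂ : E (f * (L - w) + w) = 0) (g₃ : E (v * (L - w) + gv) = 0)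
    (g₄ : E (f * v * (L - w) + (f * gv + v * w)) = 0)
    (v₁ : E (R' + rc - (hff - hH) + t * (w - L)) = 0)
    (v₂ : E (f * R' + f * rc - ((1 - f) * hH + (f - 2) * hff) + t * ((1 - f) * L + (f - 2) * w)) = 0)
    (el : ∀ χ : A, E (χ * (τ • (L - w) + f - N • 1)) = 0)
    (c : T' * E (R + w) + τ * E (R' - hff + 2 * gv + ((1 / 2 : ℝ) • t - v) * (R + w)) =
      n / 2 * E ((1 / 2 : ℝ) • t - v))
    (e : 2 * T' * E w + 2 * τ * E (2 * gv - hff + ((1 / 2 : ℝ) • t - v) * w) - T' * E (f * (R + w)) -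
      τ * E (v * (R + w) + f * (R' - hff + 2 * gv) + ((1 / 2 : ℝ) • t - v) * (f * (R + w))) -
      E (2 * f * v + ((1 / 2 : ℝ) • t - v) * (f * f)) +
      (n / 2 + 2 * N) * E (v + ((1 / 2 : ℝ) • t - v) * f) - N ^ 2 * E ((1 / 2 : ℝ) • t - v) = 0) :
    T' * E R = τ * E rc := by
  obtain rfl : R = (n / (2 * τ)) • (1 : A) - L := eq_sub_of_add_eq hR
  obtain rfl : rc = (1 / (2 * τ)) • t - hH := eq_sub_of_add_eq hrc
  -- Replacing `t` by `2y` and `n` by `2τq` clears the denominators; the only relation then left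
  -- between scalars is `τ τ⁻¹ = 1`, recorded in `e₅`.
  obtain ⟨y, rfl⟩ : ∃ y : A, t = (2 : ℝ) • y := ⟨(1 / 2 : ℝ) • t, by rw [smul_smul]; norm_num⟩
  obtain ⟨q, rfl⟩ : ∃ q : ℝ, n = 2 * τ * q := ⟨n / (2 * τ), by field_simp⟩
  have e₁ : 2 * τ * q / (2 * τ) = q := by field_simp
  have e₂ : (1 / (2 * τ)) • (2 : ℝ) • y = τ⁻¹ • y := by rw [smul_smul]; congr 1; field_simp
  have e₃ : (1 / 2 : ℝ) • (2 : ℝ) • y = y := by rw [smul_smul]; norm_num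
  have e₄ : 2 * τ * q / 2 = τ * q := by ring
  have e₅ : algebraMap ℝ A τ * algebraMap ℝ A τ⁻¹ = 1 := by
    rw [← map_mul, mul_inv_cancel₀ hτ, map_one]
  clear hR hrc
  simp only [e₁, e₂, e₃, e₄] at v₁ v₂ c e ⊢
  -- `y - v` is the logarithmic derivative of the measure `e^{-f} dV`. The two test functions are
  -- chosen to absorb the terms in `y` and `v` that are left in `c` and in `e` after `R'` has been
  -- eliminated.
  have el₁ := el (y - v)
  have el₂ := el (3 * (y - v) - y - (y - v) * f)
  -- `T'R - τ⟨Rc,h⟩` equals, already pointwise, minus the integrand of `e` corrected by `v₂`, `g₃`,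
  -- `g₄`, `el₂`, minus `N - 1` times that of `c` corrected by `v₁`, `g₃`, `el₁`, plus `T'` times a
  -- remainder controlled by `g₁`, `g₂` and `hN`. The multiples of `v₁` and `v₂` are the ones that
  -- cancel `R'` and `f R'`.
  have key : T' • (q • (1 : A) - L) - τ • (τ⁻¹ • y - hH) =
      -(((2 * T') • w + (2 * τ) • (2 * gv - hff + (y - v) * w) -
          T' • (f * (q • (1 : A) - L + w)) - τ • (v * (q • (1 : A) - L + w) +
            f * (R' - hff + 2 * gv) + (y - v) * (f * (q • (1 : A) - L + w))) -
          (2 * f * v + (y - v) * (f * f)) + (τ * q + 2 * N) • (v + (y - v) * f) -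
          (N ^ 2) • (y - v)) +
        τ • (f * R' + f * (τ⁻¹ • y - hH) - ((1 - f) * hH + (f - 2) * hff) +
          ((2 : ℝ) • y) * ((1 - f) * L + (f - 2) * w)) +
        (2 * τ) • (f * v * (L - w) + (f * gv + v * w)) - (4 * τ) • (v * (L - w) + gv) -
        (3 * (y - v) - y - (y - v) * f) * (τ • (L - w) + f - N • 1)) -
      (N - 1) • (T' • (q • (1 : A) - L + w) +
          τ • (R' - hff + 2 * gv + (y - v) * (q • (1 : A) - L + w)) - (τ * q) • (y - v) -
        τ • (R' + (τ⁻¹ • y - hH) - (hff - hH) + ((2 : ℝ) • y) * (w - L)) -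
        (2 * τ) • (v * (L - w) + gv) - (y - v) * (τ • (L - w) + f - N • 1)) +
      T' • (f * (L - w) + w - N • (L - w) - q • (f - N • 1)) := by
    simp only [Algebra.smul_def, map_sub, map_add, map_mul, map_pow, map_one, map_ofNat]
    linear_combination (y * f - y * algebraMap ℝ A N) * e₅
  have hE := congrArg E key
  simp only [map_add, map_sub, map_neg, map_smul, smul_eq_mul] at hE g₁ g₂ g₃ g₄ v₁ v₂ el₁ el₂ c e ⊢
  linear_combination hE + T' * (g₂ - N * g₁) - T' * q * hN - (N - 1) * (c - τ * v₁ - 2 * τ * g₃ - el₁) -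
    (e + τ * v₂ + 2 * τ * g₄ - 4 * τ * g₃ - el₂)

/-- The integrated Bochner formula on a shrinker; `Hs = |∇²f|²`, `Q = |Rc|²`, `gL = ⟨∇f, ∇Δf⟩`,
`gw = ⟨∇f, ∇|∇f|²⟩` and `Lw = Δ|∇f|²`. -/
lemma apply_scal_eq (f w L R Hs Q gL gw Lw : A) {n τ N : ℝ} (hτ : τ ≠ 0)
    (hR : R + L = (n / (2 * τ)) • (1 : A))
    (hH : Hs = (n / (4 * τ ^ 2)) • (1 : A) - (1 / τ) • R + Q)
    (hB : (1 / 2 : ℝ) • Lw - Hs - gL = (1 / (2 * τ)) • w - (1 / 2 : ℝ) • gw)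
    (g₁ : E (L - w) = 0) (g₂ : E (f * (L - w) + w) = 0) (g₃ : E (Lw - gw) = 0)
    (g₄ : E ((L - w) * (L - w) + (gL - gw)) = 0)
    (el : ∀ χ : A, E (χ * (τ • (L - w) + f - N • 1)) = 0) :
    E R = 2 * τ * E Q := by
  obtain rfl : L = (n / (2 * τ)) • (1 : A) - R := eq_sub_of_add_eq' hR
  subst hH
  -- The test function is `L - w = Δf - |∇f|²`, since `L` has been replaced by `n/(2τ) - R`. It
  -- gives `τ E((L - w)²) = E w`, while Green's identity `g₄` relates the same square to the
  -- gradient terms of Bochner's formula.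
  have el₁ := el ((n / (2 * τ)) • (1 : A) - R - w)
  clear hR el
  set D : A := (n / (2 * τ)) • (1 : A) - R - w with hD
  have h1 : D * (τ • D + f - N • 1) = τ • (D * D) + f * D - N • D := by
    simp only [mul_sub, mul_add, mul_smul_comm, mul_one]; ring
  rw [h1] at el₁
  have hE := congrArg E hB
  have hE' := congrArg E hD
  simp only [map_add, map_sub, map_smul, smul_eq_mul] at hE hE' g₁ g₂ g₃ g₄ el₁ ⊢
  linear_combination (norm := skip) 2 * τ * hE - τ * g₃ + 2 * τ * g₄ - 2 * el₁ + 2 * g₂ -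
    2 * N * g₁ - hE' + g₁
  field_simp
  ring

end Algebra

/-! ### The weighted integral as a linear functional -/

section WeightedIntegral

variable {n : ℕ} {M : Type*} [TopologicalSpace M] [ChartedSpace (EuclideanSpace ℝ (Fin n)) M]

variable (n M) in
/-- The algebra of smooth functions. -/
def smoothAlg : Subalgebra ℝ (M → ℝ) where
  carrier := {a | SmoothFun n a}
  mul_mem' := SmoothFun.mul
  add_mem' := SmoothFun.add
  algebraMap_mem' := SmoothFun.const

namespace smoothAlg

variable (a b : smoothAlg n M) (r : ℝ) (x : M)

lemma add_apply : (a + b).1 x = a.1 x + b.1 x := rfl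
lemma sub_apply : (a - b).1 x = a.1 x - b.1 x := rfl
lemma mul_apply : (a * b).1 x = a.1 x * b.1 x := rfl
lemma smul_apply : (r • a).1 x = r * a.1 x := rfl
lemma one_apply : (1 : smoothAlg n M).1 x = 1 := rfl
lemma two_apply : (2 : smoothAlg n M).1 x = 2 := rfl

end smoothAlg

variable [CompactSpace M] [IsManifold (𝓡 n) ∞ M] [MeasurableSpace M] [BorelSpace M]
  {k : Tensor2 n M} {f : M → ℝ}

/-- `a ↦ ∫ a e^{-f} dV`. -/
def weightedIntegral (hk : IsMetric k) (hf : SmoothFun n f) : smoothAlg n M →ₗ[ℝ] ℝ where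
  toFun a := ∫ x, a.1 x * Real.exp (-f x) ∂(vol k)
  map_add' a b := by
    have ha : SmoothFun n a.1 := a.2
    have hb : SmoothFun n b.1 := b.2
    rw [← integral_add ((ha.mul hf.exp_neg).integrable hk.smoothComps)
      ((hb.mul hf.exp_neg).integrable hk.smoothComps)]
    exact integral_congr_ae (Eventually.of_forall fun x => by
      simp only [smoothAlg.add_apply]; ring)
  map_smul' r a := by
    rw [RingHom.id_apply, smul_eq_mul, ← integral_const_mul]
    exact integral_congr_ae (Eventually.of_forall fun x => by
      simp only [smoothAlg.smul_apply]; ring)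

lemma weightedIntegral_apply (hk : IsMetric k) (hf : SmoothFun n f) (a : smoothAlg n M) :
    weightedIntegral hk hf a = ∫ x, a.1 x * Real.exp (-f x) ∂(vol k) := rfl

lemma weightedIntegral_eq (hk : IsMetric k) (hf : SmoothFun n f) (a : smoothAlg n M) {b : M → ℝ}
    (h : ∀ x, a.1 x = b x) :
    weightedIntegral hk hf a = ∫ x, b x * Real.exp (-f x) ∂(vol k) := by
  rw [weightedIntegral_apply]; simp only [h]

variable {τ : ℝ}

lemma weightedIntegral_one (hk : IsMetric k) (hf : SmoothFun n f) :
    weightedIntegral hk hf 1 = mass k f := by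
  rw [weightedIntegral_apply, mass]; simp only [smoothAlg.one_apply, one_mul]

variable [T2Space M]

lemma weightedIntegral_green (hk : IsMetric k) (hf : SmoothFun n f) {b : M → ℝ}
    (hb : SmoothFun n b) (a : smoothAlg n M) : weightedIntegral hk hf
      (a * (⟨lapM k b, hk.smooth_lapM hb⟩ - ⟨dotM k f b, hk.smooth_dotM hf hb⟩) +
        ⟨dotM k a.1 b, hk.smooth_dotM a.2 hb⟩) = 0 :=
  integral_weighted_green hk hf a.2 hb

lemma weightedIntegral_green_one (hk : IsMetric k) (hf : SmoothFun n f) {b : M → ℝ}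
    (hb : SmoothFun n b) : weightedIntegral hk hf
      (⟨lapM k b, hk.smooth_lapM hb⟩ - ⟨dotM k f b, hk.smooth_dotM hf hb⟩) = 0 := by
  rw [← weightedIntegral_green hk hf hb 1, one_mul]
  congr 1
  refine Subtype.ext (funext fun x => ?_)
  rw [smoothAlg.add_apply]
  exact (add_eq_left.2 (dotM_const_left k 1 b x)).symm

/-- On a shrinker, the potential equation reads `τ(Δf - |∇f|²) = -(f - N)`. -/
lemma weightedIntegral_potential (hk : IsMetric k) (hf : SmoothFun n f) (hr : Realizes k f τ)
    (hs : IsGradientShrinker k f τ) {N : ℝ}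
    (hN : weightedIntegral hk hf ⟨f, hf⟩ = N * weightedIntegral hk hf 1) (χ : smoothAlg n M) :
    weightedIntegral hk hf (χ * (τ • (⟨lapM k f, hk.smooth_lapM hf⟩ -
      ⟨dotM k f f, hk.smooth_dotM hf hf⟩) + ⟨f, hf⟩ - N • 1)) = 0 := by
  have hτ := hr.1.2.1
  have h1 := hr.potential_equation hk χ.2
  have h2 := weightedIntegral_green hk hf hf χ
  have hm := hr.1.mass_pos.ne'
  have hN' : (∫ x, f x * Real.exp (-f x) ∂(vol k)) / mass k f = N := by
    rw [div_eq_iff hm, ← weightedIntegral_one hk hf, ← hN]; rfl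
  rw [hN', ← weightedIntegral_eq hk hf ((2 * τ) • ⟨dotM k χ.1 f, hk.smooth_dotM χ.2 hf⟩ +
    χ * (τ • (⟨lapM k f, hk.smooth_lapM hf⟩ -
      ⟨dotM k f f, hk.smooth_dotM hf hf⟩) - ⟨f, hf⟩ + N • 1))] at h1
  · have h3 := congrArg (weightedIntegral hk hf) (show χ * (τ • ((⟨lapM k f, hk.smooth_lapM hf⟩ :
      smoothAlg n M) - ⟨dotM k f f, hk.smooth_dotM hf hf⟩) + ⟨f, hf⟩ - N • 1) =
        (2 * τ) • (χ * (⟨lapM k f, hk.smooth_lapM hf⟩ - ⟨dotM k f f, hk.smooth_dotM hf hf⟩) +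
          ⟨dotM k χ.1 f, hk.smooth_dotM χ.2 hf⟩) -
        ((2 * τ) • ⟨dotM k χ.1 f, hk.smooth_dotM χ.2 hf⟩ +
          χ * (τ • (⟨lapM k f, hk.smooth_lapM hf⟩ -
            ⟨dotM k f f, hk.smooth_dotM hf hf⟩) - ⟨f, hf⟩ + N • 1)) from by
      refine Subtype.ext (funext fun x => ?_)
      simp only [smoothAlg.add_apply, smoothAlg.sub_apply, smoothAlg.mul_apply,
        smoothAlg.smul_apply, smoothAlg.one_apply]
      ring)
    rw [h3, map_sub, map_smul, h2, h1]; simp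
  · intro x
    have h4 := hk.soliton_scal hs x
    have h5 : τ * scal k x = n / 2 - τ * lapM k f x := by
      field_simp at h4
      linarith
    simp only [smoothAlg.add_apply, smoothAlg.sub_apply, smoothAlg.mul_apply,
        smoothAlg.smul_apply, smoothAlg.one_apply, hk.dotM_comm χ.1 f]
    linear_combination χ.1 x * h5

/-- `∫ R e^{-f} dV = 2τ ∫ |Rc|² e^{-f} dV` on a shrinker that realizes `ν`. -/
lemma integral_scal_eq_ricSq (hk : IsMetric k) (hr : Realizes k f τ)
    (hs : IsGradientShrinker k f τ) :
    ∫ x, scal k x * Real.exp (-f x) ∂(vol k) = 2 * τ * ∫ x, ricSq k x * Real.exp (-f x) ∂(vol k) := by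
  have hf : SmoothFun n f := smoothFun_iff.2 hs.1
  have hτ := hr.1.2.1.ne'
  have hw := hk.smooth_dotM hf hf
  have hL := hk.smooth_lapM hf
  set E := weightedIntegral hk hf with hE
  have hN : E ⟨f, hf⟩ = E ⟨f, hf⟩ / E 1 * E 1 := by
    rw [div_mul_cancel₀]
    rw [hE, weightedIntegral_one]; exact hr.1.mass_pos.ne'
  refine apply_scal_eq E ⟨f, hf⟩ ⟨dotM k f f, hw⟩ ⟨lapM k f, hL⟩ ⟨scal k, hk.smooth_scal⟩
    ⟨hessSq k f, hk.smooth_hessSq hf⟩ ⟨ricSq k, hk.smooth_ricSq⟩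
    ⟨dotM k f (lapM k f), hk.smooth_dotM hf hL⟩ ⟨dotM k f (dotM k f f), hk.smooth_dotM hf hw⟩
    ⟨lapM k (dotM k f f), hk.smooth_lapM hw⟩ (n := n) hτ ?_ ?_ ?_ (weightedIntegral_green_one hk hf hf)
    (weightedIntegral_green hk hf hf ⟨f, hf⟩) (weightedIntegral_green_one hk hf hw) ?_
    (weightedIntegral_potential hk hf hr hs hN)
  · refine Subtype.ext (funext fun x => ?_)
    simp only [smoothAlg.add_apply, smoothAlg.smul_apply, smoothAlg.one_apply, mul_one]
    exact hk.soliton_scal hs x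
  · refine Subtype.ext (funext fun x => ?_)
    simp only [smoothAlg.add_apply, smoothAlg.sub_apply, smoothAlg.smul_apply,
      smoothAlg.one_apply, mul_one]
    exact hk.soliton_hessSq hs x
  · refine Subtype.ext (funext fun x => ?_)
    simp only [smoothAlg.sub_apply, smoothAlg.smul_apply]
    rw [hk.bochner hf x, hk.soliton_ricGrad hs x]
  -- Green's identity with `Δf - |∇f|²` as the multiplier.
  · rw [← weightedIntegral_green hk hf hf (⟨lapM k f, hL⟩ - ⟨dotM k f f, hw⟩)]
    congr 2
    refine Subtype.ext (funext fun x => ?_)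
    have h1 : ∀ x, dotM k (fun x => lapM k f x - dotM k f f x) f x =
        dotM k f (lapM k f) x - dotM k f (dotM k f f) x := fun x => by
      have h2 := dotM_add_left k (hL.sub hw) hw (d := f) x
      simp only [sub_add_cancel] at h2
      rw [hk.dotM_comm f (lapM k f), hk.dotM_comm f (dotM k f f)]
      exact eq_sub_of_add_eq h2.symm
    exact (h1 x).symm

/-- The scalar curvature of a shrinker that realizes `ν` has positive weighted integral. -/
lemma integral_scal_ne_zero (hn : 0 < n) (hk : IsMetric k)
    (hpos : ∀ x, (comps k x (coord x)).PosDef) (hr : Realizes k f τ)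
    (hs : IsGradientShrinker k f τ) : ∫ x, scal k x * Real.exp (-f x) ∂(vol k) ≠ 0 := by
  intro h0
  have hf : SmoothFun n f := smoothFun_iff.2 hs.1
  have hτ := hr.1.2.1
  have hn' : (0 : ℝ) < n := Nat.cast_pos.2 hn
  have hfin := isFiniteMeasure_vol hk.smoothComps
  have hR := hk.smooth_scal
  have hint : ∀ {b : M → ℝ}, SmoothFun n b → Integrable b (vol k) := fun hb =>
    hb.integrable hk.smoothComps
  have h1 : ∫ x, ricSq k x * Real.exp (-f x) ∂(vol k) = 0 := by
    have := integral_scal_eq_ricSq hk hr hs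
    rw [h0] at this
    exact (mul_eq_zero.1 this.symm).resolve_left (by positivity)
  -- Vanishing of the weighted integral of `|Rc|²` propagates to `R²` by `sq_scal_le`, so `R = 0`
  -- almost everywhere.
  have h2 : ∫ x, scal k x ^ 2 * Real.exp (-f x) ∂(vol k) = 0 := by
    refine le_antisymm ?_ (integral_nonneg fun x => by positivity)
    calc ∫ x, scal k x ^ 2 * Real.exp (-f x) ∂(vol k)
        ≤ ∫ x, n * (ricSq k x * Real.exp (-f x)) ∂(vol k) := by
          refine integral_mono ?_ (hint ((hk.smooth_ricSq.mul hf.exp_neg).const_mul _)) fun x => ?_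
          · simp only [pow_two]; exact hint ((hR.mul hR).mul hf.exp_neg)
          · beta_reduce
            rw [← mul_assoc]
            exact mul_le_mul_of_nonneg_right (hk.sq_scal_le hn (hpos x)) (Real.exp_pos _).le
      _ = 0 := by rw [integral_const_mul, h1, mul_zero]
  have h3 : scal k =ᵐ[vol k] 0 := by
    have h4 := (integral_eq_zero_iff_of_nonneg (μ := vol k)
      (f := fun x => scal k x ^ 2 * Real.exp (-f x)) (fun x => by positivity) (by
        simp only [pow_two]; exact hint ((hR.mul hR).mul hf.exp_neg))).1 h2
    filter_upwards [h4] with x hx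
    simpa [(Real.exp_pos _).ne'] using hx
  -- Now the unweighted measure: integrating `R + Δf = n/(2τ)` leaves a positive multiple of the
  -- volume equal to zero, contrary to the positive mass.
  have h5 : ∫ x, lapM k f x ∂(vol k) = 0 := by
    rw [← integral_mul_lapM_add_dotM hk (SmoothFun.const 1) hf]
    exact integral_congr_ae (Eventually.of_forall fun x => by
      simp only [dotM_const_left]; ring)
  have h6 : ∫ x, scal k x ∂(vol k) = n / (2 * τ) * (vol k).real Set.univ := by
    rw [← add_zero (∫ x, scal k x ∂(vol k)), ← h5, ← integral_add (hint hR)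
      (hint (hk.smooth_lapM hf)), integral_congr_ae (Eventually.of_forall fun x =>
        hk.soliton_scal hs x), integral_const, smul_eq_mul, mul_comm]
  rw [integral_congr_ae h3] at h6
  simp only [Pi.zero_apply, integral_zero] at h6
  have h7 : (vol k).real Set.univ = 0 := (mul_eq_zero.1 h6.symm).resolve_left (by positivity)
  rw [measureReal_eq_zero_iff, Measure.measure_univ_eq_zero] at h7
  have := hr.1.mass_pos
  rw [mass, h7, integral_zero_measure] at this
  exact lt_irrefl _ this

end WeightedIntegral

/-! ### Differentiating the Euler-Lagrange equations -/

section Variation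

variable {n : ℕ} {M : Type*} [TopologicalSpace M] [ChartedSpace (EuclideanSpace ℝ (Fin n)) M]
  [T2Space M] [CompactSpace M] [IsManifold (𝓡 n) ∞ M] [MeasurableSpace M] [BorelSpace M]
  {k : ℝ → Tensor2 n M} {S : Set ℝ} {s : ℝ} {h : Tensor2 n M} {F : ℝ → M → ℝ} {T : ℝ → ℝ}

/-- The measure `e^{-F} dV` has logarithmic derivative `½ tr h - ∂ₛF`; the rest is the product rule.
-/
lemma hasDerivAt_weightedIntegral (hk : IsMetricFam k S) (hS : IsOpen S) (hs : s ∈ S)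
    (hd : ∀ c : M, ∀ u ∈ (chartAt (EuclideanSpace ℝ (Fin n)) c).target,
      dsM (fun s => comps (k s) c) s u = comps h c u) (hF : SmoothFam n F S) {B : ℝ → M → ℝ}
    (hB : SmoothFam n B S) {B' : M → ℝ} (hB' : ∀ x, HasDerivAt (fun s => B s x) (B' x) s) :
    HasDerivAt (fun s => ∫ x, B s x * Real.exp (-F s x) ∂(vol (k s)))
      (∫ x, (B' x + (1 / 2 * trM (k s) h x - deriv (fun s => F s x) s) * B s x) *
        Real.exp (-F s x) ∂(vol (k s))) s := by
  refine (hasDerivAt_integral_vol hk hS hs hd (hB.mul hF.exp_neg)).congr_deriv ?_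
  refine integral_congr_ae (Eventually.of_forall fun x => ?_)
  beta_reduce
  rw [((hB' x).fun_mul (hF.hasDerivAt hs x).fun_neg.exp).deriv]
  ring

omit [T2Space M] in
-- Testing with the potential itself turns the weak equation into a scalar relation between weighted
-- integrals, which can be differentiated along the family without differentiating a test-function
-- identity.
lemma Realizes.potential_equation_self {k : Tensor2 n M} {f : M → ℝ} {τ : ℝ} (hk : IsMetric k)
    (hr : Realizes k f τ) :
    2 * τ * (∫ x, dotM k f f x * Real.exp (-f x) ∂(vol k)) -
      τ * (∫ x, f x * (scal k x + dotM k f f x) * Real.exp (-f x) ∂(vol k)) -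
      (∫ x, f x * f x * Real.exp (-f x) ∂(vol k)) +
      (n / 2 + (∫ x, f x * Real.exp (-f x) ∂(vol k)) / mass k f) *
        (∫ x, f x * Real.exp (-f x) ∂(vol k)) = 0 := by
  have hf : SmoothFun n f := smoothFun_iff.2 hr.1.1
  have h1 := hr.potential_equation hk hf
  set c := n / 2 + (∫ x, f x * Real.exp (-f x) ∂(vol k)) / mass k f with hc
  have hw := hk.smooth_dotM hf hf
  let f₀ : smoothAlg n M := ⟨f, hf⟩
  let w : smoothAlg n M := ⟨dotM k f f, hw⟩
  let R : smoothAlg n M := ⟨scal k, hk.smooth_scal⟩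
  have h2 := weightedIntegral_eq hk hf ((2 * τ) • w - τ • (f₀ * (R + w)) - f₀ * f₀ + c • f₀)
    (b := fun x => 2 * τ * dotM k f f x - f x * (τ * (scal k x + dotM k f f x) + f x - c))
    (fun x => by
      simp only [smoothAlg.add_apply, smoothAlg.sub_apply, smoothAlg.mul_apply,
        smoothAlg.smul_apply, f₀, w, R]
      ring)
  rw [h1] at h2
  simp only [map_add, map_sub, map_smul, smul_eq_mul] at h2
  exact h2

lemma hasDerivAt_mul_exp_neg (y : ℝ) :
    HasDerivAt (fun y => y * Real.exp (-y)) ((1 - y) * Real.exp (-y)) y :=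
  ((hasDerivAt_id' y).fun_mul (hasDerivAt_exp_neg y)).congr_deriv (by ring)

lemma hasDerivAt_one_sub_mul_exp_neg (y : ℝ) :
    HasDerivAt (fun y => (1 - y) * Real.exp (-y)) ((y - 2) * Real.exp (-y)) y :=
  (((hasDerivAt_id' y).const_sub 1).fun_mul (hasDerivAt_exp_neg y)).congr_deriv (by ring)

/-- For a weight of the form `η(f)` the chain rule reduces the derivatives of the weight to those of
`f`. The cases needed are `η(y) = e^{-y}` and `η(y) = y e^{-y}`. -/
lemma integral_variation_scal_comp (hk : IsMetricFam k S) (hS : IsOpen S) (hs : s ∈ S)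
    (hd : ∀ c : M, ∀ u ∈ (chartAt (EuclideanSpace ℝ (Fin n)) c).target,
      dsM (fun s => comps (k s) c) s u = comps h c u)
    (hsymm : ∀ (x : M) (v w : TangentSpace (𝓡 n) x), h x v w = h x w v)
    {η η₁ η₂ : ℝ → ℝ} (hη : ∀ y, HasDerivAt η (η₁ y) y) (hη₁ : ∀ y, HasDerivAt η₁ (η₂ y) y)
    {f : M → ℝ} (hf : SmoothFun n f) (hχ : SmoothFun n fun x => η (f x)) :
    ∫ x, (η (f x) * deriv (fun s => scal (k s) x) s + η (f x) * ricciInner (k s) h x -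
      (η₁ (f x) * hessInner (k s) h f x + η₂ (f x) * gradForm (k s) h f f x) +
      trM (k s) h x * (η₁ (f x) * lapM (k s) f x + η₂ (f x) * dotM (k s) f f x)) ∂(vol (k s)) = 0 := by
  rw [← integral_variation_scal hk hS hs hd hsymm hχ]
  refine integral_congr_ae (Eventually.of_forall fun x => ?_)
  beta_reduce
  rw [(hk.isMetric hs).hessInner_comp h hη hη₁ hf x, lapM_comp (k s) hη hη₁ hf x]

/-- The variation of the scale of the minimizers of `𝒲` at a shrinker. -/
theorem hasDerivAt_scale (hn : 0 < n) (hk : IsMetricFam k S) (hS : IsOpen S) (h0 : (0 : ℝ) ∈ S)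
    (hd : ∀ c : M, ∀ u ∈ (chartAt (EuclideanSpace ℝ (Fin n)) c).target,
      dsM (fun s => comps (k s) c) 0 u = comps h c u)
    (hpos : ∀ x, (comps (k 0) x (coord x)).PosDef)
    (hsymm : ∀ (x : M) (v w : TangentSpace (𝓡 n) x), h x v w = h x w v)
    (hF : SmoothFam n F S) (hr : ∀ s ∈ S, Realizes (k s) (F s) (T s))
    (hs : IsGradientShrinker (k 0) (F 0) (T 0)) :
    (∫ x, scal (k 0) x * Real.exp (-F 0 x) ∂(vol (k 0))) ≠ 0 ∧
    HasDerivAt T (T 0 * ((∫ x, ricciInner (k 0) h x * Real.exp (-F 0 x) ∂(vol (k 0))) /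
      ∫ x, scal (k 0) x * Real.exp (-F 0 x) ∂(vol (k 0)))) 0 := by
  have hm : IsMetric (k 0) := hk.isMetric h0
  have hh : SmoothComps h := hk.smoothComps_deriv h0 hd
  have hne := integral_scal_ne_zero hn hm hpos (hr 0 h0) hs
  refine ⟨hne, ?_⟩
  have hf : SmoothFun n (F 0) := hF.smoothFun h0
  have hτ : 0 < T 0 := (hr 0 h0).1.2.1
  have hn' : (0 : ℝ) < n := Nat.cast_pos.2 hn
  -- Recording all quantities as elements of the commutative algebra of smooth functions, with `E` a
  -- linear functional on it, reduces the conclusion to the purely algebraic `mul_apply_scal_eq`.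
  set E := weightedIntegral hm hf with hE
  have hv : SmoothFun n fun x => deriv (fun s => F s x) 0 := hF.deriv.smoothFun h0
  let f : smoothAlg n M := ⟨F 0, hf⟩
  let v : smoothAlg n M := ⟨fun x => deriv (fun s => F s x) 0, hv⟩
  let t : smoothAlg n M := ⟨trM (k 0) h, hm.smooth_trM hh⟩
  let w : smoothAlg n M := ⟨dotM (k 0) (F 0) (F 0), hm.smooth_dotM hf hf⟩
  let L : smoothAlg n M := ⟨lapM (k 0) (F 0), hm.smooth_lapM hf⟩
  let R : smoothAlg n M := ⟨scal (k 0), hm.smooth_scal⟩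
  let R' : smoothAlg n M := ⟨fun x => deriv (fun s => scal (k s) x) 0,
    (smoothFam_scal hk hS).deriv.smoothFun h0⟩
  let hff : smoothAlg n M := ⟨gradForm (k 0) h (F 0) (F 0), hm.smooth_gradForm hh hf hf⟩
  let hH : smoothAlg n M := ⟨hessInner (k 0) h (F 0), hm.smooth_hessInner hh hf⟩
  let rc : smoothAlg n M := ⟨ricciInner (k 0) h, hm.smooth_ricciInner hh hsymm⟩
  let gv : smoothAlg n M := ⟨dotM (k 0) (F 0) v.1, hm.smooth_dotM hf hv⟩
  -- the quantities to be differentiated, and their derivatives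
  have hc1 : SmoothFam n (fun (_ : ℝ) (_ : M) => (1 : ℝ)) S := (SmoothFun.const 1).smoothFam S
  have hwfam := smoothFam_dotM hk hS hF hF
  have hRfam := smoothFam_scal hk hS
  have hw' : ∀ x, HasDerivAt (fun s => dotM (k s) (F s) (F s) x) ((2 * gv - hff).1 x) 0 :=
    hasDerivAt_dotM hk h0 hd hF
  have hR' : ∀ x, HasDerivAt (fun s => scal (k s) x) (R'.1 x) 0 := fun x => hRfam.hasDerivAt h0 x
  have hv' : ∀ x, HasDerivAt (fun s => F s x) (v.1 x) 0 := fun x => hF.hasDerivAt h0 x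
  have hRw' : ∀ x, HasDerivAt (fun s => scal (k s) x + dotM (k s) (F s) (F s) x)
      ((R' - hff + 2 * gv).1 x) 0 := fun x => by
    refine ((hR' x).fun_add (hw' x)).congr_deriv ?_
    simp only [smoothAlg.add_apply, smoothAlg.sub_apply]; ring
  have key : ∀ {B : ℝ → M → ℝ} (_ : SmoothFam n B S) (b b' : smoothAlg n M) (_ : B 0 = b.1)
      (_ : ∀ x, HasDerivAt (fun s => B s x) (b'.1 x) 0),
      HasDerivAt (fun s => ∫ x, B s x * Real.exp (-F s x) ∂(vol (k s)))
        (E (b' + ((1 / 2 : ℝ) • t - v) * b)) 0 := fun {B} hB b b' hb hb' => by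
    have h1 := hasDerivAt_weightedIntegral hk hS h0 hd hF hB hb'
    rw [hb] at h1
    exact h1
  have dm : HasDerivAt (fun s => mass (k s) (F s)) (E ((1 / 2 : ℝ) • t - v)) 0 := by
    have h1 := key hc1 1 0 rfl fun x => hasDerivAt_const _ _
    simpa only [mass, one_mul, zero_add, mul_one] using h1
  have dS := key (hRfam.add hwfam) (R + w) (R' - hff + 2 * gv) rfl hRw'
  have dP := key hwfam w (2 * gv - hff) rfl hw'
  have dq := key (hF.mul (hRfam.add hwfam)) (f * (R + w)) (v * (R + w) + f * (R' - hff + 2 * gv)) rfl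
    fun x => (hv' x).fun_mul (hRw' x)
  have da₂ := key (hF.mul hF) (f * f) (v * f + f * v) rfl fun x => (hv' x).fun_mul (hv' x)
  have da := key hF f v rfl hv'
  have hm0 : mass (k 0) (F 0) ≠ 0 := (hr 0 h0).1.mass_pos.ne'
  have hE1 : E 1 = mass (k 0) (F 0) := weightedIntegral_one hm hf
  -- the scale is differentiable
  have hTm : ∀ s ∈ S, T s = mass (k s) (F s) ^ (2 / (n : ℝ)) / (4 * Real.pi) := fun s hs => by
    have h1 := (hr s hs).1.2.1
    -- The normalization says that the mass is `(4πT)^{n/2}`; solving it for `T` needs `n > 0`.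
    have h2 : (n : ℝ) / 2 * (2 / n) = 1 := by field_simp
    rw [(hr s hs).1.mass_eq, ← Real.rpow_mul (by positivity), h2, Real.rpow_one]
    field_simp
  have hTd : DifferentiableAt ℝ T 0 := by
    have h1 := (dm.rpow_const (p := 2 / (n : ℝ)) (Or.inl hm0)).div_const (4 * Real.pi)
    refine (h1.congr_of_eventuallyEq ?_).differentiableAt
    filter_upwards [hS.mem_nhds h0] with s hs using hTm s hs
  set T' := deriv T 0 with hT'
  have dT : HasDerivAt T T' 0 := hTd.hasDerivAt
  -- the differentiated equations
  have hc : T' * E (R + w) + T 0 * E (R' - hff + 2 * gv + ((1 / 2 : ℝ) • t - v) * (R + w)) =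
      n / 2 * E ((1 / 2 : ℝ) • t - v) := by
    have h1 := dT.fun_mul dS
    have h2 := dm.const_mul ((n : ℝ) / 2)
    refine (h1.congr_of_eventuallyEq ?_).unique h2
    filter_upwards [hS.mem_nhds h0] with s hs
    exact ((hr s hs).scale_equation (hk.isMetric hs)).symm
  -- `N` is the weighted mean of the potential at `s = 0`.
  obtain ⟨N, hN⟩ : ∃ N, E f = N * E 1 := ⟨E f / E 1, by rw [div_mul_cancel₀]; rwa [hE1]⟩
  have he : 2 * T' * E w + 2 * T 0 * E (2 * gv - hff + ((1 / 2 : ℝ) • t - v) * w) -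
      T' * E (f * (R + w)) -
      T 0 * E (v * (R + w) + f * (R' - hff + 2 * gv) + ((1 / 2 : ℝ) • t - v) * (f * (R + w))) -
      E (2 * f * v + ((1 / 2 : ℝ) • t - v) * (f * f)) +
      (n / 2 + 2 * N) * E (v + ((1 / 2 : ℝ) • t - v) * f) -
      N ^ 2 * E ((1 / 2 : ℝ) • t - v) = 0 := by
    have h1 := ((((dT.const_mul 2).fun_mul dP).fun_sub (dT.fun_mul dq)).fun_sub da₂).fun_add
      (((da.fun_div dm hm0).const_add ((n : ℝ) / 2)).fun_mul da)
    have h2 := (h1.congr_of_eventuallyEq (f₁ := fun _ => (0 : ℝ)) (by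
      filter_upwards [hS.mem_nhds h0] with s hs
      exact ((hr s hs).potential_equation_self (hk.isMetric hs)).symm)).unique
      (hasDerivAt_const (0 : ℝ) (0 : ℝ))
    have h3 : v * f + f * v = 2 * f * v := by ring
    have h4 : (∫ x, F 0 x * Real.exp (-F 0 x) ∂(vol (k 0))) = N * mass (k 0) (F 0) := by
      rw [← hE1, ← hN]; rfl
    have h5 : (∫ x, dotM (k 0) (F 0) (F 0) x * Real.exp (-F 0 x) ∂(vol (k 0))) = E w := rfl
    have h6 : (∫ x, F 0 x * (scal (k 0) x + dotM (k 0) (F 0) (F 0) x) * Real.exp (-F 0 x)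
      ∂(vol (k 0))) = E (f * (R + w)) := rfl
    rw [h4, h5, h6, h3] at h2
    field_simp at h2
    linear_combination h2 / 2
  -- the geometric identities at `s = 0`
  have g₃ := weightedIntegral_green hm hf hf v
  have g₄ := weightedIntegral_green hm hf hf (f * v)
  have hgv : (⟨dotM (k 0) v.1 (F 0), hm.smooth_dotM hv hf⟩ : smoothAlg n M) = gv :=
    Subtype.ext (funext fun x => hm.dotM_comm _ _ x)
  have hfv : (⟨dotM (k 0) (f * v).1 (F 0), hm.smooth_dotM (f * v).2 hf⟩ : smoothAlg n M) =
      f * gv + v * w := Subtype.ext (funext fun x => by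
    rw [← hgv, smoothAlg.add_apply, smoothAlg.mul_apply, smoothAlg.mul_apply]
    exact dotM_mul_left (k 0) hf hv (F 0) x)
  rw [hgv] at g₃
  rw [hfv] at g₄
  have v₁ : E (R' + rc - (hff - hH) + t * (w - L)) = 0 := by
    rw [← integral_variation_scal_comp hk hS h0 hd hsymm hasDerivAt_exp_neg hasDerivAt_neg_exp_neg
      hf hf.exp_neg]
    refine integral_congr_ae (Eventually.of_forall fun x => ?_)
    simp only [smoothAlg.add_apply, smoothAlg.sub_apply, smoothAlg.mul_apply]
    ring
  have v₂ : E (f * R' + f * rc - ((1 - f) * hH + (f - 2) * hff) +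
      t * ((1 - f) * L + (f - 2) * w)) = 0 := by
    rw [← integral_variation_scal_comp hk hS h0 hd hsymm hasDerivAt_mul_exp_neg
      hasDerivAt_one_sub_mul_exp_neg hf (hf.mul hf.exp_neg)]
    refine integral_congr_ae (Eventually.of_forall fun x => ?_)
    simp only [smoothAlg.add_apply, smoothAlg.sub_apply, smoothAlg.mul_apply,
      smoothAlg.one_apply, smoothAlg.two_apply]
    ring
  have hR : R + L = ((n : ℝ) / (2 * T 0)) • (1 : smoothAlg n M) :=
    Subtype.ext (funext fun x => by
      simp only [smoothAlg.add_apply, smoothAlg.smul_apply, smoothAlg.one_apply, mul_one]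
      exact hm.soliton_scal hs x)
  have hrc : rc + hH = (1 / (2 * T 0)) • t :=
    Subtype.ext (funext fun x => by
      simp only [smoothAlg.add_apply, smoothAlg.smul_apply]
      exact hm.soliton_ricciInner hs hsymm x)
  have hfin : T' * E R = T 0 * E rc := mul_apply_scal_eq E f v t w L R R' hff hH rc gv (n := n)
    hτ.ne' hN hR hrc (weightedIntegral_green_one hm hf hf) (weightedIntegral_green hm hf hf f)
    g₃ g₄ v₁ v₂ (weightedIntegral_potential hm hf (hr 0 h0) hs hN) hc he
  refine dT.congr_deriv ?_
  rw [← mul_div_assoc, eq_div_iff hne]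
  exact hfin

end Variation

end

end ShrinkerEntropy

open ShrinkerEntropy in
theorem lemma2p4 {n : ℕ} (hn : 0 < n) {M : Type*} [TopologicalSpace M] [T2Space M] [CompactSpace M]
    [ChartedSpace (EuclideanSpace ℝ (Fin n)) M] [IsManifold (𝓡 n) ∞ M]
    [MeasurableSpace M] [BorelSpace M]
    -- a compact gradient shrinker `(M, g, f)` with scale `τ`
    (g : Bundle.ContMDiffRiemannianMetric (𝓡 n) ∞ (EuclideanSpace ℝ (Fin n))
      (fun x : M => TangentSpace (𝓡 n) x))
    (f : M → ℝ) (τ : ℝ) (hsol : IsGradientShrinker g.inner f τ)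
    -- a smooth symmetric 2-tensor `h`
    (h : Tensor2 n M) (hsmooth : h.Smooth) (hsymm : ∀ (x : M) (v w : TangentSpace (𝓡 n) x),
      h x v w = h x w v)
    -- pairs `(F s, T s)` that realize `ν(g + s h)`, with `F` smooth, starting at `(f, τ)`
    (ε : ℝ) (hε : 0 < ε) (F : ℝ → M → ℝ) (T : ℝ → ℝ)
    (hF : ContMDiffOn (𝓘(ℝ, ℝ).prod (𝓡 n)) 𝓘(ℝ, ℝ) ∞ (fun q : ℝ × M => F q.1 q.2)
      (Set.Ioo (-ε) ε ×ˢ Set.univ))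
    (hreal : ∀ s ∈ Set.Ioo (-ε) ε, Realizes (fun x : M => g.inner x + s • h x) (F s) (T s))
    (hF0 : F 0 = f) (hT0 : T 0 = τ) :
    (∫ x, scal g.inner x * Real.exp (-f x) ∂(vol g.inner)) ≠ 0 ∧
    HasDerivAt T
      (τ * ((∫ x, ricciInner g.inner h x * Real.exp (-f x) ∂(vol g.inner)) /
        ∫ x, scal g.inner x * Real.exp (-f x) ∂(vol g.inner))) 0 := by
  obtain ⟨δ, hδ, hfam⟩ := exists_isMetricFam g hsmooth hsymm
  have h0 : (0 : ℝ) ∈ Set.Ioo (-δ) δ ∩ Set.Ioo (-ε) ε := ⟨⟨by linarith, hδ⟩, ⟨by linarith, hε⟩⟩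
  -- The family is named through an equation, so that `k` is opaque and `k 0` can be rewritten to
  -- `g.inner`.
  obtain ⟨k, hk⟩ : ∃ k : ℝ → Tensor2 n M, k = fun s x => g.inner x + s • h x := ⟨_, rfl⟩
  have hk0 : k 0 = g.inner := hk ▸ add_zero_smul g.inner h
  have hd : ∀ c : M, ∀ u ∈ (chartAt (EuclideanSpace ℝ (Fin n)) c).target,
      dsM (fun s => comps (k s) c) 0 u = comps h c u := fun c u _ =>
    hk ▸ dsM_comps_add_smul g.inner h 0 c u
  have hreal' : ∀ s ∈ Set.Ioo (-δ) δ ∩ Set.Ioo (-ε) ε, Realizes (k s) (F s) (T s) := fun s hs =>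
    hk ▸ hreal s hs.2
  rw [← hk] at hfam
  subst hF0 hT0
  have hmain := hasDerivAt_scale hn
    (hfam.mono (isOpen_Ioo.inter isOpen_Ioo) Set.inter_subset_left)
    (isOpen_Ioo.inter isOpen_Ioo) h0 hd
    (fun x => hk0 ▸ comps_posDef g (coord_mem_target x)) hsymm
    ((smoothFam_of_contMDiffOn isOpen_Ioo hF).mono Set.inter_subset_right)
    hreal' (hk0 ▸ hsol)
  rwa [hk0] at hmain
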